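/- Conventions. Let $x^\perp=(-x_2,x_1)$ and $\mathbb T=\mathbb R/2\pi\mathbb Z$; functions on $\mathbb R/L\mathbb Z$ are identified with $L$-periodic functions on $\mathbb R$. A *patch domain* is a bounded, connected, nonempty open set $\Omega\subset\mathbb R^2$ whose boundary is a simple closed curve. An *$L$-periodic parametrization* of $\partial\Omega$ is a $C^1$, $L$-periodic map $\gamma:\mathbb R\to\mathbb R^2$ with $\gamma'\neq0$ everywhere, which is injective on $[0,L)$, has image $\partial\Omega$, and is counterclockwise oriented ($\Omega$ lies to the left of $\gamma$); it is an *arc-length* parametrization if $|\gamma'|\equiv1$, and then $L>0$ is the length of $\partial\Omega$. For $p\in[1,\infty]$, $\|\Omega\|_{W^{2,p}}$ denotes the norm $\|\gamma\|_{L^p}+\|\gamma'\|_{L^p}+\|\gamma''\|_{L^p}$ over $[-L/2,L/2]$ (weak derivatives) of an arc-length parametrization $\gamma$ of $\partial\Omega$, with value $\infty$ if there is no arc-length parametrization of class $W^{2,p}$. The norm of $C^{1,\sigma}(\mathbb T)$ is $\sup|f|+\sup|f'|+\sup_{x\ne y}|f'(x)-f'(y)|/|x-y|^\sigma$. A family $(\Omega_t)_{t\in[0,T]}$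 of patch domains generates the velocity field $$v(x,t)=\int_{\Omega_t}\frac{(x-y)^\perp}{|x-y|^{2+2\alpha}}\,dy .$$ It is an *$\alpha$-patch* on $[0,T]$ if for every $\varphi\in C_c^\infty(\mathbb R^2\times[0,T))$ $$\int_{\Omega_0}\varphi(x,0)\,dx=-\int_0^T\!\!\int_{\mathbb R^2}\chi_{\Omega_t}\,(\partial_t\varphi+v\cdot\nabla\varphi)\,dx\,dt ,$$ and a *$W^{2,p}$ $\alpha$-patch* if moreover $\sup_{t\in[0,T]}\|\Omega_t\|_{W^{2,p}}<\infty$. Theorem. Let $0<\alpha<\tfrac12$, $\tfrac1{1-2\alpha}<p\le\infty$, $T>0$ and $\sigma=1-\tfrac1p-2\alpha$. Let $(\Omega_t)_{t\in[0,T]}$ be a $W^{2,p}$ $\alpha$-patch whose boundary $\partial\Omega_t$ depends continuously on $t\in[0,T]$ in the Hausdorff distance, and let $v$ be its velocity field. Let $\gamma_0\in W^{2,p}(\mathbb T)$ be a $2\pi$-periodic parametrization of $\partial\Omega_0$. Then $\sigma>0$, and the Cauchy problem $$\partial_t\gamma(x,t)=v(\gamma(x,t),t)\quad\text{for all }(x,t)\in\mathbb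 T\times[0,T],\qquad \gamma(\cdot,0)=\gamma_0,$$ (with one-sided time derivatives at $t=0,T$) has exactly one solution $\gamma\in C([0,T];C^{1,\sigma}(\mathbb T))$. Moreover, for every $t\in[0,T]$ the map $\gamma(\cdot,t)$ is a $2\pi$-periodic parametrization of $\partial\Omega_t$. -/

import Mathlib

open Set Filter Topology MeasureTheory
open scoped ENNReal NNReal ContDiff

noncomputable section

namespace AlphaPatch

/-- The Euclidean plane. -/
abbrev Plane : Type := EuclideanSpace ℝ (Fin 2)

/-- Counterclockwise rotation by a right angle. -/
def perp (x : Plane) : Plane := !₂[-x 1, x 0]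

/-- The modified Biot-Savart law (with constant one): the convolution of the kernel
`z ↦ z^⊥ / |z|^(2 + 2 α)` with the scalar `w`. -/
def biotSavart (α : ℝ) (w : Plane → ℝ) (x : Plane) : Plane :=
  ∫ y, (w y / ‖x - y‖ ^ (2 + 2 * α)) • perp (x - y)

/-- The velocity field generated by a moving domain. -/
def velocity (α : ℝ) (Ω : ℝ → Set Plane) (x : Plane) (t : ℝ) : Plane :=
  biotSavart α ((Ω t).indicator 1) x

/-- `g` is the weak (distributional) derivative of `f` on the line. For periodic functions this
is the weak derivative on the torus. -/
def HasWeakDeriv (f g : ℝ → Plane) : Prop :=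
  LocallyIntegrable f ∧ LocallyIntegrable g ∧
    ∀ φ : ℝ → ℝ, ContDiff ℝ ∞ φ → HasCompactSupport φ →
      ∫ x, deriv φ x • f x = -∫ x, φ x • g x

/-- The `W^{2,p}` norm, over one period `[-L/2, L/2]`, of an `L`-periodic function. Weak
derivatives are unique up to null sets, so the infimum is over at most one value; it is `⊤` when
`f` is not twice weakly differentiable. -/
def w2pNorm (p : ℝ≥0∞) (L : ℝ) (f : ℝ → Plane) : ℝ≥0∞ :=
  ⨅ (g : ℝ → Plane) (h : ℝ → Plane) (_ : HasWeakDeriv f g) (_ : HasWeakDeriv g h),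
    eLpNorm f p (volume.restrict (Icc (-L / 2) (L / 2))) +
      eLpNorm g p (volume.restrict (Icc (-L / 2) (L / 2))) +
      eLpNorm h p (volume.restrict (Icc (-L / 2) (L / 2)))

/-- The `C^{1,σ}` norm (for `0 ≤ σ`) of a `C^1` periodic function. -/
def c1HolderNorm (σ : ℝ) (f : ℝ → Plane) : ℝ≥0∞ :=
  (⨆ x, ‖f x‖ₑ) + (⨆ x, ‖deriv f x‖ₑ) + eHolderNorm σ.toNNReal (deriv f)

/-- A bounded domain of the plane whose boundary is a simple closed curve. -/
structure IsPatchDomain (Ω : Set Plane) : Prop where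
  isOpen : IsOpen Ω
  isConnected : IsConnected Ω
  isBounded : Bornology.IsBounded Ω
  simpleClosedBoundary : ∃ c : ℝ → Plane, Continuous c ∧ Function.Periodic c 1 ∧
    InjOn c (Ico 0 1) ∧ range c = frontier Ω

/-- `γ` is an `L`-periodic counterclockwise `C^1` parametrization of the simple closed curve
`∂Ω`, run through once per period. -/
structure IsParametrization (L : ℝ) (γ : ℝ → Plane) (Ω : Set Plane) : Prop where
  contDiff : ContDiff ℝ 1 γ
  periodic : Function.Periodic γ L
  deriv_ne_zero : ∀ x, deriv γ x ≠ 0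
  injOn : InjOn γ (Ico 0 L)
  range_eq : range γ = frontier Ω
  /-- The domain lies to the left of the curve. -/
  counterclockwise : ∀ x, ∀ᶠ ε in 𝓝[>] (0 : ℝ), γ x + ε • perp (deriv γ x) ∈ Ω

/-- `γ` is an arc-length parametrization of `∂Ω`, and `L` is the length of `∂Ω`. -/
structure IsArcLengthParametrization (L : ℝ) (γ : ℝ → Plane) (Ω : Set Plane) : Prop
    extends IsParametrization L γ Ω where
  length_pos : 0 < L
  norm_deriv : ∀ x, ‖deriv γ x‖ = 1

/-- The norm `‖Ω‖_{W^{2,p}}`: the `W^{2,p}` norm of an arc-length parametrization of `∂Ω`. All of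
these differ by a translation of the variable, so the infimum is over at most one value. -/
def domainW2pNorm (p : ℝ≥0∞) (Ω : Set Plane) : ℝ≥0∞ :=
  ⨅ (L : ℝ) (γ : ℝ → Plane) (_ : IsArcLengthParametrization L γ Ω), w2pNorm p L γ

/-- The moving domain `Ω` is an `α`-patch on `[0, T]`: its characteristic function is a weak
solution of the `α`-SQG equation. The test functions, restricted to nonnegative times, are those
of `C_c^∞(ℝ² × [0, T))`. -/
structure IsAlphaPatch (α T : ℝ) (Ω : ℝ → Set Plane) : Prop where
  isPatchDomain : ∀ t ∈ Icc 0 T, IsPatchDomain (Ω t)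
  weakSolution : ∀ φ : Plane × ℝ → ℝ, ContDiff ℝ ∞ φ → HasCompactSupport φ →
    tsupport φ ⊆ {z | z.2 < T} →
      ∫ x in Ω 0, φ (x, 0) =
        -∫ t in (0 : ℝ)..T, ∫ x, (Ω t).indicator (1 : Plane → ℝ) x *
          (deriv (fun s => φ (x, s)) t + fderiv ℝ (fun y => φ (y, t)) x (velocity α Ω x t))

/-- The moving domain `Ω` is a `W^{2,p}` `α`-patch on `[0, T]`. -/
structure IsW2pAlphaPatch (α T : ℝ) (p : ℝ≥0∞) (Ω : ℝ → Set Plane) : Prop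
    extends IsAlphaPatch α T Ω where
  sup_norm_lt_top : ⨆ t ∈ Icc 0 T, domainW2pNorm p (Ω t) < ⊤

/-- The boundary of the moving domain depends continuously on time in the Hausdorff distance. -/
def BoundaryContinuous (T : ℝ) (Ω : ℝ → Set Plane) : Prop :=
  ∀ t ∈ Icc 0 T, Tendsto (fun s => Metric.hausdorffDist (frontier (Ω s)) (frontier (Ω t)))
    (𝓝[Icc 0 T] t) (𝓝 0)

/-- `γ ∈ C([0, T]; C^{1,σ}(𝕋))`, where `𝕋 = ℝ / 2πℤ`. -/
structure IsContinuousC1Holder (T σ : ℝ) (γ : ℝ → ℝ → Plane) : Prop where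
  periodic : ∀ t ∈ Icc 0 T, Function.Periodic (fun x => γ x t) (2 * Real.pi)
  contDiff : ∀ t ∈ Icc 0 T, ContDiff ℝ 1 (fun x => γ x t)
  norm_lt_top : ∀ t ∈ Icc 0 T, c1HolderNorm σ (fun x => γ x t) < ⊤
  continuous : ∀ t ∈ Icc 0 T,
    Tendsto (fun s => c1HolderNorm σ (fun x => γ x s - γ x t)) (𝓝[Icc 0 T] t) (𝓝 0)

/-- `γ(x, t)` solves `∂_t γ = v(γ, t)` on `𝕋 × [0, T]` with `γ(·, 0) = γ₀`, where `v` is the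
velocity field of the moving domain `Ω` (one-sided time derivatives at `0` and `T`). -/
structure SolvesFlow (α T : ℝ) (Ω : ℝ → Set Plane) (γ₀ : ℝ → Plane) (γ : ℝ → ℝ → Plane) :
    Prop where
  initial : ∀ x, γ x 0 = γ₀ x
  flow : ∀ x, ∀ t ∈ Icc 0 T,
    HasDerivWithinAt (fun s => γ x s) (velocity α Ω (γ x t) t) (Icc 0 T) t

end AlphaPatch

end

namespace AlphaPatch

/-! ### Rotation of the plane -/

/-! Write `β = 1 - 1/p`, so that `σ = β - 2α` and the lower bound on `p` says exactly `σ > 0`. In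
the plane `v` is merely continuous, but along `∂Ω_t` it is much better, because the boundary is
uniformly `C^{1,β}`.

By Gauss-Green (`HolderCurve.gaussGreen`), `2α v(X)` is the integral of `|X - Γ(s')|^{-2α} Γ'(s')`
along the boundary. Differentiating along the curve and subtracting a total derivative in `s'`
leaves a kernel of size `|s - s'|^{β - 2α - 1}`. Hence `v` restricted to the boundary is `C^{1,σ}`.
Off the boundary, only the component of `v(X) - v(P)` normal to the curve at the nearest point `P`
is Lipschitz in the distance; the tangential component is irrelevant, since it only slides the
boundary along itself. All this is done for the kernel smoothed at scale `ε`, with bounds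
independent of `ε`, and collected in `exists_curveField`.

The bounds must be uniform in time, which needs a uniform arc-chord condition
(`MovingCurve.exists_uniform_arcChord`). A curve with controlled tangents that is Hausdorff-close to
a given one has nearly the same tangents up to one global sign. If it came back close to itself, a
short normal segment would cross it twice in a row in the same direction, which is impossible for
the boundary of a domain lying on its left. Compactness of `[0,T]` then gives uniform constants.

The weak equation enters once, in `MovingCurve.eventually_motion`. A bump of radius `ε|h|` travels
with the velocity of a boundary point. The mass of `Ω_t` under it changes little, because the
relative velocity is small; if the boundary at time `t + h` missed the bump, that mass would have to
jump to zero or to its maximum. So the boundary moves with `v` to first order.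

A Grönwall argument for the distance to the moving boundary (`FlowFamily.mem_of_hasDerivWithinAt`)
confines every solution starting on it, and uniqueness follows from the Lipschitz bound there. For
existence (`FlowFamily.exists_flow`), `v` is extended from the boundary to a Lipschitz field of the
plane, whose trajectories stay on the boundary by the same argument. Reversing time gives
injectivity and surjectivity onto `∂Ω_t`. Difference quotients of the flow solve a linear equation
up to an error of order `|h|^σ`, whence the `C^{1,σ}` regularity
(`FlowMap.exists_norm_flowQuot_sub_le`). Orientation is preserved because a point pushed off the
curve along the rotated tangent never meets the boundary
(`MovingCurve.eventually_add_smul_perp_mem`). -/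

lemma inner_plane (x y : Plane) : inner ℝ x y = x 0 * y 0 + x 1 * y 1 := by
  simp [PiLp.inner_apply, Fin.sum_univ_two, mul_comm]

lemma norm_sq_plane (x : Plane) : ‖x‖ ^ 2 = x 0 ^ 2 + x 1 ^ 2 := by
  rw [← real_inner_self_eq_norm_sq, inner_plane]; ring

@[simp] lemma perp_apply_zero (x : Plane) : perp x 0 = -x 1 := rfl
@[simp] lemma perp_apply_one (x : Plane) : perp x 1 = x 0 := rfl

lemma plane_ext {x y : Plane} (h0 : x 0 = y 0) (h1 : x 1 = y 1) : x = y := by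
  ext i; fin_cases i <;> assumption

lemma perp_add (x y : Plane) : perp (x + y) = perp x + perp y := by
  apply plane_ext <;> simp; ring

lemma perp_smul (c : ℝ) (x : Plane) : perp (c • x) = c • perp x := by
  apply plane_ext <;> simp

lemma norm_perp (x : Plane) : ‖perp x‖ = ‖x‖ := by
  rw [← sq_eq_sq₀ (norm_nonneg _) (norm_nonneg _), norm_sq_plane, norm_sq_plane]
  simp; ring

/-- The rotation by a right angle as a linear isometry. -/
def perpL : Plane →ₗᵢ[ℝ] Plane where
  toFun := perp
  map_add' := perp_add
  map_smul' := perp_smul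
  norm_map' := norm_perp


lemma perp_sub (x y : Plane) : perp (x - y) = perp x - perp y := perpL.map_sub x y
lemma perp_neg (x : Plane) : perp (-x) = -perp x := perpL.map_neg x
@[fun_prop] lemma continuous_perp : Continuous perp := perpL.continuous
lemma perp_perp (x : Plane) : perp (perp x) = -x := by apply plane_ext <;> simp
lemma inner_perp_self (x : Plane) : inner ℝ x (perp x) = 0 := by
  rw [inner_plane]; simp; ring
lemma inner_perp_perp (x y : Plane) : inner ℝ (perp x) (perp y) = inner ℝ x y := by
  rw [inner_plane, inner_plane]; simp; ring

/-- Expansion in the orthonormal frame `(e, e^⊥)`. -/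
lemma frame_expansion {e : Plane} (he : ‖e‖ = 1) (x : Plane) :
    x = inner ℝ e x • e + inner ℝ (perp e) x • perp e := by
  have h := norm_sq_plane e
  rw [he] at h
  apply plane_ext <;> simp only [inner_plane, perp_apply_zero, perp_apply_one, PiLp.add_apply,
    PiLp.smul_apply, smul_eq_mul]
  · linear_combination (x 0) * h
  · linear_combination (x 1) * h

lemma norm_sq_frame {e : Plane} (he : ‖e‖ = 1) (x : Plane) :
    ‖x‖ ^ 2 = inner ℝ e x ^ 2 + inner ℝ (perp e) x ^ 2 := by
  have h := norm_sq_plane e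
  rw [he] at h
  simp only [norm_sq_plane x, inner_plane, perp_apply_zero, perp_apply_one]
  linear_combination (x 0 ^ 2 + x 1 ^ 2) * h

/-! ### Weak derivatives -/

lemma integral_deriv_smul_eq_neg {φ : ℝ → ℝ} {f : ℝ → Plane} (hφ : ContDiff ℝ ∞ φ)
    (hφc : HasCompactSupport φ) (hf : ContDiff ℝ 1 f) :
    ∫ x, deriv φ x • f x = -∫ x, φ x • deriv f x := by
  have hdφ : Continuous (deriv φ) := (hφ.of_le (by simp) : ContDiff ℝ 1 φ).continuous_deriv le_rfl
  have hdf : Continuous (deriv f) := hf.continuous_deriv le_rfl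
  have h1 : Integrable (fun x => deriv φ x • f x) :=
    (hdφ.smul hf.continuous).integrable_of_hasCompactSupport (hφc.deriv.smul_right)
  have h2 : Integrable (fun x => φ x • deriv f x) :=
    (hφ.continuous.smul hdf).integrable_of_hasCompactSupport (hφc.smul_right)
  have h3 : ∫ x, (φ x • deriv f x + deriv φ x • f x) = 0 := by
    refine integral_eq_zero_of_hasDerivAt_of_integrable (f := fun x => φ x • f x) (fun x => ?_)
      (h2.add h1) ((hφ.continuous.smul hf.continuous).integrable_of_hasCompactSupport
        (hφc.smul_right))
    exact ((hφ.differentiable (by simp)) x).hasDerivAt.smul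
      ((hf.differentiable (by simp)) x).hasDerivAt
  rw [integral_add h2 h1] at h3
  rw [eq_neg_iff_add_eq_zero, add_comm]; exact h3

/-- Identifies the competitors in the infimum defining `w2pNorm` with the classical first
derivative. -/
lemma HasWeakDeriv.ae_eq_deriv {f g : ℝ → Plane} (hf : ContDiff ℝ 1 f) (h : HasWeakDeriv f g) :
    g =ᵐ[volume] deriv f := by
  have hdf : Continuous (deriv f) := hf.continuous_deriv le_rfl
  have := ae_eq_zero_of_integral_contDiff_smul_eq_zero (μ := volume)
    (f := fun x => g x - deriv f x) (h.2.1.sub hdf.locallyIntegrable) (fun φ hφ hφc => ?_)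
  · filter_upwards [this] with x hx using sub_eq_zero.1 hx
  · have h1 := h.2.2 φ hφ hφc
    rw [integral_deriv_smul_eq_neg hφ hφc hf, neg_inj] at h1
    simp only [smul_sub]
    rw [integral_sub, h1, sub_self]
    · exact h.2.1.integrable_smul_left_of_hasCompactSupport hφ.continuous hφc
    · exact (hφ.continuous.smul hdf).integrable_of_hasCompactSupport (hφc.smul_right)

lemma HasWeakDeriv.congr_left {f f' g : ℝ → Plane} (h : HasWeakDeriv f g)
    (hff : f =ᵐ[volume] f') (hf' : Continuous f') : HasWeakDeriv f' g := by
  refine ⟨hf'.locallyIntegrable, h.2.1, fun φ hφ hφc => ?_⟩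
  rw [← h.2.2 φ hφ hφc]
  apply integral_congr_ae
  filter_upwards [hff] with x hx
  rw [hx]

/-- A continuous function is controlled by the integral of its weak derivative. -/
lemma norm_sub_le_of_weakDeriv_on {E : Type*} [NormedAddCommGroup E] [NormedSpace ℝ E]
    [CompleteSpace E] {f g : ℝ → E} (hf : Continuous f) {a b : ℝ} (hab : a < b)
    (hg : IntegrableOn g (Icc a b))
    (h : ∀ φ : ℝ → ℝ, ContDiff ℝ ∞ φ → (∀ x, x ∉ Icc a b → φ x = 0) →
      ∫ x, deriv φ x • f x = -∫ x, φ x • g x) : ‖f b - f a‖ ≤ ∫ x in Icc a b, ‖g x‖ := by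
  -- smooth approximations of the difference of two Dirac masses
  have hgi : IntegrableOn (fun x => ‖g x‖) (Icc a b) := hg.norm
  have key : ∀ ε : ℝ, 0 < ε → ε < (b - a) / 4 → ∃ η : ℝ → ℝ, (∀ x, 0 ≤ η x) ∧
      ContDiff ℝ ∞ η ∧ (∀ x, ε ≤ |x| → η x = 0) ∧ ∫ x, η x = 1 ∧
      ‖(∫ x, η (x - (b - ε)) • f x) - ∫ x, η (x - (a + ε)) • f x‖ ≤ ∫ x in Icc a b, ‖g x‖ := by
    intro ε hε hεab
    let B : ContDiffBump (0 : ℝ) := ⟨ε / 2, ε, by linarith, by linarith⟩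
    let η : ℝ → ℝ := B.normed volume
    have hη0 : ∀ x, 0 ≤ η x := fun x => B.nonneg_normed x
    have hηs : ContDiff ℝ ∞ η := B.contDiff_normed
    have hηz : ∀ x, ε ≤ |x| → η x = 0 := by
      intro x hx
      by_contra hne
      have : x ∈ Function.support η := hne
      rw [show Function.support η = Metric.ball (0 : ℝ) B.rOut from B.support_normed_eq] at this
      rw [Metric.mem_ball, Real.dist_eq, sub_zero] at this
      exact absurd this (not_lt.2 hx)
    have hη1 : ∫ x, η x = 1 := B.integral_normed
    have hηc : HasCompactSupport η := B.hasCompactSupport_normed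
    refine ⟨η, hη0, hηs, hηz, hη1, ?_⟩
    -- The primitive `φ` of `ψ` is, up to sign, a smoothed indicator of `[a, b]`. The two bumps have
    -- equal mass, and their centres are moved inwards by `ε`, so `φ` vanishes off `[a, b]`; it is
    -- bounded by `1`.
    let ψ : ℝ → ℝ := fun x => η (x - (b - ε)) - η (x - (a + ε))
    have hψs : ContDiff ℝ ∞ ψ := by
      apply ContDiff.sub <;> exact hηs.comp (contDiff_id.sub contDiff_const)
    let φ : ℝ → ℝ := fun x => ∫ y in a..x, ψ y
    have hφd : ∀ x, HasDerivAt φ (ψ x) x := fun x =>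
      intervalIntegral.integral_hasDerivAt_right (hψs.continuous.intervalIntegrable _ _)
        (hψs.continuous.stronglyMeasurableAtFilter _ _) hψs.continuous.continuousAt
    have hdφ : deriv φ = ψ := funext fun x => (hφd x).deriv
    have hφs : ContDiff ℝ ∞ φ := by
      rw [contDiff_infty_iff_deriv, hdφ]
      exact ⟨fun x => (hφd x).differentiableAt, hψs⟩
    have hηi : ∀ c, Integrable (fun x => η (x - c)) := fun c =>
      (hηs.continuous.integrable_of_hasCompactSupport hηc).comp_sub_right c
    have hle1 : ∀ c x, a ≤ x → ∫ y in a..x, η (y - c) ≤ 1 := by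
      intro c x hx
      rw [intervalIntegral.integral_of_le hx]
      calc ∫ y in Ioc a x, η (y - c) ≤ ∫ y, η (y - c) :=
            setIntegral_le_integral (hηi c) (Eventually.of_forall fun u => hη0 _)
        _ = 1 := by rw [integral_sub_right_eq_self (μ := volume) η c]; exact hη1
    have hfull : ∀ c x, a ≤ c - ε → c + ε ≤ x → ∫ y in a..x, η (y - c) = 1 := by
      intro c x h1 h2
      rw [← hη1, ← integral_sub_right_eq_self (μ := volume) η c]
      rw [intervalIntegral.integral_of_le (by linarith)]
      apply setIntegral_eq_integral_of_forall_compl_eq_zero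
      intro y hy
      apply hηz
      rw [mem_Ioc, not_and_or] at hy
      rcases hy with hy | hy
      · rw [abs_of_nonpos] <;> linarith
      · rw [abs_of_nonneg] <;> linarith
    have hφe : ∀ x, φ x = (∫ y in a..x, η (y - (b - ε))) - ∫ y in a..x, η (y - (a + ε)) := by
      intro x
      exact intervalIntegral.integral_sub ((hηi _).intervalIntegrable)
        ((hηi _).intervalIntegrable)
    have hφout : ∀ x, x ∉ Icc a b → φ x = 0 := by
      intro x hx
      rw [mem_Icc, not_and_or] at hx
      rcases hx with hx | hx
      · have : ∀ y ∈ uIcc a x, ψ y = 0 := by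
          intro y hy
          rw [uIcc_of_ge (by linarith)] at hy
          have h1 := hηz (y - (b - ε)) (by rw [abs_of_nonpos] <;> linarith [hy.2])
          have h2 := hηz (y - (a + ε)) (by rw [abs_of_nonpos] <;> linarith [hy.2])
          simp [ψ, h1, h2]
        exact (intervalIntegral.integral_congr this).trans (by simp)
      · rw [hφe, hfull _ _ (by linarith) (by linarith), hfull _ _ (by linarith) (by linarith),
          sub_self]
    have hφ1 : ∀ x ∈ Icc a b, |φ x| ≤ 1 := by
      intro x hx
      rw [hφe]
      have h1 := hle1 (b - ε) x hx.1
      have h2 := hle1 (a + ε) x hx.1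
      have h3 := intervalIntegral.integral_nonneg (μ := volume) (f := fun y => η (y - (b - ε))) hx.1
        fun u _ => hη0 _
      have h4 := intervalIntegral.integral_nonneg (μ := volume) (f := fun y => η (y - (a + ε))) hx.1
        fun u _ => hη0 _
      rw [abs_le]; constructor <;> linarith
    have hw := h φ hφs hφout
    have hint : ∀ c, Integrable (fun x => η (x - c) • f x) := fun c =>
      ((hηs.continuous.comp (by fun_prop : Continuous fun x : ℝ => x - c)).smul
        hf).integrable_of_hasCompactSupport
        ((hηc.comp_homeomorph (Homeomorph.subRight c)).smul_right)
    have : (∫ x, η (x - (b - ε)) • f x) - ∫ x, η (x - (a + ε)) • f x = -∫ x, φ x • g x := by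
      rw [← hw, ← integral_sub (hint _) (hint _), hdφ]
      simp only [ψ, sub_smul]
    rw [this, norm_neg, ← setIntegral_eq_integral_of_forall_compl_eq_zero (s := Icc a b)
      (fun x hx => by rw [hφout x hx, zero_smul])]
    apply norm_integral_le_of_norm_le hgi
    filter_upwards [ae_restrict_mem measurableSet_Icc] with x hx
    rw [norm_smul, Real.norm_eq_abs]
    exact mul_le_of_le_one_left (norm_nonneg _) (hφ1 x hx)
  -- conclude by continuity
  refine le_of_forall_pos_le_add fun δ hδ => ?_
  obtain ⟨r, hr, hra⟩ := Metric.continuous_iff.1 hf a (δ / 2) (by positivity)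
  obtain ⟨r', hr', hrb⟩ := Metric.continuous_iff.1 hf b (δ / 2) (by positivity)
  obtain ⟨ε, hε, hεm⟩ : ∃ ε : ℝ, 0 < ε ∧ ε < min ((b - a) / 4) (min (r / 2) (r' / 2)) :=
    exists_between (by simp; exact ⟨by linarith, hr, hr'⟩)
  simp only [lt_min_iff] at hεm
  obtain ⟨η, hη0, hηs, hηz, hη1, hle⟩ := key ε hε hεm.1
  have hηc : HasCompactSupport η := by
    refine HasCompactSupport.intro (isCompact_Icc (a := -ε) (b := ε)) fun x hx => hηz x ?_
    by_contra hlt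
    rw [not_le, abs_lt] at hlt
    exact hx ⟨hlt.1.le, hlt.2.le⟩
  have approx : ∀ c d : ℝ, (∀ x, dist x d < 2 * ε → dist (f x) (f d) < δ / 2) → |c - d| ≤ ε →
      ‖(∫ x, η (x - c) • f x) - f d‖ ≤ δ / 2 := by
    intro c d hcl hcd
    have hηi : Integrable (fun x => η (x - c)) :=
      (hηs.continuous.integrable_of_hasCompactSupport hηc).comp_sub_right c
    have hint : Integrable (fun x => η (x - c) • f x) :=
      ((hηs.continuous.comp (by fun_prop : Continuous fun x : ℝ => x - c)).smul
        hf).integrable_of_hasCompactSupport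
        ((hηc.comp_homeomorph (Homeomorph.subRight c)).smul_right)
    have h1 : ∫ x, η (x - c) = 1 := by
      rw [integral_sub_right_eq_self (μ := volume) η c]; exact hη1
    have h2 : f d = ∫ x, η (x - c) • f d := by
      rw [integral_smul_const, h1, one_smul]
    rw [h2, ← integral_sub hint (hηi.smul_const _)]
    calc ‖∫ x, (η (x - c) • f x - η (x - c) • f d)‖ ≤ ∫ x, η (x - c) * (δ / 2) := by
          apply norm_integral_le_of_norm_le (hηi.mul_const _)
          refine Eventually.of_forall fun x => ?_
          rw [← smul_sub, norm_smul, Real.norm_eq_abs, abs_of_nonneg (hη0 _)]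
          by_cases hx : ε ≤ |x - c|
          · rw [hηz _ hx]; simp
          · apply mul_le_mul_of_nonneg_left _ (hη0 _)
            rw [← dist_eq_norm]
            refine (hcl x ?_).le
            rw [Real.dist_eq]
            calc |x - d| = |(x - c) + (c - d)| := by ring_nf
              _ ≤ |x - c| + |c - d| := abs_add_le _ _
              _ < 2 * ε := by linarith [not_le.1 hx]
      _ = δ / 2 := by rw [integral_mul_const, h1, one_mul]
  have ha := approx (a + ε) a (fun x hx => hra x (by linarith)) (by simp [abs_of_pos hε])
  have hb := approx (b - ε) b (fun x hx => hrb x (by linarith)) (by simp [abs_of_pos hε])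
  set I₁ := ∫ x, η (x - (b - ε)) • f x
  set I₂ := ∫ x, η (x - (a + ε)) • f x
  calc ‖f b - f a‖ = ‖-(I₁ - f b) + (I₁ - I₂) + (I₂ - f a)‖ := by congr 1; abel
    _ ≤ ‖I₁ - f b‖ + ‖I₁ - I₂‖ + ‖I₂ - f a‖ := by
        refine (norm_add₃_le).trans ?_
        rw [norm_neg]
    _ ≤ _ := by linarith

lemma HasWeakDeriv.norm_sub_le {f g : ℝ → Plane} (h : HasWeakDeriv f g) (hf : Continuous f)
    {a b : ℝ} (hab : a < b) : ‖f b - f a‖ ≤ ∫ x in Icc a b, ‖g x‖ :=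
  norm_sub_le_of_weakDeriv_on hf hab (h.2.1.integrableOn_isCompact isCompact_Icc)
    fun φ hφ hφ0 => h.2.2 φ hφ (HasCompactSupport.intro isCompact_Icc hφ0)


lemma exists_int_sub_mem_Ico {L : ℝ} (hL : 0 < L) (a x : ℝ) :
    ∃ n : ℤ, a ≤ x - n * L ∧ x - n * L < a + L := by
  obtain ⟨n, hn, -⟩ := existsUnique_sub_zsmul_mem_Ico hL x a
  exact ⟨n, by simpa using hn.1, by simpa using hn.2⟩

lemma periodic_deriv {E : Type*} [NormedAddCommGroup E] [NormedSpace ℝ E] {f : ℝ → E} {L : ℝ}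
    (h : Function.Periodic f L) : Function.Periodic (deriv f) L := by
  intro x
  rw [← deriv_comp_add_const f L x]
  congr 1
  exact funext h

/-- The embedding `W^{2,p} ⊂ C^{1,1-1/p}` for periodic curves. -/
lemma holder_of_w2pNorm_lt {p : ℝ≥0∞} (hp : 1 ≤ p) {L M : ℝ} (hL : 0 < L)
    {γ : ℝ → Plane} (hγ : ContDiff ℝ 1 γ) (hper : Function.Periodic γ L)
    (h : w2pNorm p L γ < ENNReal.ofReal M) (s s' : ℝ) :
    ‖deriv γ s' - deriv γ s‖ ≤ 2 * M * |s' - s| ^ (1 - (1 / p).toReal) := by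
  have hM : 0 < M := by
    by_contra hM
    rw [ENNReal.ofReal_of_nonpos (not_lt.1 hM)] at h
    exact not_lt_bot h
  have hβ : 0 ≤ 1 - (1 / p).toReal := by
    rw [sub_nonneg]
    refine ENNReal.toReal_le_of_le_ofReal zero_le_one ?_
    rw [ENNReal.ofReal_one, one_div]
    exact ENNReal.inv_le_one.2 hp
  unfold w2pNorm at h
  simp only [iInf_lt_iff] at h
  obtain ⟨g, k, h1, h2, h3⟩ := h
  have hcd : Continuous (deriv γ) := hγ.continuous_deriv le_rfl
  have hk := h2.congr_left (h1.ae_eq_deriv hγ) hcd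
  have hkM : eLpNorm k p (volume.restrict (Icc (-L / 2) (L / 2))) ≤ ENNReal.ofReal M :=
    le_add_self.trans h3.le
  -- within one period
  have base : ∀ a b, -L / 2 ≤ a → a ≤ b → b ≤ L / 2 →
      ‖deriv γ b - deriv γ a‖ ≤ M * (b - a) ^ (1 - (1 / p).toReal) := by
    intro a b ha hab hb
    rcases hab.eq_or_lt with rfl | hab
    · simp; positivity
    refine (hk.norm_sub_le hcd hab).trans ?_
    have hki : IntegrableOn k (Icc a b) := hk.2.1.integrableOn_isCompact isCompact_Icc
    -- Hölder's inequality on `[a, b]` trades the `L^1` norm for the `L^p` norm at the cost of `(b -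
    -- a)^(1 - 1/p)`.
    have e1 := eLpNorm_le_eLpNorm_mul_rpow_measure_univ (μ := volume.restrict (Icc a b)) hp
      hki.aestronglyMeasurable
    have e2 : eLpNorm k p (volume.restrict (Icc a b)) ≤ ENNReal.ofReal M :=
      (eLpNorm_mono_measure k (Measure.restrict_mono (Icc_subset_Icc ha hb) le_rfl)).trans hkM
    have e3 : ENNReal.ofReal (∫ x in Icc a b, ‖k x‖) = eLpNorm k 1 (volume.restrict (Icc a b)) := by
      rw [eLpNorm_one_eq_lintegral_enorm, ofReal_integral_norm_eq_lintegral_enorm hki]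
    have hpos : 0 ≤ M * (b - a) ^ (1 - (1 / p).toReal) :=
      mul_nonneg hM.le (Real.rpow_nonneg (by linarith) _)
    rw [← ENNReal.ofReal_le_ofReal_iff hpos, e3]
    refine e1.trans ?_
    rw [ENNReal.ofReal_mul hM.le, ← ENNReal.ofReal_rpow_of_nonneg (by linarith) hβ]
    rw [Measure.restrict_apply_univ, Real.volume_Icc]
    have : 1 / (1 : ℝ≥0∞).toReal - 1 / p.toReal = 1 - (1 / p).toReal := by
      simp [ENNReal.toReal_inv]
    rw [this]
    gcongr
  have hperd := periodic_deriv hper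
  -- two points at distance at most one period
  have two : ∀ a b, a ≤ b → b ≤ a + L →
      ‖deriv γ b - deriv γ a‖ ≤ 2 * M * (b - a) ^ (1 - (1 / p).toReal) := by
    intro a b hab hbL
    obtain ⟨n, hn1, hn2⟩ := exists_int_sub_mem_Ico hL (-L / 2) a
    rw [← hperd.sub_int_mul_eq n (x := a), ← hperd.sub_int_mul_eq n (x := b)]
    have hab' : b - a = (b - n * L) - (a - n * L) := by ring
    rw [hab']
    set a' := a - n * L
    set b' := b - n * L
    have h1' : a' ≤ b' := by simp only [a', b']; linarith
    have h2' : b' ≤ a' + L := by simp only [a', b']; linarith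
    -- The end of the window `[-L/2, L/2]` may cut `[a', b']` in two; each piece costs `M`, which is
    -- where the factor `2` comes from.
    rcases le_total b' (L / 2) with hb | hb
    · refine (base a' b' hn1 h1' hb).trans ?_
      have : 0 ≤ M * (b' - a') ^ (1 - (1 / p).toReal) :=
        mul_nonneg hM.le (Real.rpow_nonneg (by linarith) _)
      nlinarith
    · have e1 := base a' (L / 2) hn1 (by linarith) le_rfl
      have e2 := base (-L / 2) (b' - L) le_rfl (by linarith) (by linarith)
      rw [hperd.sub_eq, show -L / 2 = L / 2 - L by ring, hperd.sub_eq] at e2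
      have e3 : (L / 2 - a') ^ (1 - (1 / p).toReal) ≤ (b' - a') ^ (1 - (1 / p).toReal) :=
        Real.rpow_le_rpow (by linarith) (by linarith) hβ
      have e4 : (b' - L - (L / 2 - L)) ^ (1 - (1 / p).toReal) ≤ (b' - a') ^ (1 - (1 / p).toReal) :=
        Real.rpow_le_rpow (by linarith) (by linarith) hβ
      calc ‖deriv γ b' - deriv γ a'‖
          ≤ ‖deriv γ b' - deriv γ (L / 2)‖ + ‖deriv γ (L / 2) - deriv γ a'‖ :=
            norm_sub_le_norm_sub_add_norm_sub _ _ _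
        _ ≤ M * (b' - a') ^ (1 - (1 / p).toReal) + M * (b' - a') ^ (1 - (1 / p).toReal) := by
            gcongr
            · exact e2.trans (mul_le_mul_of_nonneg_left e4 hM.le)
            · exact e1.trans (mul_le_mul_of_nonneg_left e3 hM.le)
        _ = _ := by ring
  have ordered : ∀ a b, a ≤ b →
      ‖deriv γ b - deriv γ a‖ ≤ 2 * M * (b - a) ^ (1 - (1 / p).toReal) := by
    intro a b hab
    rcases le_total b (a + L) with hb | hb
    · exact two a b hab hb
    · obtain ⟨n, hn1, hn2⟩ := exists_int_sub_mem_Ico hL a b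
      have := two a (b - n * L) hn1 hn2.le
      rw [hperd.sub_int_mul_eq n] at this
      refine this.trans (mul_le_mul_of_nonneg_left ?_ (by positivity))
      exact Real.rpow_le_rpow (by linarith) (by linarith) hβ
  rcases le_total s s' with hs | hs
  · rw [abs_of_nonneg (by linarith)]; exact ordered s s' hs
  · rw [abs_of_nonpos (by linarith), neg_sub, norm_sub_rev]; exact ordered s' s hs


/-! ### The two sides of a curve with Hölder continuous tangent -/

/-- A locally constant predicate on a connected space is constant. Sides, signs and orientations are
propagated by it, along a curve or in time. -/
lemma forall_iff_of_eventually_iff {X : Type*} [TopologicalSpace X] [PreconnectedSpace X]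
    {p : X → Prop} (h : ∀ x, ∀ᶠ y in 𝓝 x, (p y ↔ p x)) (x y : X) : p x ↔ p y := by
  have : IsLocallyConstant p := (IsLocallyConstant.iff_eventually_eq p).2 fun x => by
    filter_upwards [h x] with y hy using propext hy
  rw [this.apply_eq_of_preconnectedSpace x y]

/-- A connected set that does not meet the boundary of `Ω` is inside `Ω` as soon as one of its
points is. -/
lemma mem_iff_mem_of_isPreconnected {S Ω : Set Plane} (hS : IsPreconnected S)
    (hd : ∀ x ∈ S, x ∉ frontier Ω) {x y : Plane} (hx : x ∈ S) (hy : y ∈ S) : x ∈ Ω ↔ y ∈ Ω := by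
  have aux : ∀ x y, x ∈ S → y ∈ S → x ∈ Ω → y ∈ Ω := by
    intro x y hx hy hxΩ
    by_contra hyΩ
    have hcl : ∀ z ∈ S, z ∈ closure Ω → z ∈ interior Ω := fun z hz hzc => by
      by_contra hzi
      exact hd z hz ⟨hzc, hzi⟩
    obtain ⟨z, -, hz1, hz2⟩ := hS (interior Ω) (closure Ω)ᶜ isOpen_interior
      isClosed_closure.isOpen_compl
      (fun z hz => (em (z ∈ closure Ω)).imp (hcl z hz) id)
      ⟨x, hx, hcl x hx (subset_closure hxΩ)⟩
      ⟨y, hy, fun hyc => hyΩ (interior_subset (hcl y hy hyc))⟩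
    exact hz2 (subset_closure (interior_subset hz1))
  exact ⟨aux x y hx hy, aux y x hy hx⟩

/-- An arc-length parametrization with Hölder continuous tangent; at scales below `ℓ` the tangent
turns by at most `1/8`. -/
structure HolderCurve (β M ℓ L : ℝ) (Γ : ℝ → Plane) (Ω : Set Plane) : Prop
    extends IsArcLengthParametrization L Γ Ω where
  β_pos : 0 < β
  β_le : β ≤ 1
  M_pos : 0 < M
  scale_pos : 0 < ℓ
  scale : ∀ u, |u| ≤ ℓ → M * |u| ^ β ≤ 1 / 8
  holder : ∀ s s', ‖deriv Γ s' - deriv Γ s‖ ≤ M * |s' - s| ^ β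

/-- Points of the curve at distance less than `δ` are close along the curve. -/
def ArcChord (L δ : ℝ) (Γ : ℝ → Plane) : Prop :=
  ∀ s s', ‖Γ s' - Γ s‖ < δ → ∃ k : ℤ, |s' - s - k * L| ≤ 2 * ‖Γ s' - Γ s‖

/-- The truncated convex cone at `P` with axis `e`. -/
def cone (P e : Plane) (δ : ℝ) : Set Plane := {X | ‖X - P‖ < δ ∧ 1 / 2 * ‖X - P‖ < inner ℝ e (X - P)}

lemma convex_cone (P e : Plane) (δ : ℝ) : Convex ℝ (cone P e δ) := by
  rintro X ⟨hX1, hX2⟩ Y ⟨hY1, hY2⟩ a b ha hb hab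
  have h : a • X + b • Y - P = a • (X - P) + b • (Y - P) := by
    have : P = (a + b) • P := by rw [hab, one_smul]
    nth_rewrite 1 [this]; module
  have hn : ‖a • X + b • Y - P‖ ≤ a * ‖X - P‖ + b * ‖Y - P‖ := by
    rw [h]; refine (norm_add_le _ _).trans ?_
    rw [norm_smul, norm_smul, Real.norm_of_nonneg ha, Real.norm_of_nonneg hb]
  have hpos : 0 < a ∨ 0 < b := by
    by_contra hcon; push Not at hcon; linarith
  refine ⟨hn.trans_lt ?_, ?_⟩
  · calc a * ‖X - P‖ + b * ‖Y - P‖ < a * δ + b * δ := by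
          rcases hpos with h | h <;> nlinarith
      _ = δ := by rw [← add_mul, hab, one_mul]
  · rw [h, inner_add_right, inner_smul_right, inner_smul_right, ← h]
    rcases hpos with h | h <;> nlinarith

lemma isOpen_cone (P e : Plane) (δ : ℝ) : IsOpen (cone P e δ) :=
  (isOpen_lt (f := fun X => ‖X - P‖) (g := fun _ => δ) (by fun_prop) (by fun_prop)).inter
    (isOpen_lt (f := fun X => 1 / 2 * ‖X - P‖) (g := fun X => inner ℝ e (X - P))
      (by fun_prop) (by fun_prop))

lemma add_smul_mem_cone {P e : Plane} {δ c : ℝ} (he : ‖e‖ = 1) (hc : 0 < c) (hcδ : c < δ) :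
    P + c • e ∈ cone P e δ := by
  constructor
  · simp [norm_smul, he, abs_of_pos hc, hcδ]
  · simp [norm_smul, he, abs_of_pos hc, inner_smul_right]; linarith

namespace HolderCurve

variable {β M ℓ L δ : ℝ} {Γ : ℝ → Plane} {Ω : Set Plane}

section basic
variable (h : HolderCurve β M ℓ L Γ Ω)
include h

lemma hasDerivAt (s : ℝ) : HasDerivAt Γ (deriv Γ s) s :=
  ((h.contDiff.differentiable (by simp)) s).hasDerivAt

lemma continuous : Continuous Γ := h.contDiff.continuous

lemma continuous_deriv : Continuous (deriv Γ) := h.contDiff.continuous_deriv le_rfl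

lemma mem_frontier (s : ℝ) : Γ s ∈ frontier Ω := h.range_eq ▸ mem_range_self s

lemma exists_eq {P : Plane} (hP : P ∈ frontier Ω) : ∃ s, Γ s = P := by
  rw [← h.range_eq] at hP; exact hP

lemma norm_perp_deriv (s : ℝ) : ‖perp (deriv Γ s)‖ = 1 := by rw [norm_perp, h.norm_deriv]

lemma taylor (s s' : ℝ) : ‖Γ s' - Γ s - (s' - s) • deriv Γ s‖ ≤ M * |s' - s| ^ β * |s' - s| := by
  have := (convex_uIcc s s').norm_image_sub_le_of_norm_hasDerivWithin_le
    (f := fun x => Γ x - x • deriv Γ s) (f' := fun x => deriv Γ x - deriv Γ s)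
    (C := M * |s' - s| ^ β) (x := s) (y := s') (fun x _ => ?_) (fun x hx => ?_)
    left_mem_uIcc right_mem_uIcc
  · rw [Real.norm_eq_abs] at this
    refine le_of_eq_of_le (congrArg _ ?_) this
    module
  · have := (h.hasDerivAt x).sub ((hasDerivAt_id x).smul_const (deriv Γ s))
    rw [one_smul] at this
    exact this.hasDerivWithinAt
  · refine (h.holder s x).trans ?_
    have := h.M_pos
    have := h.β_pos
    have := abs_sub_left_of_mem_uIcc hx
    gcongr

lemma taylor_small {s s' : ℝ} (hs : |s' - s| ≤ ℓ) :
    ‖Γ s' - Γ s - (s' - s) • deriv Γ s‖ ≤ 1 / 8 * |s' - s| :=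
  (h.taylor s s').trans (mul_le_mul_of_nonneg_right (h.scale _ hs) (abs_nonneg _))

lemma abs_sub_le_of_small {s s' : ℝ} (hs : |s' - s| ≤ ℓ) : 7 / 8 * |s' - s| ≤ ‖Γ s' - Γ s‖ := by
  have h1 := h.taylor_small hs
  have h2 : ‖(s' - s) • deriv Γ s‖ = |s' - s| := by rw [norm_smul, h.norm_deriv, mul_one]; rfl
  have h3 := norm_sub_norm_le ((s' - s) • deriv Γ s) (Γ s' - Γ s)
  rw [norm_sub_rev, h2] at h3
  rw [norm_sub_rev] at h1
  linarith [norm_sub_rev (Γ s') (Γ s), norm_sub_rev (Γ s' - Γ s) ((s' - s) • deriv Γ s)]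

lemma chord_le (s s' : ℝ) : ‖Γ s' - Γ s‖ ≤ |s' - s| := by
  have := convex_univ.norm_image_sub_le_of_norm_hasDerivWithin_le
    (f := Γ) (f' := deriv Γ) (C := 1) (x := s) (y := s')
    (fun x _ => (h.hasDerivAt x).hasDerivWithinAt) (fun x _ => (h.norm_deriv x).le)
    (mem_univ _) (mem_univ _)
  simpa using this

lemma exists_int_of_eq {a b : ℝ} (hab : Γ a = Γ b) : ∃ k : ℤ, a - b = k * L := by
  obtain ⟨n, hn1, hn2⟩ := exists_int_sub_mem_Ico h.length_pos 0 a
  obtain ⟨m, hm1, hm2⟩ := exists_int_sub_mem_Ico h.length_pos 0 b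
  have := h.injOn (show a - n * L ∈ Ico 0 L from ⟨hn1, by linarith⟩)
    (show b - m * L ∈ Ico 0 L from ⟨hm1, by linarith⟩)
    (by rw [h.periodic.sub_int_mul_eq n, h.periodic.sub_int_mul_eq m, hab])
  exact ⟨n - m, by push_cast; linarith⟩

lemma periodic_deriv : Function.Periodic (deriv Γ) L := AlphaPatch.periodic_deriv h.periodic

lemma isCompact_frontier : IsCompact (frontier Ω) := by
  rw [← h.range_eq]
  have : range Γ = Γ '' Icc 0 L := by
    refine subset_antisymm ?_ (image_subset_range _ _)
    rintro _ ⟨s, rfl⟩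
    obtain ⟨n, hn1, hn2⟩ := exists_int_sub_mem_Ico h.length_pos 0 s
    exact ⟨s - n * L, ⟨hn1, by linarith⟩, h.periodic.sub_int_mul_eq n⟩
  rw [this]
  exact isCompact_Icc.image h.continuous

lemma nonempty_frontier : (frontier Ω).Nonempty := ⟨Γ 0, h.mem_frontier 0⟩

/-- Up to arc length `ℓ` the chord is at least `7/8` of the arc, whereas a full period has chord
zero. -/
lemma scale_lt_length : ℓ < L := by
  by_contra hlt
  have h1 := h.abs_sub_le_of_small (s := 0) (s' := L) (by
    rw [sub_zero, abs_of_pos h.length_pos]; exact not_lt.1 hlt)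
  have h2 : Γ L = Γ 0 := by have := h.periodic 0; rwa [zero_add] at this
  rw [h2, sub_self, norm_zero, sub_zero, abs_of_pos h.length_pos] at h1
  linarith [h.length_pos]

/-- Short arcs are controlled by the tangent. Parameter offsets in `[-L/2, L/2]` of modulus at least
`ℓ` form a compact set on which injectivity bounds the chord below. The resulting `δ` depends on the
curve. -/
lemma exists_arcChord : ∃ δ, 0 < δ ∧ 2 * δ ≤ ℓ ∧ ArcChord L δ Γ := by
  let K : Set (ℝ × ℝ) := (Icc 0 L ×ˢ Icc (-L / 2) (L / 2)) ∩ {q | ℓ ≤ |q.2|}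
  have hK : IsCompact K :=
    (isCompact_Icc.prod isCompact_Icc).inter_right (isClosed_le (by fun_prop) (by fun_prop))
  have hc := h.continuous
  obtain ⟨m, hm, hmK⟩ : ∃ m, 0 < m ∧ ∀ q ∈ K, m ≤ ‖Γ (q.1 + q.2) - Γ q.1‖ := by
    rcases K.eq_empty_or_nonempty with he | hne
    · exact ⟨1, one_pos, by simp [he]⟩
    obtain ⟨q, hq, hmin⟩ := hK.exists_isMinOn hne
      (f := fun q : ℝ × ℝ => ‖Γ (q.1 + q.2) - Γ q.1‖) (by fun_prop)
    refine ⟨_, ?_, fun q' hq' => hmin hq'⟩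
    rw [norm_pos_iff, sub_ne_zero]
    intro heq
    obtain ⟨k, hk⟩ := h.exists_int_of_eq heq
    rw [add_sub_cancel_left] at hk
    obtain ⟨⟨-, hq1, hq2⟩, hq3⟩ := hq
    have hL := h.length_pos
    have hk0 : k = 0 := by
      have h1 : (k : ℝ) < 1 := by by_contra hcon; nlinarith
      have h2 : (-1 : ℝ) < k := by by_contra hcon; nlinarith
      have h1' : k < 1 := by exact_mod_cast h1
      have h2' : -1 < k := by exact_mod_cast h2
      omega
    rw [hk0] at hk
    simp only [mem_ofPred_eq, hk] at hq3
    norm_num at hq3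
    linarith [h.scale_pos]
  refine ⟨min m (ℓ / 2), by have := h.scale_pos; positivity, ?_, fun s s' hs => ?_⟩
  · linarith [min_le_right m (ℓ / 2)]
  obtain ⟨n, hn1, hn2⟩ := exists_int_sub_mem_Ico h.length_pos 0 s
  obtain ⟨k, hk1, hk2⟩ := exists_int_sub_mem_Ico h.length_pos (-L / 2) (s' - s)
  refine ⟨k, ?_⟩
  have e1 : Γ (s + (s' - s - k * L)) = Γ s' := by
    rw [← h.periodic.sub_int_mul_eq k (x := s')]; congr 1; ring
  have e2 : Γ (s - n * L + (s' - s - k * L)) = Γ s' := by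
    rw [← e1, ← h.periodic.sub_int_mul_eq n (x := s + (s' - s - k * L))]; congr 1; ring
  by_cases hu : |s' - s - k * L| ≤ ℓ
  · have := h.abs_sub_le_of_small (s := s) (s' := s + (s' - s - k * L)) (by simpa using hu)
    rw [e1, add_sub_cancel_left] at this
    linarith [norm_nonneg (Γ s' - Γ s)]
  · have := hmK (s - n * L, s' - s - k * L)
      ⟨⟨⟨hn1, by linarith⟩, hk1, by linarith⟩, (not_le.1 hu).le⟩
    simp only [e2, h.periodic.sub_int_mul_eq n] at this
    exact absurd (this.trans_lt hs) (not_lt.2 (min_le_left _ _))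

/-- The foot of a point on the curve: the connecting vector is normal. -/
lemma exists_foot (X : Plane) : ∃ s, (∀ s', ‖X - Γ s‖ ≤ ‖X - Γ s'‖) ∧
    X - Γ s = inner ℝ (perp (deriv Γ s)) (X - Γ s) • perp (deriv Γ s) ∧
    |inner ℝ (perp (deriv Γ s)) (X - Γ s)| = ‖X - Γ s‖ := by
  obtain ⟨P, hP, hPX⟩ := h.isCompact_frontier.exists_infDist_eq_dist h.nonempty_frontier X
  obtain ⟨s, rfl⟩ := h.exists_eq hP
  have hmin : ∀ s', ‖X - Γ s‖ ≤ ‖X - Γ s'‖ := by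
    intro s'
    rw [← dist_eq_norm, ← hPX, ← dist_eq_norm]
    exact Metric.infDist_le_dist_of_mem (h.mem_frontier s')
  have horth : inner ℝ (deriv Γ s) (X - Γ s) = 0 := by
    have hd : HasDerivAt (fun r => ‖X - Γ r‖ ^ 2) (2 * inner ℝ (X - Γ s) (-deriv Γ s)) s := by
      have := ((hasDerivAt_const s X).sub (h.hasDerivAt s)).norm_sq
      simpa using this
    have hloc : IsLocalMin (fun r => ‖X - Γ r‖ ^ 2) s :=
      Eventually.of_forall fun r => by
        have := hmin r
        show ‖X - Γ s‖ ^ 2 ≤ ‖X - Γ r‖ ^ 2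
        gcongr
    have h0 := hloc.hasDerivAt_eq_zero hd
    rw [inner_neg_right, real_inner_comm] at h0
    linarith
  have hfe := frame_expansion (h.norm_deriv s) (X - Γ s)
  rw [horth, zero_smul, zero_add] at hfe
  refine ⟨s, hmin, hfe, ?_⟩
  conv_rhs => rw [hfe, norm_smul, h.norm_perp_deriv, mul_one, Real.norm_eq_abs]

end basic

section flat
variable (h : HolderCurve β M ℓ L Γ Ω) (hδ : 0 < δ) (hδℓ : 2 * δ ≤ ℓ) (hac : ArcChord L δ Γ)
include h hδℓ hac

/-- Close points of the curve have close parameters, up to a period. -/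
lemma exists_param {s : ℝ} {P : Plane} (hP : P ∈ frontier Ω) (hs : ‖P - Γ s‖ < δ) :
    ∃ s', Γ s' = P ∧ |s' - s| ≤ 2 * ‖P - Γ s‖ ∧ |s' - s| ≤ ℓ := by
  obtain ⟨r, rfl⟩ := h.exists_eq hP
  obtain ⟨k, hk⟩ := hac s r hs
  refine ⟨r - k * L, h.periodic.sub_int_mul_eq k, ?_, ?_⟩
  · rwa [sub_right_comm]
  · rw [sub_right_comm]; linarith

/-- Pairing with the normal removes the linear term of the Taylor expansion, and the remainder is at
most `1/8` of the arc, hence `1/4` of the chord. Since `1/4` is less than the aperture `1/2` in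
`cone`, the cones about the two normals avoid the curve. -/
lemma flat {s : ℝ} {P : Plane} (hP : P ∈ frontier Ω) (hs : ‖P - Γ s‖ < δ) :
    |inner ℝ (perp (deriv Γ s)) (P - Γ s)| ≤ 1 / 4 * ‖P - Γ s‖ ∧
    |inner ℝ (perp (deriv Γ s)) (P - Γ s)| ≤ M * (2 * ‖P - Γ s‖) ^ β * (2 * ‖P - Γ s‖) := by
  obtain ⟨s', rfl, h1, h2⟩ := h.exists_param hδℓ hac hP hs
  have h3 : inner ℝ (perp (deriv Γ s)) (Γ s' - Γ s) =
      inner ℝ (perp (deriv Γ s)) (Γ s' - Γ s - (s' - s) • deriv Γ s) := by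
    rw [inner_sub_right _ _ ((s' - s) • deriv Γ s), inner_smul_right,
      real_inner_comm (deriv Γ s) (perp (deriv Γ s)), inner_perp_self, mul_zero, sub_zero]
  have h4 : |inner ℝ (perp (deriv Γ s)) (Γ s' - Γ s)| ≤ M * |s' - s| ^ β * |s' - s| := by
    rw [h3]
    refine (abs_real_inner_le_norm _ _).trans ?_
    rw [h.norm_perp_deriv, one_mul]
    exact h.taylor s s'
  have hM := h.M_pos
  have hβ := h.β_pos
  constructor
  · refine h4.trans ?_
    have := mul_le_mul_of_nonneg_right (h.scale _ h2) (abs_nonneg (s' - s))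
    linarith
  · refine h4.trans ?_
    gcongr

lemma cone_not_mem_frontier {s : ℝ} {e X : Plane} (he : e = perp (deriv Γ s) ∨ e = -perp (deriv Γ s))
    (hX : X ∈ cone (Γ s) e δ) : X ∉ frontier Ω := by
  intro hXf
  have h1 := (h.flat hδℓ hac hXf hX.1).1
  have h2 := hX.2
  have h3 : |inner ℝ e (X - Γ s)| ≤ 1 / 4 * ‖X - Γ s‖ := by
    rcases he with rfl | rfl
    · exact h1
    · rwa [inner_neg_left, abs_neg]
  have := le_abs_self (inner ℝ e (X - Γ s))
  linarith [norm_nonneg (X - Γ s)]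

lemma cone_iff {s : ℝ} {e X Y : Plane} (he : e = perp (deriv Γ s) ∨ e = -perp (deriv Γ s))
    (hX : X ∈ cone (Γ s) e δ) (hY : Y ∈ cone (Γ s) e δ) : X ∈ Ω ↔ Y ∈ Ω :=
  mem_iff_mem_of_isPreconnected (convex_cone _ _ _).isPreconnected
    (fun _ hx => h.cone_not_mem_frontier hδℓ hac he hx) hX hY

include hδ

/-- The orientation hypothesis places points of the normal ray arbitrarily close to `Γ s` in `Ω`;
the rest of the cone follows because it is connected and misses the boundary. -/
lemma upper_cone_subset (s : ℝ) : cone (Γ s) (perp (deriv Γ s)) δ ⊆ Ω := by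
  intro X hX
  obtain ⟨ε, hε, hε1, hε2⟩ := ((h.counterclockwise s).and (Ioo_mem_nhdsGT hδ)).exists
  exact (h.cone_iff hδℓ hac (Or.inl rfl) hX
    (add_smul_mem_cone (h.norm_perp_deriv s) hε1 hε2)).2 hε

omit hδℓ hac in
lemma lower_point_mem_cone (s : ℝ) : Γ s - (δ / 2) • perp (deriv Γ s) ∈
    cone (Γ s) (-perp (deriv Γ s)) δ := by
  rw [sub_eq_add_neg, ← smul_neg]
  exact add_smul_mem_cone (by rw [norm_neg, h.norm_perp_deriv]) (by positivity) (by linarith)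

omit hδℓ hac in
lemma upper_point_mem_cone (s : ℝ) : Γ s + (δ / 2) • perp (deriv Γ s) ∈
    cone (Γ s) (perp (deriv Γ s)) δ :=
  add_smul_mem_cone (h.norm_perp_deriv s) (by positivity) (by linarith)

omit hδℓ hac in
lemma eventually_lower_point_mem (s : ℝ) : ∀ᶠ r in 𝓝 s,
    Γ r - (δ / 2) • perp (deriv Γ r) ∈ cone (Γ s) (-perp (deriv Γ s)) δ := by
  have hc : Continuous fun r => Γ r - (δ / 2) • perp (deriv Γ r) := by
    have := h.continuous
    have := h.continuous_deriv
    fun_prop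
  exact hc.continuousAt.eventually_mem
    ((isOpen_cone _ _ _).mem_nhds (h.lower_point_mem_cone hδ s))

/-- If one lower cone met `Ω`, continuation along the curve would put all of them in `Ω`. Both sides
of the boundary would then belong to `Ω`, so `closure Ω` would be open as well as closed, hence the
whole plane, against boundedness. -/
lemma lower_cone_disjoint (hΩ : IsPatchDomain Ω) {s : ℝ} {X : Plane}
    (hX : X ∈ cone (Γ s) (-perp (deriv Γ s)) δ) : X ∉ Ω := by
  intro hXΩ
  have h0 := (h.cone_iff hδℓ hac (Or.inr rfl) hX (h.lower_point_mem_cone hδ s)).1 hXΩ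
  have hall : ∀ r, Γ r - (δ / 2) • perp (deriv Γ r) ∈ Ω := by
    intro r
    refine (forall_iff_of_eventually_iff (p := fun r => Γ r - (δ / 2) • perp (deriv Γ r) ∈ Ω)
      (fun r => ?_) s r).1 h0
    filter_upwards [h.eventually_lower_point_mem hδ r] with r' hr'
    exact h.cone_iff hδℓ hac (Or.inr rfl) hr' (h.lower_point_mem_cone hδ r)
  have hopen : IsOpen (closure Ω) := by
    rw [isOpen_iff_mem_nhds]
    intro x hx
    rw [closure_eq_self_union_frontier] at hx
    rcases hx with hx | hx
    · exact mem_of_superset (hΩ.isOpen.mem_nhds hx) subset_closure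
    · obtain ⟨s0, rfl⟩ := h.exists_eq hx
      filter_upwards [Metric.ball_mem_nhds (Γ s0) hδ] with Y hY
      obtain ⟨r, hr1, hr2, hr3⟩ := h.exists_foot Y
      have hYr : ‖Y - Γ r‖ < δ := (hr1 s0).trans_lt (by rwa [← dist_eq_norm])
      set c := inner ℝ (perp (deriv Γ r)) (Y - Γ r) with hc
      have hY' : Y = Γ r + c • perp (deriv Γ r) := by rw [← hr2, add_sub_cancel]
      rcases lt_trichotomy c 0 with hc0 | hc0 | hc0
      · apply subset_closure
        refine (h.cone_iff hδℓ hac (Or.inr rfl) ?_ (h.lower_point_mem_cone hδ r)).2 (hall r)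
        rw [hY', show c • perp (deriv Γ r) = (-c) • (-perp (deriv Γ r)) by simp]
        refine add_smul_mem_cone (by rw [norm_neg, h.norm_perp_deriv]) (by linarith) ?_
        rwa [← abs_of_neg hc0, hr3]
      · rw [hY', hc0, zero_smul, add_zero]
        exact frontier_subset_closure (h.mem_frontier r)
      · apply subset_closure
        apply h.upper_cone_subset hδ hδℓ hac r
        rw [hY']
        refine add_smul_mem_cone (h.norm_perp_deriv r) hc0 ?_
        rwa [← abs_of_pos hc0, hr3]
  have huniv : closure Ω = univ :=
    IsClopen.eq_univ ⟨isClosed_closure, hopen⟩ hΩ.isConnected.nonempty.closure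
  have hb : Bornology.IsBounded (univ : Set Plane) := huniv ▸ hΩ.isBounded.closure
  exact NormedSpace.unbounded_univ ℝ Plane hb

/-- Every point off the curve can be joined, off the curve, to a point of a cone on its side. -/
lemma exists_joinedIn (hΩ : IsPatchDomain Ω) {X : Plane} (hX : X ∉ frontier Ω) :
    (X ∈ Ω → ∃ s, JoinedIn (frontier Ω)ᶜ X (Γ s + (δ / 2) • perp (deriv Γ s))) ∧
    (X ∉ Ω → ∃ s, JoinedIn (frontier Ω)ᶜ X (Γ s - (δ / 2) • perp (deriv Γ s))) := by
  obtain ⟨r, hr1, hr2, hr3⟩ := h.exists_foot X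
  set c := inner ℝ (perp (deriv Γ r)) (X - Γ r) with hc
  have hX' : X = Γ r + c • perp (deriv Γ r) := by rw [← hr2, add_sub_cancel]
  have hc0 : c ≠ 0 := by
    intro h0
    rw [hX', h0, zero_smul, add_zero] at hX
    exact hX (h.mem_frontier r)
  -- the segment from the foot to the point
  have havoid : ∀ t ∈ Ioc (0 : ℝ) 1, Γ r + (t * c) • perp (deriv Γ r) ∉ frontier Ω := by
    intro t ht hf
    obtain ⟨s, hs⟩ := h.exists_eq hf
    have h1 := hr1 s
    rw [hs, hX', add_sub_add_left_eq_sub, ← sub_smul, add_sub_cancel_left, norm_smul, norm_smul,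
      h.norm_perp_deriv, Real.norm_eq_abs, Real.norm_eq_abs, mul_one, mul_one,
      show c - t * c = (1 - t) * c by ring, abs_mul,
      abs_of_nonneg (sub_nonneg.2 ht.2)] at h1
    have := abs_pos.2 hc0
    nlinarith [ht.1]
  -- Stop on the normal segment at distance at most `δ/2` from the foot: this point lies in one of
  -- the two cones there.
  set t₀ := min 1 (δ / 2 / |c|) with ht₀
  have hcpos := abs_pos.2 hc0
  have ht₀pos : 0 < t₀ := by positivity
  have ht₀1 : t₀ ≤ 1 := min_le_left _ _
  have ht₀c : t₀ * |c| ≤ δ / 2 := by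
    calc t₀ * |c| ≤ δ / 2 / |c| * |c| := by gcongr; exact min_le_right _ _
      _ = δ / 2 := by field_simp
  have hseg : JoinedIn (frontier Ω)ᶜ X (Γ r + (t₀ * c) • perp (deriv Γ r)) := by
    have hpc : IsPathConnected ((fun t : ℝ => Γ r + (t * c) • perp (deriv Γ r)) '' Ioc 0 1) :=
      ((convex_Ioc (0 : ℝ) 1).isPathConnected ⟨1, by simp⟩).image (by fun_prop)
    refine (hpc.joinedIn _ ⟨1, by simp, ?_⟩ _ ⟨t₀, ⟨ht₀pos, ht₀1⟩, rfl⟩).mono ?_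
    · simpa using hX'.symm
    · rintro _ ⟨t, ht, rfl⟩; exact havoid t ht
  rcases hc0.lt_or_gt with hneg | hpos
  · have hm : Γ r + (t₀ * c) • perp (deriv Γ r) ∈ cone (Γ r) (-perp (deriv Γ r)) δ := by
      rw [show (t₀ * c) • perp (deriv Γ r) = (t₀ * |c|) • (-perp (deriv Γ r)) by
        rw [abs_of_neg hneg]; simp]
      exact add_smul_mem_cone (by rw [norm_neg, h.norm_perp_deriv]) (by positivity) (by linarith)
    have hj2 : JoinedIn (frontier Ω)ᶜ (Γ r + (t₀ * c) • perp (deriv Γ r))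
        (Γ r - (δ / 2) • perp (deriv Γ r)) :=
      (((convex_cone _ _ _).isPathConnected ⟨_, hm⟩).joinedIn _ hm _
        (h.lower_point_mem_cone hδ r)).mono
        fun x hx => h.cone_not_mem_frontier hδℓ hac (Or.inr rfl) hx
    refine ⟨fun hXΩ => ?_, fun _ => ⟨r, hseg.trans hj2⟩⟩
    exfalso
    obtain ⟨p, hp⟩ := hseg
    refine h.lower_cone_disjoint hδ hδℓ hac hΩ hm ?_
    refine (mem_iff_mem_of_isPreconnected (S := range p) (isPreconnected_range p.continuous)
      ?_ ⟨0, p.source⟩ ⟨1, p.target⟩).1 hXΩ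
    rintro _ ⟨t, rfl⟩; exact hp t
  · have hm : Γ r + (t₀ * c) • perp (deriv Γ r) ∈ cone (Γ r) (perp (deriv Γ r)) δ := by
      rw [← abs_of_pos hpos]
      exact add_smul_mem_cone (h.norm_perp_deriv r) (by positivity) (by linarith)
    have hj2 : JoinedIn (frontier Ω)ᶜ (Γ r + (t₀ * c) • perp (deriv Γ r))
        (Γ r + (δ / 2) • perp (deriv Γ r)) :=
      (((convex_cone _ _ _).isPathConnected ⟨_, hm⟩).joinedIn _ hm _
        (h.upper_point_mem_cone hδ r)).mono
        fun x hx => h.cone_not_mem_frontier hδℓ hac (Or.inl rfl) hx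
    refine ⟨fun _ => ⟨r, hseg.trans hj2⟩, fun hXΩ => ?_⟩
    exfalso
    obtain ⟨p, hp⟩ := hseg
    refine hXΩ ((mem_iff_mem_of_isPreconnected (S := range p) (isPreconnected_range p.continuous)
      ?_ ⟨0, p.source⟩ ⟨1, p.target⟩).2 (h.upper_cone_subset hδ hδℓ hac r hm))
    rintro _ ⟨t, rfl⟩; exact hp t

/-- For `r'` near `r` the lower point at `r'` lies in the convex lower cone at `r`, so being joined
to the lower point at `s` is a locally constant property of the parameter. -/
lemma joinedIn_lower_points (s s' : ℝ) : JoinedIn (frontier Ω)ᶜ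
    (Γ s - (δ / 2) • perp (deriv Γ s)) (Γ s' - (δ / 2) • perp (deriv Γ s')) := by
  have hjoin : ∀ r r', Γ r' - (δ / 2) • perp (deriv Γ r') ∈ cone (Γ r) (-perp (deriv Γ r)) δ →
      JoinedIn (frontier Ω)ᶜ (Γ r - (δ / 2) • perp (deriv Γ r))
        (Γ r' - (δ / 2) • perp (deriv Γ r')) := fun r r' hr' =>
    (((convex_cone _ _ _).isPathConnected ⟨_, hr'⟩).joinedIn _
      (h.lower_point_mem_cone hδ r) _ hr').mono
      fun x hx => h.cone_not_mem_frontier hδℓ hac (Or.inr rfl) hx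
  refine (forall_iff_of_eventually_iff (p := fun r => JoinedIn (frontier Ω)ᶜ
    (Γ s - (δ / 2) • perp (deriv Γ s)) (Γ r - (δ / 2) • perp (deriv Γ r)))
    (fun r => ?_) s s').1 ?_
  · filter_upwards [h.eventually_lower_point_mem hδ r] with r' hr'
    exact ⟨fun hj => hj.trans (hjoin r r' hr').symm, fun hj => hj.trans (hjoin r r' hr')⟩
  · exact hjoin s s (h.lower_point_mem_cone hδ s)

/-- The exterior of a patch domain is path connected. -/
lemma joinedIn_exterior (hΩ : IsPatchDomain Ω) {X Y : Plane} (hX : X ∉ closure Ω)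
    (hY : Y ∉ closure Ω) : JoinedIn (frontier Ω)ᶜ X Y := by
  have aux : ∀ {Z}, Z ∉ closure Ω →
      ∃ s, JoinedIn (frontier Ω)ᶜ Z (Γ s - (δ / 2) • perp (deriv Γ s)) := fun hZ =>
    (h.exists_joinedIn hδ hδℓ hac hΩ fun hf => hZ (frontier_subset_closure hf)).2
      fun hf => hZ (subset_closure hf)
  obtain ⟨s, hs⟩ := aux hX
  obtain ⟨s', hs'⟩ := aux hY
  exact (hs.trans (h.joinedIn_lower_points hδ hδℓ hac s s')).trans hs'.symm

end flat

end HolderCurve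

/-! ### From coherent tangents to an arc-chord condition -/

namespace HolderCurve

variable {β M ℓ L δ : ℝ} {Γ : ℝ → Plane} {Ω : Set Plane}

/-- A segment cannot cross the curve twice in a row from the right to the left. -/
lemma not_cross_twice (h : HolderCurve β M ℓ L Γ Ω) (hΩ : IsPatchDomain Ω) {A m : Plane} {y : ℝ}
    (hm : ‖m‖ = 1) (hy : 0 < y) (hA : A ∈ frontier Ω) (hB : A + y • m ∈ frontier Ω)
    (hcross : ∀ s, ∀ t ∈ Icc 0 y, Γ s = A + t • m → 1 / 2 < inner ℝ (perp (deriv Γ s)) m) :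
    False := by
  obtain ⟨δ, hδ, hδℓ, hac⟩ := h.exists_arcChord
  have hup : ∀ s, 1 / 2 < inner ℝ (perp (deriv Γ s)) m → ∀ t, 0 < t → t < δ →
      Γ s + t • m ∈ Ω := by
    intro s hs t ht0 htδ
    apply h.upper_cone_subset hδ hδℓ hac s
    constructor
    · simpa [norm_smul, hm, abs_of_pos ht0]
    · simp only [add_sub_cancel_left, norm_smul, hm, Real.norm_eq_abs, abs_of_pos ht0,
        inner_smul_right]
      nlinarith
  have hlow : ∀ s, 1 / 2 < inner ℝ (perp (deriv Γ s)) m → ∀ t, 0 < t → t < δ →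
      Γ s - t • m ∉ Ω := by
    intro s hs t ht0 htδ
    apply h.lower_cone_disjoint hδ hδℓ hac hΩ (s := s)
    constructor
    · simpa [norm_smul, hm, abs_of_pos ht0]
    · simp only [sub_sub_cancel_left, norm_smul, hm, Real.norm_eq_abs, abs_of_pos ht0,
        inner_smul_right, norm_neg, inner_neg_right, inner_neg_left]
      nlinarith
  obtain ⟨s₀, hs₀⟩ := h.exists_eq hA
  have hs₀c := hcross s₀ 0 ⟨le_rfl, hy.le⟩ (by simp [hs₀])
  set ε := min (δ / 2) (y / 2) with hε
  have hε0 : 0 < ε := by positivity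
  have hεδ : ε ≤ δ / 2 := min_le_left _ _
  have hεy : ε ≤ y / 2 := min_le_right _ _
  -- Let `t₁` be the first meeting with the boundary after `ε`. The segment is in `Ω` just after `A`
  -- and out of `Ω` just before `t₁`, yet meets no boundary point in between. Starting `S` at `ε`
  -- makes it closed while leaving out `A` itself.
  let S : Set ℝ := Icc ε y ∩ (fun t => A + t • m) ⁻¹' frontier Ω
  have hS : IsCompact S := isCompact_Icc.inter_right (isClosed_frontier.preimage (by fun_prop))
  obtain ⟨t₁, ⟨⟨ht₁ε, ht₁y⟩, ht₁f⟩, hmin⟩ := hS.exists_isMinOn ⟨y, ⟨by linarith, le_rfl⟩, hB⟩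
    (f := id) continuousOn_id
  obtain ⟨s₁, hs₁⟩ := h.exists_eq ht₁f
  have hs₁c := hcross s₁ t₁ ⟨by linarith, ht₁y⟩ hs₁
  have hεΩ : A + ε • m ∈ Ω := hs₀ ▸ hup s₀ hs₀c ε hε0 (by linarith)
  have hne : t₁ ≠ ε := by
    intro heq
    have hf : A + ε • m ∈ frontier Ω := heq ▸ ht₁f
    rw [hΩ.isOpen.frontier_eq] at hf
    exact hf.2 hεΩ
  have hlt : ε < t₁ := lt_of_le_of_ne ht₁ε hne.symm
  set η := min (δ / 2) (t₁ - ε) with hη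
  have hη0 : 0 < η := lt_min (by positivity) (by linarith)
  have h1 : A + (t₁ - η) • m ∉ Ω := by
    have e : A + (t₁ - η) • m = Γ s₁ - η • m := by
      rw [hs₁]
      show _ = A + t₁ • m - η • m
      rw [sub_smul, add_sub_assoc]
    rw [e]
    exact hlow s₁ hs₁c η hη0 (by linarith [min_le_left (δ / 2) (t₁ - ε)])
  refine h1 ((mem_iff_mem_of_isPreconnected (S := (fun t : ℝ => A + t • m) '' Ico ε t₁)
    (isPreconnected_Ico.image _ (by fun_prop)) ?_ ⟨ε, ⟨le_rfl, hlt⟩, rfl⟩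
    ⟨t₁ - η, ⟨by linarith [min_le_right (δ / 2) (t₁ - ε)], by linarith⟩, rfl⟩).1 hεΩ)
  rintro _ ⟨t, ht, rfl⟩ hf
  have := hmin (show t ∈ S from ⟨⟨ht.1, by linarith [ht.2]⟩, hf⟩)
  simp only [mem_ofPred_eq, id] at this
  linarith [ht.2]

/-- If nearby points of the curve have nearby tangents, then the curve satisfies an arc-chord
condition with an explicit constant. -/
lemma arcChord_of_coherent (h : HolderCurve β M ℓ L Γ Ω) (hΩ : IsPatchDomain Ω) {δ₁ : ℝ}
    (hcoh : ∀ s s', ‖Γ s' - Γ s‖ < δ₁ → ‖deriv Γ s' - deriv Γ s‖ ≤ 1 / 8) :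
    ArcChord L (min δ₁ ℓ / 4) Γ := by
  intro s s' hs
  set d := ‖Γ s' - Γ s‖ with hd
  have hd1 : d < δ₁ / 4 := hs.trans_le (by gcongr; exact min_le_left _ _)
  have hd2 : d < ℓ / 4 := hs.trans_le (by gcongr; exact min_le_right _ _)
  have hd0 : 0 ≤ d := norm_nonneg _
  set τ := deriv Γ s with hτ
  have hτ1 : ‖τ‖ = 1 := h.norm_deriv s
  -- the horizontal coordinate
  have ha : ∀ u, |u| ≤ ℓ → |inner ℝ τ (Γ (s + u) - Γ s) - u| ≤ 1 / 8 * |u| := by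
    intro u hu
    have h1 := h.taylor_small (s := s) (s' := s + u) (by simpa using hu)
    rw [add_sub_cancel_left] at h1
    have h2 : inner ℝ τ (Γ (s + u) - Γ s) - u = inner ℝ τ (Γ (s + u) - Γ s - u • τ) := by
      rw [inner_sub_right _ _ (u • τ), inner_smul_right, real_inner_self_eq_norm_sq, hτ1]; ring
    rw [h2]
    refine (abs_real_inner_le_norm _ _).trans ?_
    rwa [hτ1, one_mul]
  set q := inner ℝ τ (Γ s' - Γ s) with hq
  have hqd : |q| ≤ d := (abs_real_inner_le_norm _ _).trans (by rw [hτ1, one_mul])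
  -- As the parameter runs over `|u| ≤ 2d`, the coordinate along `τ` sweeps past `±d`, so the local
  -- arc meets the normal line through `Γ s'`. It remains to show that the meeting point is `Γ s'`
  -- itself.
  obtain ⟨u, hu, huq⟩ : ∃ u ∈ Icc (-(2 * d)) (2 * d), inner ℝ τ (Γ (s + u) - Γ s) = q := by
    have hc : ContinuousOn (fun u => inner ℝ τ (Γ (s + u) - Γ s)) (Icc (-(2 * d)) (2 * d)) := by
      have := h.continuous
      fun_prop
    have h1 := ha (2 * d) (by rw [abs_of_nonneg] <;> linarith)
    have h2 := ha (-(2 * d)) (by rw [abs_neg, abs_of_nonneg] <;> linarith)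
    rw [abs_neg] at h2
    rw [abs_of_nonneg (by linarith : 0 ≤ 2 * d)] at h1 h2
    rw [abs_le] at h1 h2 hqd
    exact intermediate_value_Icc (by linarith) hc ⟨by linarith, by linarith⟩
  have hu' : |u| ≤ 2 * d := abs_le.2 hu
  set n := perp τ with hn
  have hn1 : ‖n‖ = 1 := by rw [hn, norm_perp, hτ1]
  set y := inner ℝ n (Γ s' - Γ (s + u)) with hy
  have hQ : Γ s' = Γ (s + u) + y • n := by
    have h1 := frame_expansion hτ1 (Γ s' - Γ (s + u))
    have h2 : inner ℝ τ (Γ s' - Γ (s + u)) = 0 := by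
      rw [← sub_sub_sub_cancel_right _ _ (Γ s), inner_sub_right, huq, sub_self]
    rw [h2, zero_smul, zero_add] at h1
    rw [← h1, add_sub_cancel]
  have hPu : ‖Γ (s + u) - Γ s‖ ≤ 2 * d := (h.chord_le s (s + u)).trans (by simpa using hu')
  -- all boundary points on the segment are crossed in the same direction
  have hcr : ∀ r, ‖Γ r - Γ s‖ ≤ 3 * d → 1 / 2 < inner ℝ (perp (deriv Γ r)) n := by
    intro r hr
    have h1 := hcoh s r (by linarith)
    rw [hn, inner_perp_perp]
    have h2 : inner ℝ (deriv Γ r) τ = 1 + inner ℝ (deriv Γ r - τ) τ := by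
      rw [inner_sub_left, real_inner_self_eq_norm_sq, hτ1]; ring
    have h3 := neg_le_of_abs_le ((abs_real_inner_le_norm (deriv Γ r - τ) τ))
    rw [hτ1, mul_one] at h3
    linarith
  have hyb : |y| ≤ 3 * d := by
    refine (abs_real_inner_le_norm _ _).trans ?_
    rw [hn1, one_mul]
    calc ‖Γ s' - Γ (s + u)‖ ≤ ‖Γ s' - Γ s‖ + ‖Γ s - Γ (s + u)‖ :=
          norm_sub_le_norm_sub_add_norm_sub _ _ _
      _ ≤ 3 * d := by rw [norm_sub_rev (Γ s)]; linarith
  have hsegball : ∀ A B : Plane, ‖A - Γ s‖ ≤ 3 * d → ‖B - Γ s‖ ≤ 3 * d → ∀ t ∈ Icc (0 : ℝ) 1,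
      ‖A + t • (B - A) - Γ s‖ ≤ 3 * d := by
    intro A B hA hB t ht
    have : A + t • (B - A) ∈ Metric.closedBall (Γ s) (3 * d) := by
      refine (convex_closedBall (Γ s) (3 * d)).add_smul_sub_mem ?_ ?_ ht
      · simpa [dist_eq_norm] using hA
      · simpa [dist_eq_norm] using hB
    simpa [dist_eq_norm] using this
  have hfin : y = 0 := by
    by_contra hy0
    rcases lt_or_gt_of_ne hy0 with hneg | hpos
    · have hback : Γ (s + u) = Γ s' + (-y) • n := by rw [hQ]; module
      refine h.not_cross_twice hΩ hn1 (neg_pos.2 hneg) (h.mem_frontier s')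
        (hback ▸ h.mem_frontier (s + u)) fun r t ht hr => hcr r ?_
      rw [hr]
      have := hsegball (Γ s') (Γ (s + u)) (by linarith) (by linarith) (t / (-y))
        ⟨div_nonneg ht.1 (by linarith), div_le_one_of_le₀ ht.2 (by linarith)⟩
      rw [hback, add_sub_cancel_left, smul_smul, div_mul_cancel₀ _ (by linarith)] at this
      exact this
    · refine h.not_cross_twice hΩ hn1 hpos (h.mem_frontier (s + u))
        (hQ ▸ h.mem_frontier s') fun r t ht hr => hcr r ?_
      rw [hr]
      have := hsegball (Γ (s + u)) (Γ s') (by linarith) (by linarith) (t / y)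
        ⟨div_nonneg ht.1 (by linarith), div_le_one_of_le₀ ht.2 (by linarith)⟩
      rw [hQ, add_sub_cancel_left, smul_smul, div_mul_cancel₀ _ (by linarith)] at this
      exact this
  rw [hfin, zero_smul, add_zero] at hQ
  obtain ⟨k, hk⟩ := h.exists_int_of_eq hQ
  refine ⟨k, ?_⟩
  rw [show s' - s - k * L = u by linarith]
  exact hu'

end HolderCurve

/-! ### Tangents of Hausdorff-close curves -/

lemma exists_small_scale {β : ℝ} (hβ : 0 < β) (M : ℝ) {c ε : ℝ} (hc : 0 < c) (hε : 0 < ε) :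
    ∃ l, 0 < l ∧ l ≤ c ∧ M * (3 * l) ^ β ≤ ε := by
  have hcont : Tendsto (fun l : ℝ => M * (3 * l) ^ β) (𝓝[>] 0) (𝓝 (M * (3 * 0) ^ β)) := by
    apply Tendsto.mono_left _ nhdsWithin_le_nhds
    apply Tendsto.const_mul
    exact ((continuous_const.mul continuous_id).tendsto 0).rpow_const (Or.inr hβ.le)
  rw [mul_zero, Real.zero_rpow hβ.ne', mul_zero] at hcont
  obtain ⟨l, hl1, hl2⟩ := ((hcont.eventually_le_const hε).and (Ioc_mem_nhdsGT hc)).exists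
  exact ⟨l, hl2.1, hl2.2, hl1⟩

lemma ArcChord.mono {L δ δ' : ℝ} {Γ : ℝ → Plane} (h : ArcChord L δ Γ) (hδ : δ' ≤ δ) :
    ArcChord L δ' Γ := fun s s' hs => h s s' (hs.trans_le hδ)

namespace HolderCurve

variable {β M ℓ L₀ δ₀ : ℝ} {Γ₀ : ℝ → Plane} {Ω₀ : Set Plane}

/-- A curve in a small neighbourhood of a given curve has, at each point, nearly the same tangent
line as the given curve. -/
lemma exists_tangent_dichotomy (h₀ : HolderCurve β M ℓ L₀ Γ₀ Ω₀) (hδ : 0 < δ₀) (hδℓ : 2 * δ₀ ≤ ℓ)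
    (hac : ArcChord L₀ δ₀ Γ₀) : ∃ ρ, 0 < ρ ∧ ρ ≤ δ₀ / 2 ∧ ∀ {L : ℝ} {Γ : ℝ → Plane} {Ω : Set Plane},
      HolderCurve β M ℓ L Γ Ω → (∀ s, ∃ a, ‖Γ s - Γ₀ a‖ < ρ) → ∀ s a, ‖Γ s - Γ₀ a‖ < ρ →
        ‖deriv Γ s - deriv Γ₀ a‖ ≤ 1 / 32 ∨ ‖deriv Γ s + deriv Γ₀ a‖ ≤ 1 / 32 := by
  -- Over lengths up to `3l` both curves stay within `1/1000` of their tangents, relative to length.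
  -- A step `l` on one curve is matched, within `l/1000`, by a step `u` on the other. Hence `l •
  -- deriv Γ s` is close to `u • deriv Γ₀ a` with `|u|` close to `l`, and the sign of `u` decides
  -- between the alternatives.
  obtain ⟨l, hl, hlδ, hlM⟩ := exists_small_scale h₀.β_pos M (c := δ₀ / 4) (by positivity)
    (show (0 : ℝ) < 1 / 1000 by norm_num)
  refine ⟨l / 1000, by positivity, by linarith, fun {L Γ Ω} h hnear s a hsa => ?_⟩
  obtain ⟨b₀, hb₀⟩ := hnear (s + l)
  have hM := h₀.M_pos
  have hβ := h₀.β_pos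
  have hpow : ∀ u, |u| ≤ 3 * l → M * |u| ^ β * |u| ≤ 1 / 1000 * |u| := by
    intro u hu
    refine mul_le_mul_of_nonneg_right (le_trans ?_ hlM) (abs_nonneg _)
    gcongr
  have hll : ‖Γ (s + l) - Γ s‖ ≤ l := by
    simpa [abs_of_pos hl] using h.chord_le s (s + l)
  have hBA : ‖Γ₀ b₀ - Γ₀ a‖ ≤ l + 2 * (l / 1000) := by
    calc ‖Γ₀ b₀ - Γ₀ a‖ = ‖-(Γ (s + l) - Γ₀ b₀) + (Γ (s + l) - Γ s) + (Γ s - Γ₀ a)‖ := by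
          congr 1; abel
      _ ≤ ‖Γ (s + l) - Γ₀ b₀‖ + ‖Γ (s + l) - Γ s‖ + ‖Γ s - Γ₀ a‖ := by
          refine norm_add₃_le.trans ?_
          rw [norm_neg]
      _ ≤ _ := by linarith
  obtain ⟨b, hb, hba, -⟩ := h₀.exists_param hδℓ hac (h₀.mem_frontier b₀) (s := a) (by linarith)
  rw [← hb] at hb₀
  set u := b - a with hu
  have hu3 : |u| ≤ 3 * l := by linarith
  have e1 := (h.taylor s (s + l)).trans (hpow _ (by
    rw [add_sub_cancel_left, abs_of_pos hl]; linarith))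
  rw [add_sub_cancel_left, abs_of_pos hl] at e1
  have e2 := (h₀.taylor a b).trans (hpow _ hu3)
  have e3 : ‖l • deriv Γ s - u • deriv Γ₀ a‖ ≤ 6 * (l / 1000) := by
    calc ‖l • deriv Γ s - u • deriv Γ₀ a‖
        = ‖-(Γ (s + l) - Γ s - l • deriv Γ s) + (Γ₀ b - Γ₀ a - u • deriv Γ₀ a) +
            ((Γ (s + l) - Γ₀ b) - (Γ s - Γ₀ a))‖ := by congr 1; module
      _ ≤ ‖Γ (s + l) - Γ s - l • deriv Γ s‖ + ‖Γ₀ b - Γ₀ a - u • deriv Γ₀ a‖ +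
            (‖Γ (s + l) - Γ₀ b‖ + ‖Γ s - Γ₀ a‖) := by
          refine norm_add₃_le.trans ?_
          rw [norm_neg]
          gcongr
          exact norm_sub_le _ _
      _ ≤ _ := by linarith
  have e4 : abs (l - |u|) ≤ 6 * (l / 1000) := by
    refine le_trans ?_ e3
    have := abs_norm_sub_norm_le (l • deriv Γ s) (u • deriv Γ₀ a)
    rwa [norm_smul, norm_smul, h.norm_deriv, h₀.norm_deriv, mul_one, mul_one, Real.norm_eq_abs,
      Real.norm_eq_abs, abs_of_pos hl] at this
  have key : ∀ o : ℝ, |u| * o = u → |o| = 1 → ‖deriv Γ s - o • deriv Γ₀ a‖ ≤ 1 / 32 := by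
    intro o ho ho1
    have : ‖l • (deriv Γ s - o • deriv Γ₀ a)‖ ≤ 12 * (l / 1000) := by
      calc ‖l • (deriv Γ s - o • deriv Γ₀ a)‖
          = ‖(l • deriv Γ s - u • deriv Γ₀ a) - ((l - |u|) * o) • deriv Γ₀ a‖ := by
            rw [sub_mul, ho]; congr 1; module
        _ ≤ ‖l • deriv Γ s - u • deriv Γ₀ a‖ + ‖((l - |u|) * o) • deriv Γ₀ a‖ := norm_sub_le _ _
        _ ≤ _ := by
            rw [norm_smul ((l - |u|) * o), h₀.norm_deriv, mul_one, norm_mul, Real.norm_eq_abs o,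
              ho1, mul_one, Real.norm_eq_abs]
            linarith
    rw [norm_smul, Real.norm_eq_abs, abs_of_pos hl] at this
    nlinarith
  rcases le_total 0 u with h0 | h0
  · left; simpa using key 1 (by rw [abs_of_nonneg h0, mul_one]) (by simp)
  · right; simpa using key (-1) (by rw [abs_of_nonpos h0]; ring) (by simp)

/-- A curve in a small neighbourhood of a given curve has nearly the same tangent, up to a global
sign. -/
lemma exists_tangent_sign (h₀ : HolderCurve β M ℓ L₀ Γ₀ Ω₀) (hδ : 0 < δ₀) (hδℓ : 2 * δ₀ ≤ ℓ)
    (hac : ArcChord L₀ δ₀ Γ₀) : ∃ ρ, 0 < ρ ∧ ∀ {L : ℝ} {Γ : ℝ → Plane} {Ω : Set Plane},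
      HolderCurve β M ℓ L Γ Ω → (∀ s, ∃ a, ‖Γ s - Γ₀ a‖ < ρ / 2) →
      (∀ s a, ‖Γ s - Γ₀ a‖ < ρ → ‖deriv Γ s - deriv Γ₀ a‖ ≤ 1 / 32) ∨
      (∀ s a, ‖Γ s - Γ₀ a‖ < ρ → ‖deriv Γ s + deriv Γ₀ a‖ ≤ 1 / 32) := by
  obtain ⟨ρ, hρ, hρδ, H⟩ := h₀.exists_tangent_dichotomy hδ hδℓ hac
  refine ⟨ρ, hρ, fun {L Γ Ω} h hnear => ?_⟩
  have hdich := H h fun s => (hnear s).imp fun a ha => by linarith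
  -- the two alternatives exclude each other
  have hexcl : ∀ {s a b}, ‖Γ s - Γ₀ a‖ < ρ → ‖Γ s - Γ₀ b‖ < ρ →
      ‖deriv Γ s - deriv Γ₀ a‖ ≤ 1 / 2 → ¬ ‖deriv Γ s + deriv Γ₀ b‖ ≤ 1 / 2 := by
    intro s a b ha hb h1 h2
    have hab : ‖Γ₀ b - Γ₀ a‖ < δ₀ := by
      calc ‖Γ₀ b - Γ₀ a‖ ≤ ‖Γ₀ b - Γ s‖ + ‖Γ s - Γ₀ a‖ := norm_sub_le_norm_sub_add_norm_sub _ _ _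
        _ < δ₀ := by rw [norm_sub_rev (Γ₀ b)]; linarith
    obtain ⟨k, hk⟩ := hac a b hab
    have h3 := h₀.holder a (b - k * L₀)
    rw [h₀.periodic_deriv.sub_int_mul_eq k, sub_right_comm] at h3
    have h4 := h₀.scale (b - a - k * L₀) (by linarith)
    have h5 : ‖(2 : ℝ) • deriv Γ₀ a‖ ≤ 1 / 2 + 1 / 2 + 1 / 8 := by
      calc ‖(2 : ℝ) • deriv Γ₀ a‖ = ‖-(deriv Γ s - deriv Γ₀ a) + (deriv Γ s + deriv Γ₀ b) +
            -(deriv Γ₀ b - deriv Γ₀ a)‖ := by congr 1; module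
        _ ≤ _ := by
          refine norm_add₃_le.trans ?_
          rw [norm_neg, norm_neg]
          linarith
    rw [norm_smul, h₀.norm_deriv] at h5
    norm_num at h5
  -- A gap between the alternatives: agreement up to `1/2` with one base point improves to `1/32`
  -- with every base point in reach. The slack absorbs a small change of `s`, so the sign is locally
  -- constant.
  have hpos : ∀ {s a}, ‖Γ s - Γ₀ a‖ < ρ → ‖deriv Γ s - deriv Γ₀ a‖ ≤ 1 / 2 →
      ∀ b, ‖Γ s - Γ₀ b‖ < ρ → ‖deriv Γ s - deriv Γ₀ b‖ ≤ 1 / 32 := fun ha h1 b hb =>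
    (hdich _ b hb).resolve_right fun h2 => hexcl ha hb h1 (h2.trans (by norm_num))
  have hloc : ∀ s, ∀ᶠ s' in 𝓝 s,
      ((∀ a, ‖Γ s' - Γ₀ a‖ < ρ → ‖deriv Γ s' - deriv Γ₀ a‖ ≤ 1 / 32) ↔
        ∀ a, ‖Γ s - Γ₀ a‖ < ρ → ‖deriv Γ s - deriv Γ₀ a‖ ≤ 1 / 32) := by
    intro s
    obtain ⟨a, ha⟩ := hnear s
    have c1 : ∀ᶠ s' in 𝓝 s, ‖Γ s' - Γ₀ a‖ < ρ / 2 :=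
      (h.continuous.sub continuous_const).norm.continuousAt.eventually_lt continuousAt_const ha
    have c2 : ∀ᶠ s' in 𝓝 s, ‖deriv Γ s' - deriv Γ s‖ < 1 / 8 :=
      (h.continuous_deriv.sub continuous_const).norm.continuousAt.eventually_lt continuousAt_const
        (by simp)
    filter_upwards [c1, c2] with s' h1 h2
    constructor
    · intro H'
      refine hpos (a := a) (by linarith) ?_
      have := norm_sub_le_norm_sub_add_norm_sub (deriv Γ s) (deriv Γ s') (deriv Γ₀ a)
      rw [norm_sub_rev (deriv Γ s) (deriv Γ s')] at this
      linarith [H' a (by linarith)]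
    · intro H'
      refine hpos (a := a) (by linarith) ?_
      have := norm_sub_le_norm_sub_add_norm_sub (deriv Γ s') (deriv Γ s) (deriv Γ₀ a)
      linarith [H' a (by linarith)]
  have hall := forall_iff_of_eventually_iff hloc
  by_cases hp : ∀ a, ‖Γ 0 - Γ₀ a‖ < ρ → ‖deriv Γ 0 - deriv Γ₀ a‖ ≤ 1 / 32
  · exact Or.inl fun s => (hall 0 s).1 hp
  · refine Or.inr fun s a hsa => (hdich s a hsa).resolve_left fun h1 => hp ?_
    exact (hall s 0).1 (hpos hsa (h1.trans (by norm_num)))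

end HolderCurve

/-! ### Uniform geometry of the moving boundary -/

/-- A continuously moving patch domain with uniformly Hölder tangents. -/
structure MovingCurve (β M ℓ T : ℝ) (Ω : ℝ → Set Plane) (L : ℝ → ℝ) (Γ : ℝ → ℝ → Plane) :
    Prop where
  patch : ∀ t ∈ Icc 0 T, IsPatchDomain (Ω t)
  curve : ∀ t ∈ Icc 0 T, HolderCurve β M ℓ (L t) (Γ t) (Ω t)
  cont : BoundaryContinuous T Ω

/-- Locally bounded below quantities on a compact interval are bounded below. -/
lemma exists_uniform_of_local {T : ℝ} {p : ℝ → ℝ → Prop}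
    (hmono : ∀ t δ δ', δ' ≤ δ → p t δ → p t δ')
    (hloc : ∀ t ∈ Icc 0 T, ∃ δ > 0, ∀ᶠ s in 𝓝[Icc 0 T] t, p s δ) :
    ∃ δ > 0, ∀ t ∈ Icc 0 T, p t δ := by
  refine isCompact_Icc.induction_on (p := fun S => ∃ δ > 0, ∀ t ∈ S, p t δ)
    ⟨1, one_pos, by simp⟩ ?_ ?_ ?_
  · rintro s t hst ⟨δ, hδ, h⟩
    exact ⟨δ, hδ, fun x hx => h x (hst hx)⟩
  · rintro s t ⟨δ, hδ, h⟩ ⟨δ', hδ', h'⟩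
    refine ⟨min δ δ', lt_min hδ hδ', fun x hx => ?_⟩
    rcases hx with hx | hx
    · exact hmono _ _ _ (min_le_left _ _) (h x hx)
    · exact hmono _ _ _ (min_le_right _ _) (h' x hx)
  · intro t ht
    obtain ⟨δ, hδ, h⟩ := hloc t ht
    exact ⟨{s | p s δ}, h, δ, hδ, fun s hs => hs⟩

namespace MovingCurve

variable {β M ℓ T : ℝ} {Ω : ℝ → Set Plane} {L : ℝ → ℝ} {Γ : ℝ → ℝ → Plane}

section
variable (H : MovingCurve β M ℓ T Ω L Γ)
include H

lemma eventually_near {t₀ : ℝ} (ht₀ : t₀ ∈ Icc 0 T) {η : ℝ} (hη : 0 < η) :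
    ∀ᶠ t in 𝓝[Icc 0 T] t₀, (∀ P ∈ frontier (Ω t), ∃ Q ∈ frontier (Ω t₀), ‖P - Q‖ < η) ∧
      ∀ Q ∈ frontier (Ω t₀), ∃ P ∈ frontier (Ω t), ‖P - Q‖ < η := by
  filter_upwards [(H.cont t₀ ht₀).eventually_lt_const hη, self_mem_nhdsWithin] with t h1 ht
  have hfin := Metric.hausdorffEDist_ne_top_of_nonempty_of_bounded
    (H.curve t ht).nonempty_frontier (H.curve t₀ ht₀).nonempty_frontier
    (H.curve t ht).isCompact_frontier.isBounded (H.curve t₀ ht₀).isCompact_frontier.isBounded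
  refine ⟨fun P hP => ?_, fun Q hQ => ?_⟩
  · obtain ⟨Q, hQ, hPQ⟩ := Metric.exists_dist_lt_of_hausdorffDist_lt hP h1 hfin
    exact ⟨Q, hQ, by rwa [← dist_eq_norm]⟩
  · obtain ⟨P, hP, hPQ⟩ := Metric.exists_dist_lt_of_hausdorffDist_lt' hQ h1 hfin
    exact ⟨P, hP, by rwa [← dist_eq_norm]⟩

/-- For times near `t₀`, all tangents agree within `1/32`, up to one global sign, with those of the
curve at `t₀`. Two points within `ρ/2` of each other therefore have tangents `1/16` apart whatever
the sign, and `HolderCurve.arcChord_of_coherent` applies with a constant depending on `t₀` only. -/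
lemma exists_uniform_arcChord (hT : 0 ≤ T) : ∃ δ > 0, 2 * δ ≤ ℓ ∧ ∀ t ∈ Icc 0 T, ArcChord (L t) δ (Γ t) := by
  obtain ⟨δ, hδ, hδu⟩ := exists_uniform_of_local (T := T)
    (p := fun t δ => ArcChord (L t) δ (Γ t)) (fun t δ δ' hδ h => h.mono hδ) fun t₀ ht₀ => by
      have h₀ := H.curve t₀ ht₀
      obtain ⟨δ₀, hδ₀, hδ₀ℓ, hac₀⟩ := h₀.exists_arcChord
      obtain ⟨ρ, hρ, Hρ⟩ := h₀.exists_tangent_sign hδ₀ hδ₀ℓ hac₀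
      refine ⟨min (ρ / 2) ℓ / 4, by have := h₀.scale_pos; positivity, ?_⟩
      filter_upwards [H.eventually_near ht₀ (half_pos hρ), self_mem_nhdsWithin] with t hnear ht
      have h := H.curve t ht
      have hn : ∀ s, ∃ a, ‖Γ t s - Γ t₀ a‖ < ρ / 2 := by
        intro s
        obtain ⟨Q, hQ, hPQ⟩ := hnear.1 _ (h.mem_frontier s)
        obtain ⟨a, rfl⟩ := h₀.exists_eq hQ
        exact ⟨a, hPQ⟩
      refine h.arcChord_of_coherent (H.patch t ht) fun s s' hs => ?_
      obtain ⟨a, ha⟩ := hn s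
      have ha' : ‖Γ t s' - Γ t₀ a‖ < ρ := by
        have := norm_sub_le_norm_sub_add_norm_sub (Γ t s') (Γ t s) (Γ t₀ a)
        linarith
      rcases Hρ h hn with hp | hp
      · have h1 := hp s a (by linarith)
        have h2 := hp s' a ha'
        have := norm_sub_le_norm_sub_add_norm_sub (deriv (Γ t) s') (deriv (Γ t₀) a) (deriv (Γ t) s)
        rw [norm_sub_rev (deriv (Γ t₀) a)] at this
        linarith
      · have h1 := hp s a (by linarith)
        have h2 := hp s' a ha'
        have := norm_sub_le (deriv (Γ t) s' + deriv (Γ t₀) a) (deriv (Γ t) s + deriv (Γ t₀) a)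
        rw [add_sub_add_right_eq_sub] at this
        linarith
  have hℓ := (H.curve 0 ⟨le_rfl, hT⟩).scale_pos
  exact ⟨min δ (ℓ / 2), by positivity, by linarith [min_le_right δ (ℓ / 2)],
    fun t ht => (hδu t ht).mono (min_le_left _ _)⟩

/-- Compactness in time bounds the boundaries. A point of `Ω t` farther out would carry with it the
whole outward ray, which cannot leave `Ω t` without meeting the boundary. -/
lemma exists_bound : ∃ R > 0, ∀ t ∈ Icc 0 T, ∀ X ∈ closure (Ω t), ‖X‖ ≤ R := by
  -- `δ` is the reciprocal of a radius, which gives the predicate the monotonicity required by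
  -- `exists_uniform_of_local`.
  obtain ⟨δ, hδ, hδu⟩ := exists_uniform_of_local (T := T)
    (p := fun t δ => ∀ P ∈ frontier (Ω t), δ * ‖P‖ ≤ 1) (fun t δ δ' hδ h P hP =>
      (mul_le_mul_of_nonneg_right hδ (norm_nonneg _)).trans (h P hP)) fun t₀ ht₀ => by
      obtain ⟨R, hR⟩ := (H.curve t₀ ht₀).isCompact_frontier.isBounded.exists_norm_le
      refine ⟨1 / (|R| + 1), by positivity, ?_⟩
      filter_upwards [H.eventually_near ht₀ one_pos] with t ht P hP
      obtain ⟨Q, hQ, hPQ⟩ := ht.1 P hP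
      rw [div_mul_eq_mul_div, one_mul, div_le_one (by positivity)]
      have := norm_le_norm_add_norm_sub' P Q
      linarith [hR Q hQ, le_abs_self R]
  refine ⟨1 / δ, by positivity, fun t ht => ?_⟩
  have hfr : ∀ P ∈ frontier (Ω t), ‖P‖ ≤ 1 / δ := fun P hP => by
    rw [le_div_iff₀ hδ, mul_comm]; exact hδu t ht P hP
  have hin : ∀ X ∈ Ω t, ‖X‖ ≤ 1 / δ := by
    intro X hX
    by_contra hlt
    rw [not_le] at hlt
    have hδ' : 0 < 1 / δ := by positivity
    obtain ⟨R, hR⟩ := (H.patch t ht).isBounded.exists_norm_le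
    have hray : ∀ c : ℝ, 1 ≤ c → c • X ∈ Ω t := by
      intro c hc
      refine (mem_iff_mem_of_isPreconnected (S := (fun c : ℝ => c • X) '' Ici 1)
        (isPreconnected_Ici.image _ (by fun_prop)) ?_ ⟨1, by simp, one_smul _ _⟩ ⟨c, hc, rfl⟩).1 hX
      rintro _ ⟨c', hc', rfl⟩ hf
      have := hfr _ hf
      rw [norm_smul, Real.norm_of_nonneg (by linarith [mem_Ici.1 hc'])] at this
      nlinarith [mem_Ici.1 hc']
    have := hR _ (hray (max 1 (R / ‖X‖ + 1)) (le_max_left _ _))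
    rw [norm_smul, Real.norm_of_nonneg (by positivity)] at this
    have hXpos : 0 < ‖X‖ := hδ'.trans hlt
    have h2 : (R / ‖X‖ + 1) * ‖X‖ ≤ R :=
      (mul_le_mul_of_nonneg_right (le_max_right _ _) hXpos.le).trans this
    rw [add_mul, div_mul_cancel₀ _ hXpos.ne'] at h2
    linarith
  intro X hX
  rw [closure_eq_self_union_frontier] at hX
  exact hX.elim (hin X) (hfr X)

/-- The lengths of the curves are bounded: points equally spaced along a curve are separated. -/
lemma exists_length_le (hT : 0 ≤ T) : ∃ Λ, ∀ t ∈ Icc 0 T, L t ≤ Λ := by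
  obtain ⟨δ, hδ, hδℓ, hac⟩ := H.exists_uniform_arcChord hT
  obtain ⟨R, hR, hRb⟩ := H.exists_bound
  have hℓ := (H.curve 0 ⟨le_rfl, hT⟩).scale_pos
  obtain ⟨S, -, hSfin, hScov⟩ := (isCompact_closedBall (0 : Plane) R).finite_cover_balls
    (half_pos hδ)
  refine ⟨ℓ * (hSfin.toFinset.card + 1), fun t ht => ?_⟩
  have h := H.curve t ht
  by_contra hlt
  rw [not_le] at hlt
  have hc : ∀ i : ℕ, ∃ c ∈ S, ‖Γ t (i * ℓ) - c‖ < δ / 2 := by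
    intro i
    have : Γ t (i * ℓ) ∈ Metric.closedBall (0 : Plane) R := by
      rw [mem_closedBall_zero_iff]
      exact hRb t ht _ (frontier_subset_closure (h.mem_frontier _))
    obtain ⟨c, hc, hcb⟩ := mem_iUnion₂.1 (hScov this)
    exact ⟨c, hc, by rwa [← dist_eq_norm]⟩
  choose c hcS hcb using hc
  -- With `N` balls of radius `δ/2` and `N + 1` points spaced by `ℓ`, two points are `δ`-close
  -- although their parameters differ by between `ℓ` and `Nℓ`. If `L > (N + 1)ℓ`, such a difference
  -- is at least `ℓ` away from every multiple of `L`, contradicting the arc-chord condition since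
  -- `2δ ≤ ℓ`.
  obtain ⟨i, hi, j, hj, hij, hcij⟩ := Finset.exists_ne_map_eq_of_card_lt_of_maps_to
    (s := Finset.range (hSfin.toFinset.card + 1)) (t := hSfin.toFinset) (by simp)
    (f := c) (fun i _ => by simpa using hcS i)
  wlog hlt' : i < j generalizing i j
  · exact this j hj i hi hij.symm hcij.symm (by omega)
  have hnear : ‖Γ t (j * ℓ) - Γ t (i * ℓ)‖ < δ := by
    calc ‖Γ t (j * ℓ) - Γ t (i * ℓ)‖ ≤ ‖Γ t (j * ℓ) - c j‖ + ‖c j - Γ t (i * ℓ)‖ :=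
          norm_sub_le_norm_sub_add_norm_sub _ _ _
      _ < δ := by rw [norm_sub_rev (c j), ← hcij]; linarith [hcb i, hcij ▸ hcb j]
  obtain ⟨k, hk⟩ := hac t ht _ _ hnear
  have hk' : |(j : ℝ) * ℓ - i * ℓ - k * L t| < ℓ := by linarith
  have h1 : (i : ℝ) + 1 ≤ j := by exact_mod_cast hlt'
  have h2 : (j : ℝ) ≤ hSfin.toFinset.card := by
    have : j ≤ hSfin.toFinset.card := by simpa [Nat.lt_succ_iff] using hj
    exact_mod_cast this
  have hi0 : (0 : ℝ) ≤ i := by positivity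
  rw [abs_lt] at hk'
  have hL := h.length_pos
  rcases le_or_gt k 0 with hk0 | hk0
  · have : (k : ℝ) ≤ 0 := by exact_mod_cast hk0
    nlinarith
  · have : (1 : ℝ) ≤ k := by exact_mod_cast hk0
    nlinarith

/-- Connected compact sets off the curve stay on one side for nearby times. -/
lemma eventually_mem_iff_of_isPreconnected {t₀ : ℝ} (ht₀ : t₀ ∈ Icc 0 T) {K : Set Plane}
    (hK : IsCompact K) (hKc : IsPreconnected K) (hd : ∀ X ∈ K, X ∉ frontier (Ω t₀)) :
    ∀ᶠ t in 𝓝[Icc 0 T] t₀, ∀ X ∈ K, X ∉ frontier (Ω t) ∧ ∀ Y ∈ K, X ∈ Ω t ↔ Y ∈ Ω t := by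
  obtain ⟨η, hη, hηK⟩ := hK.exists_thickening_subset_open isClosed_frontier.isOpen_compl
    (fun X hX => hd X hX)
  filter_upwards [H.eventually_near ht₀ hη] with t ht
  have hd' : ∀ X ∈ K, X ∉ frontier (Ω t) := by
    intro X hX hXf
    obtain ⟨Q, hQ, hXQ⟩ := ht.1 X hXf
    refine hηK (Metric.mem_thickening_iff.2 ⟨X, hX, ?_⟩) hQ
    rwa [dist_comm, dist_eq_norm]
  exact fun X hX => ⟨hd' X hX, fun Y hY => mem_iff_mem_of_isPreconnected hKc hd' hX hY⟩

lemma eventually_mem_iff_of_joinedIn {t₀ : ℝ} (ht₀ : t₀ ∈ Icc 0 T) {X Y : Plane}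
    (hXY : JoinedIn (frontier (Ω t₀))ᶜ X Y) : ∀ᶠ t in 𝓝[Icc 0 T] t₀, (X ∈ Ω t ↔ Y ∈ Ω t) := by
  obtain ⟨p, hp⟩ := hXY
  filter_upwards [H.eventually_mem_iff_of_isPreconnected ht₀ (isCompact_range p.continuous)
    (isPreconnected_range p.continuous) (by rintro _ ⟨r, rfl⟩; exact hp r)] with t ht
  exact (ht X ⟨0, p.source⟩).2 Y ⟨1, p.target⟩

/-- An exterior point is joined, off the boundary, to a point beyond the common bound, which is
exterior at all times. The path is compact, so it keeps off the boundary for nearby times. -/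
lemma eventually_not_mem {t₀ : ℝ} (ht₀ : t₀ ∈ Icc 0 T) {X : Plane} (hX : X ∉ closure (Ω t₀)) :
    ∀ᶠ t in 𝓝[Icc 0 T] t₀, X ∉ Ω t := by
  obtain ⟨δ, hδ, hδℓ, hac⟩ := (H.curve t₀ ht₀).exists_arcChord
  obtain ⟨R, hR, hRb⟩ := H.exists_bound
  obtain ⟨Y, hY⟩ : ∃ Y : Plane, R < ‖Y‖ := NormedSpace.exists_lt_norm ℝ Plane R
  have hYt : ∀ t ∈ Icc 0 T, Y ∉ closure (Ω t) := fun t ht hYc =>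
    absurd (hRb t ht Y hYc) (not_le.2 hY)
  filter_upwards [H.eventually_mem_iff_of_joinedIn ht₀ ((H.curve t₀ ht₀).joinedIn_exterior hδ hδℓ
    hac (H.patch t₀ ht₀) hX (hYt t₀ ht₀)), self_mem_nhdsWithin] with t h1 ht hXt
  exact hYt t ht (subset_closure (h1.1 hXt))

/-- Hausdorff continuity of the boundary does not by itself say on which side the domain lies. The
orientation settles it: if the tangents at time `t` had the opposite sign to those at `t₀`, then the
point `Γ t₀ a - (δ / 2) • n` would belong to `Ω t`, but it is exterior at `t₀` and so remains
outside. -/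
lemma eventually_mem {t₀ : ℝ} (ht₀ : t₀ ∈ Icc 0 T) {X : Plane} (hX : X ∈ Ω t₀) :
    ∀ᶠ t in 𝓝[Icc 0 T] t₀, X ∈ Ω t := by
  have hT : 0 ≤ T := ht₀.1.trans ht₀.2
  obtain ⟨δ, hδ, hδℓ, hac⟩ := H.exists_uniform_arcChord hT
  have h₀ := H.curve t₀ ht₀
  have hΩ₀ := H.patch t₀ ht₀
  have hXf : X ∉ frontier (Ω t₀) := fun hf => by
    rw [hΩ₀.isOpen.frontier_eq] at hf; exact hf.2 hX
  obtain ⟨a, ha⟩ := (h₀.exists_joinedIn hδ hδℓ (hac t₀ ht₀) hΩ₀ hXf).1 hX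
  obtain ⟨ρ, hρ, Hρ⟩ := h₀.exists_tangent_sign hδ hδℓ (hac t₀ ht₀)
  set n := perp (deriv (Γ t₀) a) with hn
  have hn1 : ‖n‖ = 1 := h₀.norm_perp_deriv a
  have hlow : Γ t₀ a - (δ / 2) • n ∉ closure (Ω t₀) := by
    have hm := h₀.lower_point_mem_cone hδ a
    rw [closure_eq_self_union_frontier]
    rintro (hc | hc)
    · exact h₀.lower_cone_disjoint hδ hδℓ (hac t₀ ht₀) hΩ₀ hm hc
    · exact h₀.cone_not_mem_frontier hδℓ (hac t₀ ht₀) (Or.inr rfl) hm hc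
  have hη : 0 < min (ρ / 2) (δ / 20) := by positivity
  filter_upwards [H.eventually_mem_iff_of_joinedIn ht₀ ha, H.eventually_not_mem ht₀ hlow,
    H.eventually_near ht₀ hη, self_mem_nhdsWithin] with t h1 h2 hnear ht
  have h := H.curve t ht
  obtain ⟨P, hP, hPa⟩ := hnear.2 _ (h₀.mem_frontier a)
  obtain ⟨s, rfl⟩ := h.exists_eq hP
  have hsρ : ‖Γ t s - Γ t₀ a‖ < ρ := by linarith [hPa.trans_le (min_le_left _ _)]
  have hsδ : ‖Γ t s - Γ t₀ a‖ < δ / 20 := hPa.trans_le (min_le_right _ _)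
  have hpt : ∀ o : ℝ, |o| = 1 → ‖deriv (Γ t) s - o • deriv (Γ t₀) a‖ ≤ 1 / 32 →
      Γ t₀ a + (o * (δ / 2)) • n ∈ Ω t := by
    intro o ho hso
    apply h.upper_cone_subset hδ hδℓ (hac t ht) s
    have e1 : Γ t₀ a + (o * (δ / 2)) • n - Γ t s = (o * (δ / 2)) • n - (Γ t s - Γ t₀ a) := by abel
    have e2 : ‖(o * (δ / 2)) • n‖ = δ / 2 := by
      rw [norm_smul, hn1, norm_mul, Real.norm_eq_abs o, ho, Real.norm_of_nonneg (by positivity)]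
      ring
    have e3 : ‖Γ t₀ a + (o * (δ / 2)) • n - Γ t s‖ < δ / 2 + δ / 20 := by
      rw [e1]; exact (norm_sub_le _ _).trans_lt (by rw [e2]; linarith)
    have ho2 : o * o = 1 := by rw [← abs_mul_abs_self, ho, one_mul]
    refine ⟨by linarith, ?_⟩
    have e4 : inner ℝ (perp (deriv (Γ t) s)) ((o * (δ / 2)) • n) =
        δ / 2 * (1 + inner ℝ (deriv (Γ t) s - o • deriv (Γ t₀) a) (o • deriv (Γ t₀) a)) := by
      rw [inner_smul_right, hn, inner_perp_perp, inner_sub_left, inner_smul_right, inner_smul_right,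
        inner_smul_left, real_inner_self_eq_norm_sq, h₀.norm_deriv]
      simp only [conj_trivial]
      linear_combination (δ / 2) * ho2
    have e5 := neg_le_of_abs_le (abs_real_inner_le_norm (deriv (Γ t) s - o • deriv (Γ t₀) a)
      (o • deriv (Γ t₀) a))
    rw [norm_smul, h₀.norm_deriv, Real.norm_eq_abs, ho, mul_one, mul_one] at e5
    have e6 := le_of_abs_le (abs_real_inner_le_norm (perp (deriv (Γ t) s)) (Γ t s - Γ t₀ a))
    rw [h.norm_perp_deriv, one_mul] at e6
    rw [e1] at e3 ⊢
    rw [inner_sub_right _ ((o * (δ / 2)) • n), e4]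
    nlinarith
  have hn' : ∀ s, ∃ a, ‖Γ t s - Γ t₀ a‖ < ρ / 2 := by
    intro s
    obtain ⟨Q, hQ, hPQ⟩ := hnear.1 _ (h.mem_frontier s)
    obtain ⟨a, rfl⟩ := h₀.exists_eq hQ
    exact ⟨a, hPQ.trans_le (min_le_left _ _)⟩
  rcases Hρ h hn' with hp | hp
  · rw [h1]
    simpa using hpt 1 (by simp) (by simpa using hp s a hsρ)
  · exfalso
    refine h2 ?_
    have := hpt (-1) (by simp) (by simpa using hp s a hsρ)
    rwa [neg_one_mul, neg_smul, ← sub_eq_add_neg] at this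

/-- Membership in the moving domain is locally constant in space and time off the boundary. -/
lemma eventually_mem_iff {t₀ : ℝ} (ht₀ : t₀ ∈ Icc 0 T) {X : Plane} (hX : X ∉ frontier (Ω t₀)) :
    ∀ᶠ q : Plane × ℝ in 𝓝 X ×ˢ 𝓝[Icc 0 T] t₀,
      q.1 ∉ frontier (Ω q.2) ∧ (q.1 ∈ Ω q.2 ↔ X ∈ Ω t₀) := by
  obtain ⟨r, hr, hrX⟩ := Metric.nhds_basis_closedBall.mem_iff.1
    (isClosed_frontier.isOpen_compl.mem_nhds hX)
  have h1 := H.eventually_mem_iff_of_isPreconnected ht₀ (isCompact_closedBall X r)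
    (convex_closedBall X r).isPreconnected fun Y hY => hrX hY
  have h2 : ∀ᶠ t in 𝓝[Icc 0 T] t₀, (X ∈ Ω t ↔ X ∈ Ω t₀) := by
    by_cases hXΩ : X ∈ Ω t₀
    · filter_upwards [H.eventually_mem ht₀ hXΩ] with t ht using iff_of_true ht hXΩ
    · have : X ∉ closure (Ω t₀) := by
        rw [closure_eq_self_union_frontier]; exact fun hc => hc.elim hXΩ hX
      filter_upwards [H.eventually_not_mem ht₀ this] with t ht using iff_of_false ht hXΩ
  have h3 : ∀ᶠ Y in 𝓝 X, Y ∈ Metric.closedBall X r := Metric.closedBall_mem_nhds X hr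
  filter_upwards [h3.prod_mk (h1.and h2)] with q hq
  exact ⟨(hq.2.1 q.1 hq.1).1,
    ((hq.2.1 q.1 hq.1).2 X (Metric.mem_closedBall_self hr.le)).trans hq.2.2⟩

end

end MovingCurve


/-! ### The Gauss-Green formula -/

open scoped Manifold

lemma inner_perp_left (x y : Plane) : inner ℝ (perp x) y = -inner ℝ x (perp y) := by
  rw [inner_plane, inner_plane]; simp

/-- The rotation taking the standard frame to `(-m^⊥, m)`. -/
noncomputable def frameMap {m : Plane} (hm : ‖m‖ = 1) : Plane ≃ₗᵢ[ℝ] Plane :=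
  LinearIsometry.toLinearIsometryEquiv (F := Plane) (E₁ := Plane)
    { toFun := fun x => x 0 • (-perp m) + x 1 • m
      map_add' := fun x y => by simp only [PiLp.add_apply]; module
      map_smul' := fun c x => by simp only [PiLp.smul_apply, smul_eq_mul, RingHom.id_apply]; module
      norm_map' := fun x => by
        have h := norm_sq_plane m
        rw [hm] at h
        rw [← sq_eq_sq₀ (norm_nonneg _) (norm_nonneg _), norm_sq_plane x]
        simp only [LinearMap.coe_mk, AddHom.coe_mk]
        rw [norm_sq_plane]
        simp
        linear_combination (-(x 0 ^ 2 + x 1 ^ 2)) * h } rfl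

lemma measurePreserving_frame {m : Plane} (hm : ‖m‖ = 1) :
    MeasurePreserving (fun q : ℝ × ℝ => q.1 • (-perp m) + q.2 • m) := by
  have h1 := (volume_preserving_finTwoArrow ℝ).symm
  have h2 := EuclideanSpace.volume_preserving_symm_measurableEquiv_toLp (Fin 2)
  exact ((frameMap hm).measurePreserving.comp h2.symm).comp h1

/-- Fubini's theorem in a rotated frame. -/
lemma integral_frame {m : Plane} (hm : ‖m‖ = 1) {F : Plane → ℝ} (hF : Integrable F) :
    ∫ x, F x = ∫ a : ℝ, ∫ b : ℝ, F (a • (-perp m) + b • m) := by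
  have hmp := measurePreserving_frame hm
  have hF' : Integrable F (Measure.map (fun q : ℝ × ℝ => q.1 • (-perp m) + q.2 • m) volume) := by
    rwa [hmp.map_eq]
  rw [← hmp.map_eq, integral_map hmp.measurable.aemeasurable hF'.aestronglyMeasurable]
  rw [Measure.volume_eq_prod, integral_prod]
  have := hmp.integrable_comp_of_integrable hF
  rwa [Measure.volume_eq_prod] at this

section compact
variable {g : Plane → ℝ} (hg : ContDiff ℝ 1 g)
include hg

lemma continuous_fderiv_apply (e : Plane) : Continuous fun x => fderiv ℝ g x e :=
  (hg.continuous_fderiv (by simp)).clm_apply continuous_const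

lemma hasDerivAt_line (X m : Plane) (b : ℝ) :
    HasDerivAt (fun b : ℝ => g (X + b • m)) (fderiv ℝ g (X + b • m) m) b := by
  have h1 : HasDerivAt (fun b : ℝ => X + b • m) m b := by
    simpa using ((hasDerivAt_id b).smul_const m).const_add X
  exact ((hg.differentiable (by simp)) _).hasFDerivAt.comp_hasDerivAt b h1

variable (hc : HasCompactSupport g)
include hc

omit hg in
lemma hasCompactSupport_fderiv_apply (e : Plane) : HasCompactSupport fun x => fderiv ℝ g x e :=
  (hc.fderiv (𝕜 := ℝ)).comp_left (g := fun T : Plane →L[ℝ] ℝ => T e) rfl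

lemma integrable_fderiv_apply (e : Plane) : Integrable fun x => fderiv ℝ g x e :=
  (continuous_fderiv_apply hg e).integrable_of_hasCompactSupport
    (hasCompactSupport_fderiv_apply hc e)

omit hg in
lemma hasCompactSupport_line (X : Plane) {m : Plane} (hm : ‖m‖ = 1) :
    HasCompactSupport fun b : ℝ => g (X + b • m) := by
  have hiso : Isometry fun b : ℝ => X + b • m := by
    refine Isometry.of_dist_eq fun a b => ?_
    rw [dist_add_left, dist_eq_norm, ← sub_smul, norm_smul, hm, mul_one, ← dist_eq_norm]
  exact hc.comp_isClosedEmbedding hiso.isClosedEmbedding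

lemma integral_fderiv_line_Ioi (X : Plane) {m : Plane} (hm : ‖m‖ = 1) (b₀ : ℝ) :
    ∫ b in Ioi b₀, fderiv ℝ g (X + b • m) m = -g (X + b₀ • m) := by
  have h1 : (fun b : ℝ => fderiv ℝ g (X + b • m) m) = deriv fun b : ℝ => g (X + b • m) :=
    funext fun b => (hasDerivAt_line hg X m b).deriv.symm
  rw [h1]
  exact (hasCompactSupport_line hc X hm).integral_Ioi_deriv_eq (hg.comp (by fun_prop)) b₀

lemma integral_fderiv_line (X : Plane) {m : Plane} (hm : ‖m‖ = 1) :
    ∫ b : ℝ, fderiv ℝ g (X + b • m) m = 0 := by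
  refine integral_eq_zero_of_hasDerivAt_of_integrable (fun b => hasDerivAt_line hg X m b) ?_
    ((hg.continuous.comp (by fun_prop)).integrable_of_hasCompactSupport
      (hasCompactSupport_line hc X hm))
  exact ((continuous_fderiv_apply hg m).comp (by fun_prop)).integrable_of_hasCompactSupport
    (hasCompactSupport_line (hasCompactSupport_fderiv_apply hc m) X hm)

lemma integral_fderiv_eq_zero {m : Plane} (hm : ‖m‖ = 1) : ∫ x, fderiv ℝ g x m = 0 := by
  rw [integral_frame hm (integrable_fderiv_apply hg hc m)]
  simp only [integral_fderiv_line hg hc _ hm, integral_zero]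

end compact

namespace HolderCurve

variable {β M ℓ L δ : ℝ} {Γ : ℝ → Plane} {Ω : Set Plane}

/-- On each line of direction `m` meeting the local arc, `Ω` is, within the support of `g`, the half
line above the crossing, so the inner integral equals `-g` there. Passing from the transversal
coordinate to arc length produces the Jacobian `inner ℝ (perp (deriv Γ s)) m`, which is positive by
transversality. -/
lemma gaussGreen_transversal (h : HolderCurve β M ℓ L Γ Ω) (hΩ : IsPatchDomain Ω) (hδ : 0 < δ)
    (hδℓ : 2 * δ ≤ ℓ) (hac : ArcChord L δ Γ) {g : Plane → ℝ} (hg : ContDiff ℝ 1 g) {s₀ : ℝ}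
    (hsupp : tsupport g ⊆ Metric.ball (Γ s₀) (δ / 4)) {m : Plane} (hm : ‖m‖ = 1)
    (hmn : 4 / 5 ≤ inner ℝ (perp (deriv Γ s₀)) m) :
    ∫ x in Ω, fderiv ℝ g x m =
      -∫ s in (s₀ - L / 2)..(s₀ + L / 2), g (Γ s) * inner ℝ (perp (deriv Γ s)) m := by
  set r := δ / 4 with hr
  have hL := h.scale_lt_length
  have hgc : HasCompactSupport g :=
    (isCompact_closedBall (Γ s₀) r).of_isClosed_subset (isClosed_tsupport g)
      (hsupp.trans Metric.ball_subset_closedBall)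
  have hout : ∀ x, r ≤ ‖x - Γ s₀‖ → fderiv ℝ g x m = 0 ∧ g x = 0 := by
    intro x hx
    have hx' : x ∉ tsupport g := fun hxs => by
      have := hsupp hxs
      rw [Metric.mem_ball, dist_eq_norm] at this
      linarith
    refine ⟨?_, image_eq_zero_of_notMem_tsupport hx'⟩
    rw [fderiv_of_notMem_tsupport ℝ hx']; rfl
  set e := -perp m with he
  have he1 : ‖e‖ = 1 := by rw [he, norm_neg, norm_perp, hm]
  have hpe : perp e = m := by rw [he, perp_neg, perp_perp, neg_neg]
  -- transversality along the local arc
  set J := Icc (s₀ - 2 * r) (s₀ + 2 * r) with hJ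
  have htrans : ∀ s ∈ J, 1 / 2 < inner ℝ (perp (deriv Γ s)) m := by
    intro s hs
    have hs' : |s - s₀| ≤ ℓ := by
      have : |s - s₀| ≤ 2 * r := abs_le.2 ⟨by linarith [hs.1], by linarith [hs.2]⟩
      linarith
    have h1 := (h.holder s₀ s).trans (h.scale _ hs')
    have h2 := neg_le_of_abs_le
      (abs_real_inner_le_norm (perp (deriv Γ s) - perp (deriv Γ s₀)) m)
    rw [← perp_sub, norm_perp, hm, mul_one] at h2
    rw [perp_sub, inner_sub_left] at h2
    linarith
  set α : ℝ → ℝ := fun s => inner ℝ e (Γ s) with hα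
  have hαd : ∀ s, HasDerivAt α (inner ℝ (perp (deriv Γ s)) m) s := by
    intro s
    have h1 := (hasDerivAt_const s e).inner ℝ (h.hasDerivAt s)
    have h2 : inner ℝ (perp (deriv Γ s)) m = inner ℝ e (deriv Γ s) + inner ℝ (0 : Plane) (Γ s) := by
      rw [inner_zero_left, add_zero, inner_perp_left, real_inner_comm, he, inner_neg_left]
    rw [h2]; exact h1
  have hαmono : StrictMonoOn α J := by
    refine strictMonoOn_of_deriv_pos (convex_Icc _ _)
      (fun s _ => (hαd s).continuousAt.continuousWithinAt) fun s hs => ?_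
    rw [(hαd s).deriv]
    linarith [htrans s (interior_subset hs)]
  have hαimg : ∀ a, |a - α s₀| ≤ r → a ∈ α '' J := by
    intro a ha
    have hgrow : ∀ x ∈ J, ∀ y ∈ J, x ≤ y → 1 / 2 * (y - x) ≤ α y - α x := by
      refine (convex_Icc _ _).mul_sub_le_image_sub_of_le_deriv
        (fun s _ => (hαd s).continuousAt.continuousWithinAt)
        (fun s _ => (hαd s).differentiableAt.differentiableWithinAt) fun s hs => ?_
      rw [(hαd s).deriv]
      exact (htrans s (interior_subset hs)).le
    have hr0 : 0 < r := by positivity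
    have g1 := hgrow (s₀ - 2 * r) ⟨le_rfl, by linarith⟩ s₀ ⟨by linarith, by linarith⟩ (by linarith)
    have g2 := hgrow s₀ ⟨by linarith, by linarith⟩ (s₀ + 2 * r) ⟨by linarith, le_rfl⟩ (by linarith)
    rw [abs_le] at ha
    exact intermediate_value_Icc (by linarith)
      (fun s _ => (hαd s).continuousAt.continuousWithinAt) ⟨by linarith, by linarith⟩
  -- the boundary integral is supported in the local arc
  have hbdry : ∫ s in (s₀ - L / 2)..(s₀ + L / 2), g (Γ s) * inner ℝ (perp (deriv Γ s)) m =
      ∫ s in J, g (Γ s) * inner ℝ (perp (deriv Γ s)) m := by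
    rw [intervalIntegral.integral_of_le (by linarith [h.length_pos]), ← integral_Icc_eq_integral_Ioc]
    apply setIntegral_eq_of_subset_of_forall_sdiff_eq_zero measurableSet_Icc
    · exact Icc_subset_Icc (by linarith) (by linarith)
    · rintro s ⟨hs1, hs2⟩
      rcases lt_or_ge ‖Γ s - Γ s₀‖ r with hlt | hge
      · exfalso
        obtain ⟨k, hk⟩ := hac s₀ s (by linarith)
        have hk' : |s - s₀ - k * L| < 2 * r := by linarith
        rw [abs_lt] at hk'
        have hk0 : k = 0 := by
          have h1 : (k : ℝ) < 1 := by
            by_contra hcon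
            have := hs1.2
            nlinarith
          have h2 : (-1 : ℝ) < k := by
            by_contra hcon
            have := hs1.1
            nlinarith
          have h1' : k < 1 := by exact_mod_cast h1
          have h2' : -1 < k := by exact_mod_cast h2
          omega
        rw [hk0, Int.cast_zero, zero_mul, sub_zero] at hk'
        exact hs2 ⟨by linarith [hk'.1], by linarith [hk'.2]⟩
      · rw [(hout _ hge).2, zero_mul]
  -- the inner integrals
  set F : Plane → ℝ := Ω.indicator fun x => fderiv ℝ g x m with hF
  have hFi : Integrable F := (integrable_fderiv_apply hg hgc m).indicator hΩ.isOpen.measurableSet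
  have hline : ∀ s ∈ J, ∫ b : ℝ, F (α s • e + b • m) = -g (Γ s) := by
    intro s hs
    set b₀ := inner ℝ m (Γ s) with hb₀
    have hΓ : Γ s = α s • e + b₀ • m := by
      have := frame_expansion he1 (Γ s)
      rwa [hpe] at this
    have hss₀ : ‖Γ s - Γ s₀‖ ≤ 2 * r := (h.chord_le s₀ s).trans
      (abs_le.2 ⟨by linarith [hs.1], by linarith [hs.2]⟩)
    rw [hΓ, ← integral_fderiv_line_Ioi hg hgc (α s • e) hm b₀, ← integral_indicator measurableSet_Ioi]
    apply integral_congr_ae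
    have hne : ∀ᵐ b : ℝ, b ≠ b₀ := by
      rw [ae_iff]; simp
    filter_upwards [hne] with b hb
    have hX : α s • e + b • m = Γ s + (b - b₀) • m := by rw [hΓ]; module
    -- Within `δ` of the crossing the two cones decide membership in `Ω`; farther away the point has
    -- left the support of `g`.
    rcases lt_or_ge |b - b₀| δ with hlt | hge
    · rcases lt_or_gt_of_ne hb with hb | hb
      · rw [indicator_of_notMem (by simpa using hb.le), hF, indicator_of_notMem]
        rw [hX]
        apply h.lower_cone_disjoint hδ hδℓ hac hΩ (s := s)
        rw [abs_of_neg (by linarith)] at hlt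
        constructor
        · rw [add_sub_cancel_left, norm_smul, hm, mul_one, Real.norm_eq_abs, abs_of_neg] <;> linarith
        · rw [add_sub_cancel_left, norm_smul, hm, mul_one, Real.norm_eq_abs,
            abs_of_neg (by linarith), inner_smul_right, inner_neg_left]
          nlinarith [htrans s hs]
      · rw [indicator_of_mem (by simpa using hb), hF, indicator_of_mem]
        rw [hX]
        apply h.upper_cone_subset hδ hδℓ hac s
        rw [abs_of_pos (by linarith)] at hlt
        constructor
        · rw [add_sub_cancel_left, norm_smul, hm, mul_one, Real.norm_eq_abs, abs_of_pos] <;> linarith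
        · rw [add_sub_cancel_left, norm_smul, hm, mul_one, Real.norm_eq_abs,
            abs_of_pos (by linarith), inner_smul_right]
          nlinarith [htrans s hs]
    · have hfar : r ≤ ‖α s • e + b • m - Γ s₀‖ := by
        have h1 : ‖(b - b₀) • m‖ = |b - b₀| := by rw [norm_smul, hm, mul_one, Real.norm_eq_abs]
        have h2 : (b - b₀) • m = (α s • e + b • m - Γ s₀) - (Γ s - Γ s₀) := by rw [hX]; abel
        have h3 := norm_sub_le (α s • e + b • m - Γ s₀) (Γ s - Γ s₀)
        rw [← h2, h1] at h3
        linarith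
      have h0 := (hout _ hfar).1
      rw [hF]
      simp only [indicator, h0, ite_self]
  have hoff : ∀ a, a ∉ α '' J → ∫ b : ℝ, F (a • e + b • m) = 0 := by
    intro a ha
    have hzero : ∀ b : ℝ, F (a • e + b • m) = 0 := by
      intro b
      have hfar : r ≤ ‖a • e + b • m - Γ s₀‖ := by
        by_contra hlt
        rw [not_le] at hlt
        refine ha (hαimg a ?_)
        have h1 := abs_real_inner_le_norm e (a • e + b • m - Γ s₀)
        rw [he1, one_mul, inner_sub_right, inner_add_right, inner_smul_right, inner_smul_right,
          real_inner_self_eq_norm_sq, he1, ← hpe, inner_perp_self] at h1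
        simp only [one_pow, mul_one, mul_zero, add_zero] at h1
        rw [hpe] at h1
        exact h1.trans hlt.le
      rw [hF]
      simp only [indicator, (hout _ hfar).1, ite_self]
    simp only [hzero, integral_zero]
  calc ∫ x in Ω, fderiv ℝ g x m = ∫ x, F x := (integral_indicator hΩ.isOpen.measurableSet).symm
    _ = ∫ a : ℝ, ∫ b : ℝ, F (a • e + b • m) := integral_frame hm hFi
    _ = ∫ a in α '' J, ∫ b : ℝ, F (a • e + b • m) :=
        (setIntegral_eq_integral_of_forall_compl_eq_zero hoff).symm
    _ = ∫ s in J, |inner ℝ (perp (deriv Γ s)) m| • ∫ b : ℝ, F (α s • e + b • m) :=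
        integral_image_eq_integral_abs_deriv_smul measurableSet_Icc
          (fun s _ => (hαd s).hasDerivWithinAt) hαmono.injOn _
    _ = ∫ s in J, -(g (Γ s) * inner ℝ (perp (deriv Γ s)) m) := by
        apply setIntegral_congr_fun measurableSet_Icc
        intro s hs
        simp only [hline s hs, smul_eq_mul, abs_of_pos (by linarith [htrans s hs] :
          0 < inner ℝ (perp (deriv Γ s)) m)]
        ring
    _ = _ := by rw [integral_neg, hbdry]

end HolderCurve

namespace HolderCurve

variable {β M ℓ L δ : ℝ} {Γ : ℝ → Plane} {Ω : Set Plane}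

lemma continuous_boundary_integrand (h : HolderCurve β M ℓ L Γ Ω) {g : Plane → ℝ}
    (hg : Continuous g) (e : Plane) :
    Continuous fun s => g (Γ s) * inner ℝ (perp (deriv Γ s)) e := by
  have := h.continuous
  have := h.continuous_deriv
  fun_prop

/-- Both sides are linear in `e`, so two independent transversal directions suffice: the normal and
`3/5 τ + 4/5 n`, which attains the bound `4/5` required by `gaussGreen_transversal`. If the ball
misses the curve, it is entirely inside or outside `Ω` and both sides vanish. -/
lemma gaussGreen_local (h : HolderCurve β M ℓ L Γ Ω) (hΩ : IsPatchDomain Ω) (hδ : 0 < δ)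
    (hδℓ : 2 * δ ≤ ℓ) (hac : ArcChord L δ Γ) {g : Plane → ℝ} (hg : ContDiff ℝ 1 g) {x₀ : Plane}
    (hsupp : tsupport g ⊆ Metric.ball x₀ (δ / 8)) (e : Plane) :
    ∫ x in Ω, fderiv ℝ g x e =
      -∫ s in (0)..L, g (Γ s) * inner ℝ (perp (deriv Γ s)) e := by
  have hgc : HasCompactSupport g :=
    (isCompact_closedBall x₀ (δ / 8)).of_isClosed_subset (isClosed_tsupport g)
      (hsupp.trans Metric.ball_subset_closedBall)
  by_cases hmeet : ∃ s₀, Γ s₀ ∈ Metric.ball x₀ (δ / 8)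
  · obtain ⟨s₀, hs₀⟩ := hmeet
    have hsupp' : tsupport g ⊆ Metric.ball (Γ s₀) (δ / 4) := by
      intro x hx
      have h1 := hsupp hx
      rw [Metric.mem_ball] at h1 hs₀ ⊢
      have := dist_triangle_right x (Γ s₀) x₀
      linarith
    -- both sides are linear in the direction
    set Λ : Plane → ℝ := fun e => (∫ x in Ω, fderiv ℝ g x e) +
      ∫ s in (s₀ - L / 2)..(s₀ + L / 2), g (Γ s) * inner ℝ (perp (deriv Γ s)) e with hΛ
    have hlin : ∀ (a b : ℝ) (x y : Plane), Λ (a • x + b • y) = a * Λ x + b * Λ y := by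
      intro a b x y
      have i1 : ∫ z in Ω, fderiv ℝ g z (a • x + b • y) =
          a * (∫ z in Ω, fderiv ℝ g z x) + b * ∫ z in Ω, fderiv ℝ g z y := by
        simp only [map_add, map_smul, smul_eq_mul]
        rw [integral_add, integral_const_mul, integral_const_mul]
        · exact ((integrable_fderiv_apply hg hgc x).const_mul a).integrableOn
        · exact ((integrable_fderiv_apply hg hgc y).const_mul b).integrableOn
      have i2 : ∫ s in (s₀ - L / 2)..(s₀ + L / 2),
          g (Γ s) * inner ℝ (perp (deriv Γ s)) (a • x + b • y) =
          a * (∫ s in (s₀ - L / 2)..(s₀ + L / 2), g (Γ s) * inner ℝ (perp (deriv Γ s)) x) +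
          b * ∫ s in (s₀ - L / 2)..(s₀ + L / 2), g (Γ s) * inner ℝ (perp (deriv Γ s)) y := by
        rw [← intervalIntegral.integral_const_mul, ← intervalIntegral.integral_const_mul,
          ← intervalIntegral.integral_add]
        · congr 1; ext s
          rw [inner_add_right, inner_smul_right, inner_smul_right]; ring
        · exact ((h.continuous_boundary_integrand hg.continuous x).const_mul a
            ).intervalIntegrable _ _
        · exact ((h.continuous_boundary_integrand hg.continuous y).const_mul b
            ).intervalIntegrable _ _
      simp only [hΛ, i1, i2]; ring
    set τ := deriv Γ s₀ with hτ
    have hτ1 : ‖τ‖ = 1 := h.norm_deriv s₀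
    have hn1 : ‖perp τ‖ = 1 := by rw [norm_perp, hτ1]
    have hnn : inner ℝ (perp τ) (perp τ) = (1 : ℝ) := by
      rw [real_inner_self_eq_norm_sq, hn1, one_pow]
    have hz1 : Λ (perp τ) = 0 := by
      have := h.gaussGreen_transversal hΩ hδ hδℓ hac hg hsupp' hn1 (by rw [hnn]; norm_num)
      simp only [hΛ, this]; ring
    have hz2 : Λ ((3 / 5 : ℝ) • τ + (4 / 5 : ℝ) • perp τ) = 0 := by
      have hm1 : ‖(3 / 5 : ℝ) • τ + (4 / 5 : ℝ) • perp τ‖ = 1 := by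
        rw [← sq_eq_sq₀ (norm_nonneg _) zero_le_one, norm_sq_frame hτ1]
        simp only [inner_add_right, inner_smul_right, hnn, real_inner_self_eq_norm_sq, hτ1,
          inner_perp_self, real_inner_comm τ (perp τ)]
        norm_num
      have := h.gaussGreen_transversal hΩ hδ hδℓ hac hg hsupp' hm1 (by
        rw [inner_add_right, inner_smul_right, inner_smul_right, hnn,
          real_inner_comm τ (perp τ), inner_perp_self]; norm_num)
      simp only [hΛ, this]; ring
    have he : Λ e = 0 := by
      rw [frame_expansion hτ1 e]
      have : inner ℝ τ e • τ + inner ℝ (perp τ) e • perp τ =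
          (5 / 3 * inner ℝ τ e) • ((3 / 5 : ℝ) • τ + (4 / 5 : ℝ) • perp τ) +
          (inner ℝ (perp τ) e - 4 / 3 * inner ℝ τ e) • perp τ := by module
      rw [this, hlin, hz1, hz2, mul_zero, mul_zero, add_zero]
    have hper : Function.Periodic (fun s => g (Γ s) * inner ℝ (perp (deriv Γ s)) e) L := by
      intro s
      simp only [h.periodic s, h.periodic_deriv s]
    have hwin := hper.intervalIntegral_add_eq (s₀ - L / 2) 0
    rw [zero_add, show s₀ - L / 2 + L = s₀ + L / 2 by ring] at hwin
    rw [← hwin]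
    exact eq_neg_of_add_eq_zero_left he
  · push Not at hmeet
    have hz : ∀ s, g (Γ s) = 0 := fun s =>
      image_eq_zero_of_notMem_tsupport fun hs => hmeet s (hsupp hs)
    simp only [hz, zero_mul, intervalIntegral.integral_zero, neg_zero]
    have hnf : ∀ x ∈ Metric.ball x₀ (δ / 8), x ∉ frontier Ω := by
      intro x hx hf
      obtain ⟨s, rfl⟩ := h.exists_eq hf
      exact hmeet s hx
    have hfz : ∀ x, x ∉ Metric.ball x₀ (δ / 8) → fderiv ℝ g x e = 0 := fun x hx => by
      rw [fderiv_of_notMem_tsupport ℝ fun hs => hx (hsupp hs)]; rfl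
    have hx₀ : x₀ ∈ Metric.ball x₀ (δ / 8) := Metric.mem_ball_self (by positivity)
    have hside := fun x hx => mem_iff_mem_of_isPreconnected
      (convex_ball x₀ (δ / 8)).isPreconnected hnf hx₀ (y := x) hx
    by_cases hin : x₀ ∈ Ω
    · rw [setIntegral_eq_integral_of_forall_compl_eq_zero fun x hx =>
        hfz x fun hxb => hx ((hside x hxb).1 hin)]
      rcases eq_or_ne e 0 with rfl | he
      · simp
      · have h1 := integral_fderiv_eq_zero hg hgc (m := (‖e‖⁻¹ : ℝ) • e) (by
          rw [norm_smul, norm_inv, norm_norm, inv_mul_cancel₀ (norm_ne_zero_iff.2 he)])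
        simp only [map_smul, smul_eq_mul, integral_const_mul] at h1
        exact (mul_eq_zero.1 h1).resolve_left (inv_ne_zero (norm_ne_zero_iff.2 he))
    · apply setIntegral_eq_zero_of_forall_eq_zero
      intro x hx
      exact hfz x fun hxb => hin ((hside x hxb).2 hx)

/-- **Gauss-Green formula** for a patch domain with Hölder continuous tangent. -/
lemma gaussGreen (h : HolderCurve β M ℓ L Γ Ω) (hΩ : IsPatchDomain Ω) {g : Plane → ℝ}
    (hg : ContDiff ℝ 1 g) (e : Plane) :
    ∫ x in Ω, fderiv ℝ g x e = -∫ s in (0)..L, g (Γ s) * inner ℝ (perp (deriv Γ s)) e := by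
  obtain ⟨δ, hδ, hδℓ, hac⟩ := h.exists_arcChord
  have hcpt : IsCompact (closure Ω) := hΩ.isBounded.isCompact_closure
  obtain ⟨S, -, hSfin, hScov⟩ := hcpt.finite_cover_balls (show 0 < δ / 8 by positivity)
  have : Fintype S := hSfin.fintype
  obtain ⟨f, hf⟩ := SmoothPartitionOfUnity.exists_isSubordinate (I := 𝓘(ℝ, Plane))
    (isClosed_closure (s := Ω)) (fun c : S => Metric.ball (c : Plane) (δ / 8))
    (fun c => Metric.isOpen_ball) (fun x hx => by
      obtain ⟨c, hc, hxc⟩ := mem_iUnion₂.1 (hScov hx)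
      exact mem_iUnion.2 ⟨⟨c, hc⟩, hxc⟩)
  have hsum : ∀ x ∈ closure Ω, ∑ c, f c x = 1 := fun x hx => by
    rw [← finsum_eq_sum_of_fintype]; exact f.sum_eq_one hx
  have hfs : ∀ c, ContDiff ℝ 1 fun x => f c x * g x := fun c =>
    ((f c).contMDiff.contDiff.of_le (by simp)).mul hg
  have hts : ∀ c, tsupport (fun x => f c x * g x) ⊆ Metric.ball (c : Plane) (δ / 8) := fun c =>
    (tsupport_mul_subset_left).trans (hf c)
  have hcs : ∀ c, HasCompactSupport fun x => f c x * g x := fun c =>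
    (isCompact_closedBall (c : Plane) (δ / 8)).of_isClosed_subset (isClosed_tsupport _)
      ((hts c).trans Metric.ball_subset_closedBall)
  have h1 : ∫ x in Ω, fderiv ℝ g x e =
      ∑ c, ∫ x in Ω, fderiv ℝ (fun x => f c x * g x) x e := by
    rw [← integral_finsetSum _ fun c _ => (integrable_fderiv_apply (hfs c) (hcs c) e).integrableOn]
    apply setIntegral_congr_fun hΩ.isOpen.measurableSet
    intro x hx
    have hev : g =ᶠ[𝓝 x] fun y => ∑ c, f c y * g y := by
      filter_upwards [hΩ.isOpen.mem_nhds hx] with y hy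
      rw [← Finset.sum_mul, hsum y (subset_closure hy), one_mul]
    simp only
    rw [hev.fderiv_eq, fderiv_fun_sum fun c _ => ((hfs c).differentiable (by simp)) x]
    simp
  have h2 : ∫ s in (0)..L, g (Γ s) * inner ℝ (perp (deriv Γ s)) e =
      ∑ c, ∫ s in (0)..L, (f c (Γ s) * g (Γ s)) * inner ℝ (perp (deriv Γ s)) e := by
    rw [← intervalIntegral.integral_finsetSum fun c _ =>
      (h.continuous_boundary_integrand (hfs c).continuous e).intervalIntegrable _ _]
    congr 1; ext s
    rw [← Finset.sum_mul, ← Finset.sum_mul,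
      hsum _ (frontier_subset_closure (h.mem_frontier s)), one_mul]
  rw [h1, h2, ← Finset.sum_neg_distrib]
  exact Finset.sum_congr rfl fun c _ => h.gaussGreen_local hΩ hδ hδℓ hac (hfs c) (hts c) e

end HolderCurve

/-! ### The regularized velocity -/

/-- The velocity field of a domain for the regularized kernel. -/
noncomputable def regVelocity (α ε : ℝ) (Ω : Set Plane) (x : Plane) : Plane :=
  ∫ y in Ω, (‖x - y‖ ^ 2 + ε ^ 2) ^ (-α - 1) • perp (x - y)

lemma continuous_regKernel {ε : ℝ} (hε : 0 < ε) (r : ℝ) (x : Plane) :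
    Continuous fun y : Plane => (‖x - y‖ ^ 2 + ε ^ 2) ^ r := by
  refine Continuous.rpow_const (by fun_prop) fun y => Or.inl ?_
  positivity

lemma contDiff_regKernel {ε : ℝ} (hε : 0 < ε) (r : ℝ) (x : Plane) :
    ContDiff ℝ 1 fun y : Plane => (‖x - y‖ ^ 2 + ε ^ 2) ^ r := by
  refine ContDiff.rpow_const_of_ne ?_ fun y => ?_
  · exact ((contDiff_const.sub contDiff_id).norm_sq ℝ).add contDiff_const
  · positivity

lemma hasDerivAt_regKernel_comp {ε : ℝ} (hε : 0 < ε) (r : ℝ) {f : ℝ → Plane} {f' : Plane} {s : ℝ}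
    (hf : HasDerivAt f f' s) : HasDerivAt (fun s => (‖f s‖ ^ 2 + ε ^ 2) ^ r)
      (2 * r * (‖f s‖ ^ 2 + ε ^ 2) ^ (r - 1) * inner ℝ (f s) f') s := by
  have h1 : HasDerivAt (fun s => ‖f s‖ ^ 2 + ε ^ 2) (2 * inner ℝ (f s) f') s :=
    hf.norm_sq.add_const _
  have h2 := h1.rpow_const (p := r) (Or.inl (by positivity))
  convert h2 using 1
  ring

lemma fderiv_regKernel {ε : ℝ} (hε : 0 < ε) (r : ℝ) (x y w : Plane) :
    fderiv ℝ (fun y : Plane => (‖x - y‖ ^ 2 + ε ^ 2) ^ r) y w =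
      -(2 * r * (‖x - y‖ ^ 2 + ε ^ 2) ^ (r - 1) * inner ℝ (x - y) w) := by
  have h1 : HasDerivAt (fun b : ℝ => x - (y + b • w)) (-w) 0 := by
    have := (((hasDerivAt_id (0 : ℝ)).smul_const w).const_add y).const_sub x
    simpa using this
  have h2 := hasDerivAt_regKernel_comp hε r h1
  have h3 := hasDerivAt_line (contDiff_regKernel hε r x) y w 0
  rw [zero_smul, add_zero] at h2 h3
  rw [h3.unique h2, inner_neg_right, mul_neg]

namespace HolderCurve

variable {β M ℓ L δ : ℝ} {Γ : ℝ → Plane} {Ω : Set Plane}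

lemma continuous_regBoundary (h : HolderCurve β M ℓ L Γ Ω) {ε : ℝ} (hε : 0 < ε) (r : ℝ) (x : Plane) :
    Continuous fun s => (‖x - Γ s‖ ^ 2 + ε ^ 2) ^ r • deriv Γ s :=
  ((continuous_regKernel hε r x).comp h.continuous).smul h.continuous_deriv

/-- The regularized velocity as a boundary integral. -/
lemma regVelocity_eq (h : HolderCurve β M ℓ L Γ Ω) (hΩ : IsPatchDomain Ω) {α ε : ℝ}
    (hε : 0 < ε) (x : Plane) :
    (2 * α) • regVelocity α ε Ω x = ∫ s in (0)..L, (‖x - Γ s‖ ^ 2 + ε ^ 2) ^ (-α) • deriv Γ s := by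
  have hcpt : IsCompact (closure Ω) := hΩ.isBounded.isCompact_closure
  have hint : IntegrableOn (fun y => (‖x - y‖ ^ 2 + ε ^ 2) ^ (-α - 1) • perp (x - y)) Ω :=
    (((continuous_regKernel hε (-α - 1) x).smul (by fun_prop)).continuousOn.integrableOn_compact
      hcpt).mono_set subset_closure
  refine ext_inner_left ℝ fun e => ?_
  -- Paired with `e`, the rotated kernel is a multiple of the derivative of the smoothed potential
  -- in the direction `perp e`.
  have hgg := h.gaussGreen hΩ (contDiff_regKernel hε (-α) x) (perp e)
  simp only [fderiv_regKernel hε, inner_perp_perp] at hgg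
  have h1 : inner ℝ e ((2 * α) • regVelocity α ε Ω x) =
      -∫ y in Ω, -(2 * -α * (‖x - y‖ ^ 2 + ε ^ 2) ^ (-α - 1) * inner ℝ (x - y) (perp e)) := by
    rw [inner_smul_right, regVelocity, ← integral_inner hint, ← integral_const_mul, ← integral_neg]
    congr 1; ext y
    rw [inner_smul_right, real_inner_comm, inner_perp_left]; ring
  rw [h1, hgg, neg_neg]
  have hi := (h.continuous_regBoundary hε (-α) x).intervalIntegrable (μ := volume) 0 L
  have h2 := (innerSL ℝ e).intervalIntegral_comp_comm hi
  simp only [innerSL_apply_apply, inner_smul_right] at h2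
  rw [← h2]
  congr 1; ext s
  rw [real_inner_comm]

end HolderCurve

/-- The kernel of the modified Biot-Savart law. -/
noncomputable def bsKernel (α : ℝ) (z : Plane) : Plane := (1 / ‖z‖ ^ (2 + 2 * α)) • perp z

lemma norm_bsKernel {α : ℝ} (hα : 0 < α) (z : Plane) : ‖bsKernel α z‖ = ‖z‖ ^ (-(1 + 2 * α)) := by
  rcases eq_or_ne z 0 with rfl | hz
  · rw [bsKernel, norm_smul, norm_perp, norm_zero, mul_zero, Real.zero_rpow (by linarith)]
  · have hz' : 0 < ‖z‖ := norm_pos_iff.2 hz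
    rw [bsKernel, norm_smul, norm_perp, Real.norm_of_nonneg (by positivity), one_div,
      ← Real.rpow_neg hz'.le]
    nth_rewrite 2 [← Real.rpow_one ‖z‖]
    rw [← Real.rpow_add hz']
    congr 1; ring

lemma measurable_bsKernel (α : ℝ) : Measurable (bsKernel α) := by
  unfold bsKernel
  exact (measurable_const.div (measurable_norm.pow_const _)).smul continuous_perp.measurable

/-- The singularity has order `1 + 2α`, below the dimension since `α < 1/2`. -/
lemma locallyIntegrable_bsKernel {α : ℝ} (hα₀ : 0 < α) (hα₁ : α < 1 / 2) :
    LocallyIntegrable (bsKernel α) := by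
  refine locallyIntegrable_of_norm_le_rpow (C := 1) (α := 1 + 2 * α) (by simp) ?_ ?_
    (measurable_bsKernel α).aestronglyMeasurable
  · simp; linarith
  · exact Eventually.of_forall fun z => by rw [norm_bsKernel hα₀, one_mul]

/-- Moves the dependence on `x` from the singular kernel to the indicator, so that one integrable
majorant serves for limits in `x`, in time and in `ε`. -/
lemma biotSavart_indicator_eq (α : ℝ) (Ω : Set Plane) (x : Plane) :
    biotSavart α (Ω.indicator 1) x = ∫ z, (Ω.indicator (1 : Plane → ℝ) (x - z)) • bsKernel α z := by
  rw [← integral_sub_left_eq_self _ volume x, biotSavart]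
  congr 1; ext1 y
  rw [sub_sub_cancel, bsKernel, smul_smul, mul_one_div]

/-- The smoothed kernel is dominated by the singular one and converges to it off the origin. -/
lemma tendsto_regVelocity {α : ℝ} (hα₀ : 0 < α) (hα₁ : α < 1 / 2) {Ω : Set Plane}
    (hΩ : MeasurableSet Ω) (hb : Bornology.IsBounded Ω) (x : Plane) :
    Tendsto (fun ε => regVelocity α ε Ω x) (𝓝[>] 0) (𝓝 (biotSavart α (Ω.indicator 1) x)) := by
  obtain ⟨R, hR⟩ := hb.exists_norm_le
  have hball : ∀ z, x - z ∈ Ω → z ∈ Metric.closedBall (0 : Plane) (‖x‖ + R) := by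
    intro z hz
    rw [mem_closedBall_zero_iff]
    have h1 := hR _ hz
    have h2 := norm_sub_le x (x - z)
    rw [sub_sub_cancel] at h2
    linarith
  have hform : ∀ ε, regVelocity α ε Ω x =
      ∫ z, (Ω.indicator (1 : Plane → ℝ) (x - z)) • ((‖z‖ ^ 2 + ε ^ 2) ^ (-α - 1) • perp z) := by
    intro ε
    rw [← integral_sub_left_eq_self _ volume x, regVelocity, ← integral_indicator hΩ]
    congr 1; ext1 y
    rw [sub_sub_cancel]
    by_cases hy : y ∈ Ω <;> simp [hy]
  simp only [hform, biotSavart_indicator_eq]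
  have hK := (locallyIntegrable_bsKernel hα₀ hα₁).integrableOn_isCompact
    (isCompact_closedBall (0 : Plane) (‖x‖ + R))
  refine tendsto_integral_filter_of_dominated_convergence
    ((Metric.closedBall (0 : Plane) (‖x‖ + R)).indicator fun z => ‖bsKernel α z‖) ?_ ?_ ?_ ?_
  · filter_upwards [self_mem_nhdsWithin] with ε hε
    have hε' : (0 : ℝ) < ε := hε
    have h1 : Measurable fun z : Plane => Ω.indicator (1 : Plane → ℝ) (x - z) :=
      (measurable_one.indicator hΩ).comp (measurable_const.sub measurable_id)
    have h2 : Continuous fun z : Plane => (‖z‖ ^ 2 + ε ^ 2) ^ (-α - 1) := by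
      refine Continuous.rpow_const (by fun_prop) fun y => Or.inl ?_
      positivity
    exact (h1.smul (h2.smul continuous_perp).measurable).aestronglyMeasurable
  · filter_upwards [self_mem_nhdsWithin] with ε hε
    refine Eventually.of_forall fun z => ?_
    by_cases hz : x - z ∈ Ω
    · rw [indicator_of_mem (hball z hz), indicator_of_mem hz, Pi.one_apply, one_smul]
      rcases eq_or_ne z 0 with rfl | hz0
      · rw [show perp (0 : Plane) = 0 from perpL.map_zero, smul_zero, norm_zero]; positivity
      have hz' : 0 < ‖z‖ := norm_pos_iff.2 hz0
      rw [bsKernel, norm_smul, norm_smul, Real.norm_of_nonneg (by positivity),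
        Real.norm_of_nonneg (by positivity)]
      apply mul_le_mul_of_nonneg_right _ (norm_nonneg _)
      rw [one_div, ← Real.rpow_neg hz'.le, show -(2 + 2 * α) = 2 * (-α - 1) by ring,
        Real.rpow_mul hz'.le, Real.rpow_two]
      exact Real.rpow_le_rpow_of_nonpos (by positivity) (by nlinarith) (by linarith)
    · rw [indicator_of_notMem hz, zero_smul, norm_zero]
      exact indicator_nonneg (fun _ _ => norm_nonneg _) _
  · exact (integrable_indicator_iff measurableSet_closedBall).2 hK.norm
  · have hne : ∀ᵐ z : Plane, z ≠ 0 := by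
      rw [ae_iff]; simp
    filter_upwards [hne] with z hz
    have hz' : 0 < ‖z‖ := norm_pos_iff.2 hz
    apply Tendsto.const_smul
    rw [bsKernel]
    apply Tendsto.smul_const
    have h1 : (1 / ‖z‖ ^ (2 + 2 * α)) = (‖z‖ ^ 2 + 0 ^ 2) ^ (-α - 1) := by
      rw [one_div, ← Real.rpow_neg hz'.le, show -(2 + 2 * α) = 2 * (-α - 1) by ring,
        Real.rpow_mul hz'.le, Real.rpow_two]
      simp
    rw [h1]
    have h2 : ContinuousAt (fun ε : ℝ => (‖z‖ ^ 2 + ε ^ 2) ^ (-α - 1)) 0 := by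
      refine ContinuousAt.rpow_const (by fun_prop) (Or.inl ?_)
      positivity
    exact h2.tendsto.mono_left nhdsWithin_le_nhds


/-! ### Weakly singular integrals on the line -/

lemma intervalIntegrable_abs_sub_rpow {σ : ℝ} (hσ : 0 < σ) (c a b : ℝ) :
    IntervalIntegrable (fun u : ℝ => |u - c| ^ (σ - 1)) volume a b := by
  have h1 : LocallyIntegrable (fun u : ℝ => |u| ^ (σ - 1)) := by
    refine locallyIntegrable_of_norm_le_rpow (C := 1) (α := 1 - σ) (by simp) (by simpa using hσ) ?_
      (measurable_norm.pow_const _).aestronglyMeasurable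
    refine Eventually.of_forall fun u => ?_
    rw [one_mul, neg_sub, Real.norm_of_nonneg (by positivity), Real.norm_eq_abs]
  have h2 := ((h1.integrableOn_isCompact (k := uIcc (a - c) (b - c)) isCompact_uIcc).intervalIntegrable).comp_sub_right c
  simpa using h2

lemma intervalIntegrable_abs_rpow {σ : ℝ} (hσ : 0 < σ) (a b : ℝ) :
    IntervalIntegrable (fun u : ℝ => |u| ^ (σ - 1)) volume a b := by
  simpa using intervalIntegrable_abs_sub_rpow hσ 0 a b

lemma integral_abs_rpow {σ c : ℝ} (hσ : 0 < σ) (hc : 0 ≤ c) :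
    ∫ u in (-c)..c, |u| ^ (σ - 1) = 2 * (c ^ σ / σ) := by
  have h1 : ∫ u in (0)..c, |u| ^ (σ - 1) = c ^ σ / σ := by
    have : ∫ u in (0)..c, |u| ^ (σ - 1) = ∫ u in (0)..c, u ^ (σ - 1) := by
      apply intervalIntegral.integral_congr
      intro u hu
      rw [uIcc_of_le hc] at hu
      simp only [abs_of_nonneg hu.1]
    rw [this, integral_rpow (Or.inl (by linarith)), sub_add_cancel, Real.zero_rpow hσ.ne', sub_zero]
  have h2 : ∫ u in (-c)..0, |u| ^ (σ - 1) = c ^ σ / σ := by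
    rw [← h1]
    have := intervalIntegral.integral_comp_neg (a := 0) (b := c) fun u : ℝ => |u| ^ (σ - 1)
    simp only [abs_neg, neg_zero] at this
    exact this.symm
  rw [← intervalIntegral.integral_add_adjacent_intervals (intervalIntegrable_abs_rpow hσ _ 0)
    (intervalIntegrable_abs_rpow hσ _ _), h1, h2]
  ring

lemma integral_rpow_tail_le {κ a b : ℝ} (hκ : 0 < κ) (ha : 0 < a) (hab : a ≤ b) :
    ∫ u in a..b, u ^ (-1 - κ) ≤ a ^ (-κ) / κ := by
  rw [integral_rpow (Or.inr ⟨by linarith, by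
    rw [uIcc_of_le hab]; exact fun h => by linarith [h.1]⟩)]
  rw [show -1 - κ + 1 = -κ by ring, div_neg, ← neg_div, neg_sub]
  gcongr
  have : 0 ≤ b ^ (-κ) := Real.rpow_nonneg (by linarith) _
  linarith

/-- Hölder continuity of weakly singular integrals. -/
lemma norm_integral_sub_integral_le {E : Type*} [NormedAddCommGroup E] [NormedSpace ℝ E]
    {F₁ F₂ : ℝ → E} {σ κ C₁ C₂ h A : ℝ} (hσ : 0 < σ) (hκ : 0 < κ) (hC₁ : 0 ≤ C₁) (hh : 0 < h)
    (hA : 2 * h ≤ A) (hF₁ : Continuous F₁) (hF₂ : Continuous F₂)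
    (b₁ : ∀ u, |u| ≤ A → u ≠ 0 → ‖F₁ u‖ ≤ C₁ * |u| ^ (σ - 1))
    (b₂ : ∀ u, |u| ≤ 2 * h → u ≠ h → ‖F₂ u‖ ≤ C₁ * |u - h| ^ (σ - 1))
    (b₃ : ∀ u, 2 * h ≤ |u| → |u| ≤ A → ‖F₁ u - F₂ u‖ ≤ C₂ * h ^ (σ + κ) * |u| ^ (-1 - κ))
    (hC₂ : 0 ≤ C₂) :
    ‖(∫ u in (-A)..A, F₁ u) - ∫ u in (-A)..A, F₂ u‖ ≤
      (C₁ * (2 * (2 ^ σ / σ) + 2 * (3 ^ σ / σ)) + C₂ * (2 * (2 ^ (-κ) / κ))) * h ^ σ := by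
  have hi : ∀ a b, IntervalIntegrable (fun u => F₁ u - F₂ u) volume a b :=
    fun a b => (hF₁.sub hF₂).intervalIntegrable a b
  -- Split at `|u| = 2h`. Inside, the two integrands are bounded separately by their singularities,
  -- which integrate to order `h^σ`. Outside, the factor `h^(σ+κ)` meets a tail integral of order
  -- `h^(-κ)`.
  rw [← intervalIntegral.integral_sub (hF₁.intervalIntegrable _ _) (hF₂.intervalIntegrable _ _),
    ← intervalIntegral.integral_add_adjacent_intervals (hi (-A) (-(2 * h))) (hi (-(2 * h)) A),
    ← intervalIntegral.integral_add_adjacent_intervals (hi (-(2 * h)) (2 * h)) (hi (2 * h) A)]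
  have htail : ∫ u in (2 * h)..A, C₂ * h ^ (σ + κ) * u ^ (-1 - κ) ≤
      C₂ * (2 ^ (-κ) / κ) * h ^ σ := by
    rw [intervalIntegral.integral_const_mul]
    calc C₂ * h ^ (σ + κ) * ∫ u in (2 * h)..A, u ^ (-1 - κ)
        ≤ C₂ * h ^ (σ + κ) * ((2 * h) ^ (-κ) / κ) := by
          gcongr; exact integral_rpow_tail_le hκ (by positivity) hA
      _ = C₂ * (2 ^ (-κ) / κ) * h ^ σ := by
          rw [Real.mul_rpow (by norm_num) hh.le, Real.rpow_add hh, Real.rpow_neg hh.le κ]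
          have : h ^ κ ≠ 0 := (Real.rpow_pos_of_pos hh κ).ne'
          field_simp
  have hti : IntervalIntegrable (fun u => C₂ * h ^ (σ + κ) * u ^ (-1 - κ)) volume (2 * h) A := by
    apply IntervalIntegrable.const_mul
    apply intervalIntegral.intervalIntegrable_rpow
    right
    rw [uIcc_of_le hA]; exact fun h' => by linarith [h'.1]
  have e3 : ‖∫ u in (2 * h)..A, (F₁ u - F₂ u)‖ ≤ C₂ * (2 ^ (-κ) / κ) * h ^ σ := by
    refine (intervalIntegral.norm_integral_le_of_norm_le hA ?_ hti).trans htail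
    refine Eventually.of_forall fun u hu => ?_
    have hu0 : 0 < u := by linarith [hu.1]
    have := b₃ u (by rw [abs_of_pos hu0]; exact hu.1.le) (by rw [abs_of_pos hu0]; exact hu.2)
    rwa [abs_of_pos hu0] at this
  have e1 : ‖∫ u in (-A)..(-(2 * h)), (F₁ u - F₂ u)‖ ≤ C₂ * (2 ^ (-κ) / κ) * h ^ σ := by
    rw [← intervalIntegral.integral_comp_neg fun u => F₁ u - F₂ u]
    refine (intervalIntegral.norm_integral_le_of_norm_le hA ?_ hti).trans htail
    refine Eventually.of_forall fun u hu => ?_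
    have hu0 : 0 < u := by linarith [hu.1]
    have := b₃ (-u) (by rw [abs_neg, abs_of_pos hu0]; exact hu.1.le)
      (by rw [abs_neg, abs_of_pos hu0]; exact hu.2)
    rwa [abs_neg, abs_of_pos hu0] at this
  have e2 : ‖∫ u in (-(2 * h))..(2 * h), (F₁ u - F₂ u)‖ ≤
      C₁ * (2 * (2 ^ σ / σ) + 2 * (3 ^ σ / σ)) * h ^ σ := by
    have i1 := (intervalIntegrable_abs_rpow hσ (-(2 * h)) (2 * h)).const_mul C₁
    have i2 := (intervalIntegrable_abs_sub_rpow hσ h (-(2 * h)) (2 * h)).const_mul C₁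
    have hne : ∀ᵐ u : ℝ, u ≠ 0 ∧ u ≠ h := by
      refine Filter.Eventually.and ?_ ?_ <;> · rw [ae_iff]; simp
    refine (intervalIntegral.norm_integral_le_of_norm_le (by linarith) ?_ (i1.add i2)).trans ?_
    · filter_upwards [hne] with u hu0 hu
      have hu' : |u| ≤ 2 * h := abs_le.2 ⟨hu.1.le, hu.2⟩
      exact (norm_sub_le _ _).trans (add_le_add (b₁ u (hu'.trans hA) hu0.1) (b₂ u hu' hu0.2))
    · rw [intervalIntegral.integral_add i1 i2, intervalIntegral.integral_const_mul,
        intervalIntegral.integral_const_mul, integral_abs_rpow hσ (by positivity),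
        intervalIntegral.integral_comp_sub_right (fun u => |u| ^ (σ - 1)) h]
      -- The singularity of `F₂` sits at `h`; centring it turns the window into `[-3h, h]`, which is
      -- enlarged to a symmetric one.
      have hmono : ∫ u in (-(2 * h) - h)..(2 * h - h), |u| ^ (σ - 1) ≤
          ∫ u in (-(3 * h))..(3 * h), |u| ^ (σ - 1) := by
        apply intervalIntegral.integral_mono_interval (by linarith) (by linarith) (by linarith)
        · exact Eventually.of_forall fun u => by positivity
        · exact intervalIntegrable_abs_rpow hσ _ _
      rw [integral_abs_rpow hσ (by positivity)] at hmono
      rw [Real.mul_rpow (by norm_num) hh.le] at hmono ⊢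
      calc _ ≤ C₁ * (2 * (2 ^ σ * h ^ σ / σ)) + C₁ * (2 * (3 ^ σ * h ^ σ / σ)) := by gcongr
        _ = _ := by ring
  calc _ ≤ _ + (_ + _) := (norm_add_le _ _).trans (add_le_add_right (norm_add_le _ _) _)
    _ ≤ _ := add_le_add e1 (add_le_add e2 e3)
    _ = _ := by ring


/-! ### The regularized kernel -/

/-- The gradient kernel `z (|z|² + ε²)^(-α-1)`. -/
noncomputable def regG (α ε : ℝ) (z : Plane) : Plane := (‖z‖ ^ 2 + ε ^ 2) ^ (-α - 1) • z

lemma reg_rpow_le {ε k ρ : ℝ} {z : Plane} (hρ : 0 < ρ) (hk : 0 ≤ k)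
    (hz : ρ ^ 2 ≤ ‖z‖ ^ 2 + ε ^ 2) : (‖z‖ ^ 2 + ε ^ 2) ^ (-k) ≤ ρ ^ (-(2 * k)) := by
  have h1 : ρ ^ (-(2 * k)) = (ρ ^ 2) ^ (-k) := by
    rw [← Real.rpow_two, ← Real.rpow_mul hρ.le]; congr 1; ring
  rw [h1]
  exact Real.rpow_le_rpow_of_nonpos (by positivity) hz (by linarith)

lemma norm_regG_le {α ε ρ : ℝ} (hα : 0 < α) {z : Plane} (hε : 0 < ε) (hρ : 0 < ρ)
    (hz : ρ ^ 2 ≤ ‖z‖ ^ 2 + ε ^ 2) : ‖regG α ε z‖ ≤ ρ ^ (-1 - 2 * α) := by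
  have hD : 0 < ‖z‖ ^ 2 + ε ^ 2 := by positivity
  have h1 : ‖z‖ ≤ (‖z‖ ^ 2 + ε ^ 2) ^ (1 / 2 : ℝ) := by
    rw [← Real.sqrt_eq_rpow]
    apply Real.le_sqrt_of_sq_le
    nlinarith [sq_nonneg ε]
  rw [regG, norm_smul, Real.norm_of_nonneg (by positivity)]
  calc (‖z‖ ^ 2 + ε ^ 2) ^ (-α - 1) * ‖z‖
      ≤ (‖z‖ ^ 2 + ε ^ 2) ^ (-α - 1) * (‖z‖ ^ 2 + ε ^ 2) ^ (1 / 2 : ℝ) := by gcongr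
    _ = (‖z‖ ^ 2 + ε ^ 2) ^ (-(α + 1 / 2)) := by rw [← Real.rpow_add hD]; congr 1; ring
    _ ≤ ρ ^ (-(2 * (α + 1 / 2))) := reg_rpow_le hρ (by linarith) hz
    _ = _ := by congr 1; ring

lemma continuous_regG (α : ℝ) {ε : ℝ} (hε : 0 < ε) : Continuous (regG α ε) := by
  have : Continuous fun z : Plane => (‖z‖ ^ 2 + ε ^ 2) ^ (-α - 1) :=
    Continuous.rpow_const (by fun_prop) fun y => Or.inl (by positivity)
  exact this.smul continuous_id

/-- The differential of `regG` at `z` is `O(|z|^(-2-2α))` uniformly in `ε`. The mean value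
inequality is applied along the path `f`, which keeps away from the origin; the straight segment
between its ends might not. -/
lemma norm_regG_sub_le {α ε ρ : ℝ} (hα : 0 < α) (hε : 0 < ε) (hρ : 0 < ρ) {f f' : ℝ → Plane}
    (hf : ∀ s, HasDerivAt f (f' s) s) {a b : ℝ} (hab : a ≤ b) (hf' : ∀ s ∈ Icc a b, ‖f' s‖ ≤ 1)
    (hfρ : ∀ s ∈ Icc a b, ρ ≤ ‖f s‖) :
    ‖regG α ε (f b) - regG α ε (f a)‖ ≤ (2 * α + 3) * ρ ^ (-2 - 2 * α) * (b - a) := by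
  have hd : ∀ s, HasDerivAt (fun s => regG α ε (f s))
      ((‖f s‖ ^ 2 + ε ^ 2) ^ (-α - 1) • f' s +
        (2 * (-α - 1) * (‖f s‖ ^ 2 + ε ^ 2) ^ (-α - 1 - 1) * inner ℝ (f s) (f' s)) • f s) s :=
    fun s => (hasDerivAt_regKernel_comp hε (-α - 1) (hf s)).smul (hf s)
  have := (convex_Icc a b).norm_image_sub_le_of_norm_hasDerivWithin_le
    (C := (2 * α + 3) * ρ ^ (-2 - 2 * α)) (fun s _ => (hd s).hasDerivWithinAt) (fun s hs => ?_)
    (left_mem_Icc.2 hab) (right_mem_Icc.2 hab)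
  · rwa [Real.norm_of_nonneg (by linarith)] at this
  · have hD : 0 < ‖f s‖ ^ 2 + ε ^ 2 := by positivity
    have hDρ : ρ ^ 2 ≤ ‖f s‖ ^ 2 + ε ^ 2 := by
      have := hfρ s hs
      nlinarith [sq_nonneg ε]
    have e1 : (‖f s‖ ^ 2 + ε ^ 2) ^ (-α - 1) ≤ ρ ^ (-2 - 2 * α) := by
      have := reg_rpow_le (k := α + 1) hρ (by linarith) hDρ
      rwa [show -(α + 1) = -α - 1 by ring, show -(2 * (α + 1)) = -2 - 2 * α by ring] at this
    have e2 : (‖f s‖ ^ 2 + ε ^ 2) ^ (-α - 1 - 1) * (‖f s‖ * ‖f s‖) ≤ ρ ^ (-2 - 2 * α) := by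
      refine le_trans ?_ e1
      rw [Real.rpow_sub_one hD.ne' (-α - 1), div_mul_eq_mul_div, div_le_iff₀ hD]
      gcongr
      nlinarith [sq_nonneg ε]
    have h1 := hf' s hs
    have h2 : |inner ℝ (f s) (f' s)| ≤ ‖f s‖ := by
      refine (abs_real_inner_le_norm _ _).trans ?_
      exact mul_le_of_le_one_right (norm_nonneg _) h1
    refine (norm_add_le _ _).trans ?_
    rw [norm_smul, norm_smul, norm_mul, norm_mul, norm_mul, Real.norm_of_nonneg (by positivity),
      Real.norm_eq_abs, Real.norm_eq_abs, abs_of_nonneg (zero_le_two (α := ℝ)),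
      abs_of_neg (by linarith : -α - 1 < 0), Real.norm_of_nonneg (by positivity), Real.norm_eq_abs]
    calc _ ≤ ρ ^ (-2 - 2 * α) * 1 + 2 * -(-α - 1) * (‖f s‖ ^ 2 + ε ^ 2) ^ (-α - 1 - 1) * ‖f s‖ *
          ‖f s‖ := by
          have : 0 ≤ 2 * -(-α - 1) * (‖f s‖ ^ 2 + ε ^ 2) ^ (-α - 1 - 1) := by
            have : 0 ≤ -(-α - 1) := by linarith
            positivity
          gcongr
      _ = ρ ^ (-2 - 2 * α) + 2 * (α + 1) *
          ((‖f s‖ ^ 2 + ε ^ 2) ^ (-α - 1 - 1) * (‖f s‖ * ‖f s‖)) := by ring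
      _ ≤ ρ ^ (-2 - 2 * α) + 2 * (α + 1) * ρ ^ (-2 - 2 * α) := by gcongr
      _ = _ := by ring

/-! ### Curves with a quantitative arc-chord condition -/

/-- A Hölder curve with an arc-chord condition and a bound on the length. -/
structure RegularCurve (β M ℓ Λ lam L : ℝ) (Γ : ℝ → Plane) (Ω : Set Plane) : Prop
    extends HolderCurve β M ℓ L Γ Ω where
  patch : IsPatchDomain Ω
  lam_pos : 0 < lam
  -- Half a period would do for one base point. The larger range allows two base points up to `L/8`
  -- apart to share the window of half-width `L/2` around the first.
  arc : ∀ s s', |s' - s| ≤ 3 / 4 * L → lam * |s' - s| ≤ ‖Γ s' - Γ s‖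
  length_le : L ≤ Λ

/-- The integrand of the tangential derivative of the regularized velocity. -/
noncomputable def regPhi (α ε : ℝ) (Γ : ℝ → Plane) (s s' : ℝ) : Plane :=
  inner ℝ (regG α ε (Γ s - Γ s')) (deriv Γ s) • (deriv Γ s' - deriv Γ s) +
    inner ℝ (regG α ε (Γ s - Γ s')) (deriv Γ s - deriv Γ s') • deriv Γ s

namespace RegularCurve

variable {α β M ℓ Λ lam L ε : ℝ} {Γ : ℝ → Plane} {Ω : Set Plane}
  (h : RegularCurve β M ℓ Λ lam L Γ Ω) (hα : 0 < α) (hε : 0 < ε)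
include h

lemma continuous_regPhi (hε : 0 < ε) (s : ℝ) : Continuous (regPhi α ε Γ s) := by
  have h1 := h.continuous
  have h2 := h.continuous_deriv
  have h3 : Continuous fun s' => regG α ε (Γ s - Γ s') := (continuous_regG α hε).comp (by fun_prop)
  unfold regPhi
  fun_prop

lemma periodic_regPhi (s : ℝ) : Function.Periodic (regPhi α ε Γ s) L := fun s' => by
  simp only [regPhi, h.periodic s', h.periodic_deriv s']

include hα hε

/-- Up to the factor `2α`, the integrand is the derivative in `s'` of the smoothed potential, which
is periodic along the curve. This cancellation supplies the missing integrability of the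
differentiated kernel. -/
lemma integral_regG_inner_eq_zero (s : ℝ) :
    ∫ s' in (0)..L, inner ℝ (regG α ε (Γ s - Γ s')) (deriv Γ s') = 0 := by
  have hd : ∀ s', HasDerivAt (fun s' => (‖Γ s - Γ s'‖ ^ 2 + ε ^ 2) ^ (-α))
      (2 * α * inner ℝ (regG α ε (Γ s - Γ s')) (deriv Γ s')) s' := by
    intro s'
    have := hasDerivAt_regKernel_comp hε (-α) ((h.hasDerivAt s').const_sub (Γ s))
    convert this using 1
    rw [regG, inner_smul_left, inner_neg_right]
    simp only [conj_trivial]; ring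
  have hc : Continuous fun s' => 2 * α * inner ℝ (regG α ε (Γ s - Γ s')) (deriv Γ s') := by
    have h1 := h.continuous
    have h2 := h.continuous_deriv
    have h3 : Continuous fun s' => regG α ε (Γ s - Γ s') := (continuous_regG α hε).comp (by fun_prop)
    fun_prop
  have := intervalIntegral.integral_eq_sub_of_hasDerivAt (fun s' _ => hd s')
    (hc.intervalIntegrable 0 L)
  rw [intervalIntegral.integral_const_mul] at this
  have hL : Γ L = Γ 0 := by have := h.periodic 0; rwa [zero_add] at this
  rw [hL, sub_self] at this
  exact (mul_eq_zero.1 this).resolve_left (by positivity)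

/-- The tangential derivative of the regularized velocity. -/
lemma hasDerivAt_regVelocity (s : ℝ) :
    HasDerivAt (fun s => regVelocity α ε Ω (Γ s)) (-∫ s' in (0)..L, regPhi α ε Γ s s') s := by
  have hc1 := h.continuous
  have hc2 := h.continuous_deriv
  have hcG : ∀ s, Continuous fun s' => regG α ε (Γ s - Γ s') := fun s =>
    (continuous_regG α hε).comp (by fun_prop)
  have key := intervalIntegral.hasDerivAt_integral_of_dominated_loc_of_deriv_le (μ := volume)
    (a := 0) (b := L) (x₀ := s) (s := univ)
    (F := fun s s' => (‖Γ s - Γ s'‖ ^ 2 + ε ^ 2) ^ (-α) • deriv Γ s')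
    (F' := fun s s' => (-2 * α * inner ℝ (regG α ε (Γ s - Γ s')) (deriv Γ s)) • deriv Γ s')
    (bound := fun _ => 2 * α * ε ^ (-1 - 2 * α))
    univ_mem
    (Eventually.of_forall fun r => (h.continuous_regBoundary hε (-α) (Γ r)).aestronglyMeasurable)
    ((h.continuous_regBoundary hε (-α) (Γ s)).intervalIntegrable _ _)
    (by
      refine Continuous.aestronglyMeasurable ?_
      have := hcG s
      fun_prop)
    (Eventually.of_forall fun s' _ r _ => by
      rw [norm_smul, h.norm_deriv, mul_one, norm_mul, Real.norm_eq_abs, Real.norm_eq_abs,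
        abs_mul, abs_neg, abs_of_pos (zero_lt_two (α := ℝ)), abs_of_pos hα]
      gcongr
      refine (abs_real_inner_le_norm _ _).trans ?_
      rw [h.norm_deriv, mul_one]
      exact norm_regG_le hα hε hε (by nlinarith [sq_nonneg ‖Γ r - Γ s'‖]))
    (continuous_const.intervalIntegrable _ _)
    (Eventually.of_forall fun s' _ r _ => by
      have := (hasDerivAt_regKernel_comp hε (-α) ((h.hasDerivAt r).sub_const (Γ s'))).smul_const
        (deriv Γ s')
      convert this using 2
      rw [regG, inner_smul_left]
      simp only [conj_trivial]; ring)
  have h2 : (fun s => regVelocity α ε Ω (Γ s)) = fun s => (2 * α)⁻¹ •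
      ∫ s' in (0)..L, (‖Γ s - Γ s'‖ ^ 2 + ε ^ 2) ^ (-α) • deriv Γ s' := by
    funext s
    rw [← h.regVelocity_eq h.patch hε, smul_smul, inv_mul_cancel₀ (by positivity), one_smul]
  rw [h2]
  refine (key.2.const_smul (2 * α)⁻¹).congr_deriv ?_
  -- Adding this vanishing term makes a difference of tangents at `s` and `s'` a factor of every
  -- term of the integrand, gaining `|s - s'|^β`.
  have hz : (∫ s' in (0)..L, inner ℝ (regG α ε (Γ s - Γ s')) (deriv Γ s')) • deriv Γ s = 0 := by
    rw [h.integral_regG_inner_eq_zero hα hε s, zero_smul]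
  rw [← intervalIntegral.integral_smul_const] at hz
  have hi1 : IntervalIntegrable (regPhi α ε Γ s) volume 0 L :=
    (h.continuous_regPhi hε s).intervalIntegrable _ _
  have hi2 : IntervalIntegrable
      (fun s' => inner ℝ (regG α ε (Γ s - Γ s')) (deriv Γ s') • deriv Γ s) volume 0 L := by
    refine Continuous.intervalIntegrable ?_ _ _
    have := hcG s
    fun_prop
  have hi1' : IntervalIntegrable (fun s' => -regPhi α ε Γ s s') volume 0 L := hi1.neg
  rw [← intervalIntegral.integral_smul, ← intervalIntegral.integral_neg, ← sub_zero
    (∫ s' in (0)..L, -regPhi α ε Γ s s'), ← hz, ← intervalIntegral.integral_sub hi1' hi2]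
  congr 1; ext1 s'
  rw [regPhi, inner_sub_right, smul_smul]
  have : (2 * α)⁻¹ * (-2 * α * inner ℝ (regG α ε (Γ s - Γ s')) (deriv Γ s)) =
      -inner ℝ (regG α ε (Γ s - Γ s')) (deriv Γ s) := by field_simp
  rw [this]
  module

/-- The arc-chord bound makes the kernel `O(|s' - s|^(-1-2α))` uniformly in `ε`, and every term
carries a difference of tangents of size `|s' - s|^β`. -/
lemma norm_regPhi_le {s s' : ℝ} (hs : |s' - s| ≤ 3 / 4 * L) (hne : s' ≠ s) :
    ‖regPhi α ε Γ s s'‖ ≤ 2 * M * lam ^ (-1 - 2 * α) * |s' - s| ^ (β - 2 * α - 1) := by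
  have hr : 0 < |s' - s| := abs_pos.2 (sub_ne_zero.2 hne)
  have hlam := h.lam_pos
  have hM := h.M_pos
  have harc := h.arc s s' hs
  rw [norm_sub_rev] at harc
  have hG : ‖regG α ε (Γ s - Γ s')‖ ≤ (lam * |s' - s|) ^ (-1 - 2 * α) :=
    norm_regG_le hα hε (by positivity) (by
      have : (lam * |s' - s|) ^ 2 ≤ ‖Γ s - Γ s'‖ ^ 2 := by gcongr
      nlinarith [sq_nonneg ε])
  have hH := h.holder s s'
  have e1 : |inner ℝ (regG α ε (Γ s - Γ s')) (deriv Γ s)| ≤ (lam * |s' - s|) ^ (-1 - 2 * α) := by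
    refine (abs_real_inner_le_norm _ _).trans ?_
    rwa [h.norm_deriv, mul_one]
  have e2 : |inner ℝ (regG α ε (Γ s - Γ s')) (deriv Γ s - deriv Γ s')| ≤
      (lam * |s' - s|) ^ (-1 - 2 * α) * (M * |s' - s| ^ β) := by
    refine (abs_real_inner_le_norm _ _).trans ?_
    rw [norm_sub_rev (deriv Γ s)]
    gcongr
  rw [regPhi]
  refine (norm_add_le _ _).trans ?_
  rw [norm_smul, norm_smul, h.norm_deriv, mul_one, Real.norm_eq_abs, Real.norm_eq_abs]
  calc _ ≤ (lam * |s' - s|) ^ (-1 - 2 * α) * (M * |s' - s| ^ β) +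
        (lam * |s' - s|) ^ (-1 - 2 * α) * (M * |s' - s| ^ β) := by gcongr
    _ = 2 * M * lam ^ (-1 - 2 * α) * (|s' - s| ^ (-1 - 2 * α) * |s' - s| ^ β) := by
        rw [Real.mul_rpow hlam.le hr.le]; ring
    _ = _ := by rw [← Real.rpow_add hr]; congr 2; ring

/-- With `d = s₂ - s₁` and `r = |s' - s₁|`, a change of tangent costs `d^β r^(-1-2α)` and a change
of kernel costs `d r^(-2-2α) r^β`. Since `d ≤ r` and `β ≤ 1`, one has `d ≤ d^β r^(1-β)`, so the
second cost is no worse than the first. -/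
lemma norm_regPhi_sub_le {s₁ s₂ s' : ℝ} (h12 : s₁ < s₂) (hL : s₂ - s₁ ≤ L / 8)
    (hs : 2 * (s₂ - s₁) ≤ |s' - s₁|) (hs' : |s' - s₁| ≤ L / 2) :
    ‖regPhi α ε Γ s₁ s' - regPhi α ε Γ s₂ s'‖ ≤
      (2 * M * (2 * α + 3) * (lam / 2) ^ (-2 - 2 * α) + 6 * M * (lam / 2) ^ (-1 - 2 * α)) *
        (s₂ - s₁) ^ β * |s' - s₁| ^ (-1 - 2 * α) := by
  set d := s₂ - s₁ with hd
  have hd0 : 0 < d := by linarith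
  set r := |s' - s₁| with hr
  have hr0 : 0 < r := by linarith
  have hlam := h.lam_pos
  have hM := h.M_pos
  have hβ := h.β_le
  have hdist : ∀ s ∈ Icc s₁ s₂, r / 2 ≤ |s' - s| ∧ |s' - s| ≤ 3 / 4 * L := by
    intro s hs
    have h1 : |s - s₁| ≤ d := by rw [abs_of_nonneg] <;> linarith [hs.1, hs.2]
    have h2 := abs_sub_abs_le_abs_sub (s' - s₁) (s - s₁)
    have h3 := abs_sub_abs_le_abs_sub (s' - s) (s₁ - s)
    rw [sub_sub_sub_cancel_right] at h2 h3
    rw [abs_sub_comm s₁ s] at h3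
    constructor <;> linarith
  have hchord : ∀ s ∈ Icc s₁ s₂, lam / 2 * r ≤ ‖Γ s - Γ s'‖ := by
    intro s hs
    obtain ⟨h1, h2⟩ := hdist s hs
    have h3 := h.arc s s' h2
    rw [norm_sub_rev] at h3
    have : lam * (r / 2) ≤ lam * |s' - s| := by gcongr
    linarith
  have hρ : 0 < lam / 2 * r := by positivity
  have hG : ‖regG α ε (Γ s₂ - Γ s') - regG α ε (Γ s₁ - Γ s')‖ ≤
      (2 * α + 3) * (lam / 2 * r) ^ (-2 - 2 * α) * d :=
    norm_regG_sub_le hα hε hρ (f := fun s => Γ s - Γ s') (f' := deriv Γ)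
      (fun s => (h.hasDerivAt s).sub_const _) h12.le (fun s _ => (h.norm_deriv s).le) hchord
  have hG2 : ‖regG α ε (Γ s₂ - Γ s')‖ ≤ (lam / 2 * r) ^ (-1 - 2 * α) :=
    norm_regG_le hα hε hρ (by
      have h1 := hchord s₂ ⟨h12.le, le_rfl⟩
      have : (lam / 2 * r) ^ 2 ≤ ‖Γ s₂ - Γ s'‖ ^ 2 := by gcongr
      nlinarith [sq_nonneg ε])
  set G₁ := regG α ε (Γ s₁ - Γ s')
  set G₂ := regG α ε (Γ s₂ - Γ s')
  set a₁ := deriv Γ s₁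
  set a₂ := deriv Γ s₂
  set b := deriv Γ s'
  have ha₁ : ‖a₁‖ = 1 := h.norm_deriv _
  have ha₂ : ‖a₂‖ = 1 := h.norm_deriv _
  have hb : ‖b‖ = 1 := h.norm_deriv _
  have hba : ‖b - a₁‖ ≤ M * r ^ β := h.holder s₁ s'
  have haa : ‖a₂ - a₁‖ ≤ M * d ^ β := by
    have := h.holder s₁ s₂
    rwa [abs_of_pos hd0] at this
  have hb2 : ∀ {x y : Plane}, ‖x‖ = 1 → ‖y‖ = 1 → ‖x - y‖ ≤ 2 := fun hx hy =>
    (norm_sub_le _ _).trans (by rw [hx, hy]; norm_num)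
  have hsplit : regPhi α ε Γ s₁ s' - regPhi α ε Γ s₂ s' =
      (inner ℝ (G₁ - G₂) a₁ • (b - a₁) + inner ℝ G₂ (a₁ - a₂) • (b - a₁) +
        inner ℝ G₂ a₂ • (a₂ - a₁)) +
      (inner ℝ (G₁ - G₂) (a₁ - b) • a₁ + inner ℝ G₂ (a₁ - a₂) • a₁ +
        inner ℝ G₂ (a₂ - b) • (a₁ - a₂)) := by
    simp only [regPhi, inner_sub_left, inner_sub_right]
    module
  have hin : ∀ x y z : Plane, ‖inner ℝ x y • z‖ ≤ ‖x‖ * ‖y‖ * ‖z‖ := fun x y z => by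
    rw [norm_smul]
    gcongr
    exact norm_inner_le_norm x y
  set g := ‖G₁ - G₂‖ with hg
  set g₂ := ‖G₂‖ with hg₂
  have hbound : ‖regPhi α ε Γ s₁ s' - regPhi α ε Γ s₂ s'‖ ≤
      2 * M * r ^ β * g + 6 * M * d ^ β * g₂ := by
    rw [hsplit]
    refine (norm_add_le _ _).trans ((add_le_add norm_add₃_le norm_add₃_le).trans ?_)
    have t1 := (hin (G₁ - G₂) a₁ (b - a₁)).trans (show _ ≤ g * 1 * (M * r ^ β) by rw [ha₁]; gcongr)
    have t2 := (hin G₂ (a₁ - a₂) (b - a₁)).trans (show _ ≤ g₂ * (M * d ^ β) * 2 by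
      rw [norm_sub_rev a₁ a₂]; gcongr; exact hb2 hb ha₁)
    have t3 := (hin G₂ a₂ (a₂ - a₁)).trans (show _ ≤ g₂ * 1 * (M * d ^ β) by rw [ha₂]; gcongr)
    have t4 := (hin (G₁ - G₂) (a₁ - b) a₁).trans (show _ ≤ g * (M * r ^ β) * 1 by
      rw [norm_sub_rev a₁ b, ha₁]; gcongr)
    have t5 := (hin G₂ (a₁ - a₂) a₁).trans (show _ ≤ g₂ * (M * d ^ β) * 1 by
      rw [norm_sub_rev a₁ a₂, ha₁]; gcongr)
    have t6 := (hin G₂ (a₂ - b) (a₁ - a₂)).trans (show _ ≤ g₂ * 2 * (M * d ^ β) by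
      rw [norm_sub_rev a₁ a₂]; gcongr; exact hb2 ha₂ hb)
    linarith
  have hgle : r ^ β * g ≤ (2 * α + 3) * (lam / 2) ^ (-2 - 2 * α) * d ^ β * r ^ (-1 - 2 * α) := by
    rw [norm_sub_rev] at hG
    have e1 : d ≤ d ^ β * r ^ (1 - β) := by
      calc d = d ^ β * d ^ (1 - β) := by rw [← Real.rpow_add hd0]; simp
        _ ≤ d ^ β * r ^ (1 - β) := by
          gcongr
          linarith
    calc r ^ β * g ≤ r ^ β * ((2 * α + 3) * (lam / 2 * r) ^ (-2 - 2 * α) * (d ^ β * r ^ (1 - β))) := by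
          gcongr
          exact hG.trans (by gcongr)
      _ = (2 * α + 3) * (lam / 2) ^ (-2 - 2 * α) * d ^ β *
            (r ^ β * r ^ (-2 - 2 * α) * r ^ (1 - β)) := by
          rw [Real.mul_rpow (by positivity) hr0.le]; ring
      _ = _ := by
          rw [← Real.rpow_add hr0, ← Real.rpow_add hr0]; congr 2; ring
  rw [Real.mul_rpow (by positivity) hr0.le] at hG2
  calc _ ≤ _ := hbound
    _ = 2 * M * (r ^ β * g) + 6 * M * d ^ β * g₂ := by ring
    _ ≤ 2 * M * ((2 * α + 3) * (lam / 2) ^ (-2 - 2 * α) * d ^ β * r ^ (-1 - 2 * α)) +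
        6 * M * d ^ β * ((lam / 2) ^ (-1 - 2 * α) * r ^ (-1 - 2 * α)) := by gcongr
    _ = _ := by ring

end RegularCurve


/-! ### Estimates uniform in the regularization, and their limits -/

/-- The bound for the tangential derivative of the regularized velocity. -/
noncomputable def derivBound (α β M Λ lam : ℝ) : ℝ :=
  2 * M * lam ^ (-1 - 2 * α) * (2 * (Λ ^ (β - 2 * α) / (β - 2 * α)))

/-- The Hölder constant of the tangential derivative of the regularized velocity. -/
noncomputable def derivHolder (α β M ℓ Λ lam : ℝ) : ℝ :=
  (2 * M * lam ^ (-1 - 2 * α) * (2 * (2 ^ (β - 2 * α) / (β - 2 * α)) +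
      2 * (3 ^ (β - 2 * α) / (β - 2 * α))) +
    (2 * M * (2 * α + 3) * (lam / 2) ^ (-2 - 2 * α) + 6 * M * (lam / 2) ^ (-1 - 2 * α)) *
      (2 * (2 ^ (-(2 * α)) / (2 * α)))) +
  2 * derivBound α β M Λ lam * (8 / ℓ) ^ (β - 2 * α)

/-- The Hölder constant of the velocity in the direction normal to the curve. -/
noncomputable def normalBound (α β M Λ lam : ℝ) : ℝ :=
  M * (lam / 2) ^ (-1 - 2 * α) * (2 * (Λ ^ (β - 2 * α) / (β - 2 * α)))

lemma abs_reg_rpow_sub_le {α ε ρ ρ₁ ρ₂ : ℝ} (hα : 0 < α) (hε : 0 < ε) (hρ : 0 < ρ) (h₁ : ρ ≤ ρ₁)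
    (h₂ : ρ ≤ ρ₂) : |(ρ₂ ^ 2 + ε ^ 2) ^ (-α) - (ρ₁ ^ 2 + ε ^ 2) ^ (-α)| ≤
      2 * α * ρ ^ (-1 - 2 * α) * |ρ₂ - ρ₁| := by
  refine (convex_Ici ρ).norm_image_sub_le_of_norm_hasDerivWithin_le
    (f := fun r : ℝ => (r ^ 2 + ε ^ 2) ^ (-α))
    (f' := fun r => 2 * r * (-α) * (r ^ 2 + ε ^ 2) ^ (-α - 1)) (fun r _ => ?_) (fun r hr => ?_) h₁ h₂
  · have h1 : HasDerivAt (fun r : ℝ => r ^ 2 + ε ^ 2) (2 * r) r := by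
      simpa using (hasDerivAt_pow 2 r).add_const (ε ^ 2)
    exact (h1.rpow_const (p := -α) (Or.inl (by positivity))).hasDerivWithinAt
  · have hr' : ρ ≤ r := hr
    have hr0 : 0 < r := hρ.trans_le hr'
    have e : (r ^ 2 + ε ^ 2) ^ (-α - 1) ≤ (r ^ 2) ^ (-α - 1) :=
      Real.rpow_le_rpow_of_nonpos (by positivity) (by nlinarith [sq_nonneg ε]) (by linarith)
    have e2 : (r ^ 2) ^ (-α - 1) * r = r ^ (-1 - 2 * α) := by
      rw [← Real.rpow_two, ← Real.rpow_mul hr0.le, ← Real.rpow_add_one hr0.ne']; congr 1; ring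
    rw [Real.norm_eq_abs, abs_mul, abs_mul, abs_neg, abs_of_pos (by positivity : 0 < 2 * r),
      abs_of_pos hα, abs_of_nonneg (by positivity : 0 ≤ (r ^ 2 + ε ^ 2) ^ (-α - 1))]
    calc 2 * r * α * (r ^ 2 + ε ^ 2) ^ (-α - 1) ≤ 2 * r * α * (r ^ 2) ^ (-α - 1) := by gcongr
      _ = 2 * α * r ^ (-1 - 2 * α) := by rw [← e2]; ring
      _ ≤ _ := by
        gcongr 2 * α * ?_
        exact Real.rpow_le_rpow_of_nonpos hρ hr' (by linarith)

lemma Periodic.intervalIntegral_eq_centered {f : ℝ → Plane} {L : ℝ} (hf : Function.Periodic f L)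
    (s : ℝ) : ∫ s' in (0)..L, f s' = ∫ u in (-(L / 2))..(L / 2), f (s + u) := by
  have h1 := hf.intervalIntegral_add_eq 0 (s + -(L / 2))
  rw [zero_add] at h1
  rw [h1, intervalIntegral.integral_comp_add_left]
  congr 1; ring

lemma norm_integral_le_of_singular {E : Type*} [NormedAddCommGroup E] [NormedSpace ℝ E]
    {f : ℝ → E} {C σ A : ℝ} (hσ : 0 < σ) (hA : 0 ≤ A)
    (hf : ∀ u, |u| ≤ A → u ≠ 0 → ‖f u‖ ≤ C * |u| ^ (σ - 1)) :
    ‖∫ u in (-A)..A, f u‖ ≤ C * (2 * (A ^ σ / σ)) := by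
  rw [← integral_abs_rpow hσ hA, ← intervalIntegral.integral_const_mul]
  refine intervalIntegral.norm_integral_le_of_norm_le (by linarith) ?_
    ((intervalIntegrable_abs_rpow hσ _ _).const_mul C)
  have hne : ∀ᵐ u : ℝ, u ≠ 0 := by rw [ae_iff]; simp
  filter_upwards [hne] with u hu0 hu
  exact hf u (abs_le.2 ⟨hu.1.le, hu.2⟩) hu0

namespace RegularCurve

variable {α β M ℓ Λ lam L ε : ℝ} {Γ : ℝ → Plane} {Ω : Set Plane}
  (h : RegularCurve β M ℓ Λ lam L Γ Ω) (hα : 0 < α) (hσ : 2 * α < β) (hε : 0 < ε)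

include h hα hσ

omit hα in
lemma derivBound_nonneg : 0 ≤ derivBound α β M Λ lam := by
  have h1 := h.M_pos
  have h2 := h.lam_pos
  have h3 : 0 < Λ := h.length_pos.trans_le h.length_le
  have h4 : 0 < β - 2 * α := by linarith
  unfold derivBound; positivity

lemma derivHolder_nonneg : 0 ≤ derivHolder α β M ℓ Λ lam := by
  have h1 := h.M_pos
  have h2 := h.lam_pos
  have h3 := h.scale_pos
  have h4 : 0 < β - 2 * α := by linarith
  have h5 := h.derivBound_nonneg hσ
  unfold derivHolder; positivity

include hε

lemma norm_integral_regPhi_le (s : ℝ) :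
    ‖∫ s' in (0)..L, regPhi α ε Γ s s'‖ ≤ derivBound α β M Λ lam := by
  have hL := h.length_pos
  have hlam := h.lam_pos
  have hM := h.M_pos
  have hs : 0 < β - 2 * α := by linarith
  rw [Periodic.intervalIntegral_eq_centered (h.periodic_regPhi s) s]
  refine (norm_integral_le_of_singular (C := 2 * M * lam ^ (-1 - 2 * α)) hs (by linarith)
    fun u hu hu0 => ?_).trans ?_
  · have := h.norm_regPhi_le hα hε (s := s) (s' := s + u) (by rw [add_sub_cancel_left]; linarith)
      (by simpa using hu0)
    rwa [add_sub_cancel_left] at this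
  · unfold derivBound
    gcongr
    linarith [h.length_le]

/-- Increments up to `ℓ/8`, hence below `L/8`, are treated by the near-far splitting with `κ = 2α`.
For larger ones twice the uniform bound suffices, at the price of the factor `(8/ℓ)^(β-2α)`. -/
lemma norm_integral_regPhi_sub_le (s₁ s₂ : ℝ) :
    ‖(∫ s' in (0)..L, regPhi α ε Γ s₁ s') - ∫ s' in (0)..L, regPhi α ε Γ s₂ s'‖ ≤
      derivHolder α β M ℓ Λ lam * |s₂ - s₁| ^ (β - 2 * α) := by
  wlog hlt : s₁ ≤ s₂ generalizing s₁ s₂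
  · rw [norm_sub_rev, abs_sub_comm]
    exact this s₂ s₁ (not_le.1 hlt).le
  have hL := h.length_pos
  have hlam := h.lam_pos
  have hM := h.M_pos
  have hs : 0 < β - 2 * α := by linarith
  have hℓ := h.scale_pos
  have hB := h.derivBound_nonneg hσ
  rcases hlt.eq_or_lt with rfl | hlt
  · simp [Real.zero_rpow hs.ne']
  rw [abs_of_pos (sub_pos.2 hlt)]
  rw [derivHolder, add_mul]
  rcases le_total (s₂ - s₁) (ℓ / 8) with hsmall | hlarge
  · have hd8 : s₂ - s₁ ≤ L / 8 := by linarith [h.scale_lt_length]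
    have hc : ∀ s, Continuous fun u => regPhi α ε Γ s (s₁ + u) := fun s =>
      (h.continuous_regPhi hε s).comp (by fun_prop)
    rw [Periodic.intervalIntegral_eq_centered (h.periodic_regPhi s₁) s₁,
      Periodic.intervalIntegral_eq_centered (h.periodic_regPhi s₂) s₁]
    refine (norm_integral_sub_integral_le (C₁ := 2 * M * lam ^ (-1 - 2 * α))
      (C₂ := 2 * M * (2 * α + 3) * (lam / 2) ^ (-2 - 2 * α) + 6 * M * (lam / 2) ^ (-1 - 2 * α))
      (κ := 2 * α) (h := s₂ - s₁) hs (by positivity) (by positivity)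
      (by linarith) (by linarith) (hc s₁) (hc s₂) (fun u hu hu0 => ?_) (fun u hu hu0 => ?_)
      (fun u hu hu' => ?_) (by positivity)).trans (le_add_of_nonneg_right ?_)
    · have := h.norm_regPhi_le hα hε (s := s₁) (s' := s₁ + u)
        (by rw [add_sub_cancel_left]; linarith) (by simpa using hu0)
      rwa [add_sub_cancel_left] at this
    · have e : s₁ + u - s₂ = u - (s₂ - s₁) := by ring
      have := h.norm_regPhi_le hα hε (s := s₂) (s' := s₁ + u)
        (by
          rw [e]
          have := abs_sub u (s₂ - s₁)
          rw [abs_of_pos (sub_pos.2 hlt)] at this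
          linarith) (fun h => hu0 (by linarith))
      rwa [e] at this
    · have := h.norm_regPhi_sub_le hα hε hlt hd8 (s' := s₁ + u)
        (by rwa [add_sub_cancel_left]) (by rwa [add_sub_cancel_left])
      rw [add_sub_cancel_left] at this
      rwa [sub_add_cancel]
    · have : 0 < s₂ - s₁ := sub_pos.2 hlt
      positivity
  · refine le_trans ?_ (le_add_of_nonneg_left ?_)
    · refine (norm_sub_le _ _).trans ((add_le_add (h.norm_integral_regPhi_le hα hσ hε s₁)
        (h.norm_integral_regPhi_le hα hσ hε s₂)).trans ?_)
      rw [mul_assoc, ← Real.mul_rpow (by positivity) (by linarith), ← two_mul]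
      refine le_mul_of_one_le_right (by positivity) (Real.one_le_rpow ?_ hs.le)
      rw [div_mul_eq_mul_div, le_div_iff₀ hℓ]
      linarith
    · have : 0 < s₂ - s₁ := sub_pos.2 hlt
      positivity

/-- The first order expansion of the regularized velocity along the curve. -/
lemma norm_regVelocity_sub_le (s s' : ℝ) :
    ‖regVelocity α ε Ω (Γ s') - regVelocity α ε Ω (Γ s) -
        (s' - s) • -∫ r in (0)..L, regPhi α ε Γ s r‖ ≤
      derivHolder α β M ℓ Λ lam * |s' - s| ^ (β - 2 * α) * |s' - s| := by
  have hK := h.derivHolder_nonneg hα hσ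
  have := (convex_uIcc s s').norm_image_sub_le_of_norm_hasDerivWithin_le
    (f := fun x => regVelocity α ε Ω (Γ x) - x • -∫ r in (0)..L, regPhi α ε Γ s r)
    (f' := fun x => (-∫ r in (0)..L, regPhi α ε Γ x r) - -∫ r in (0)..L, regPhi α ε Γ s r)
    (C := derivHolder α β M ℓ Λ lam * |s' - s| ^ (β - 2 * α)) (x := s) (y := s')
    (fun x _ => ?_) (fun x hx => ?_) left_mem_uIcc right_mem_uIcc
  · rw [Real.norm_eq_abs] at this
    refine le_of_eq_of_le (congrArg _ ?_) this
    module
  · have := (h.hasDerivAt_regVelocity hα hε x).sub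
      ((hasDerivAt_id x).smul_const (-∫ r in (0)..L, regPhi α ε Γ s r))
    rw [one_smul] at this
    exact this.hasDerivWithinAt
  · rw [neg_sub_neg]
    refine (h.norm_integral_regPhi_sub_le hα hσ hε s x).trans ?_
    have : |x - s| ≤ |s' - s| := abs_sub_left_of_mem_uIcc hx
    gcongr

/-- Normal Lipschitz estimate for the regularized velocity. -/
lemma abs_inner_regVelocity_sub_le {s : ℝ} {X : Plane} (hs : ∀ s', ‖X - Γ s‖ ≤ ‖X - Γ s'‖) :
    |inner ℝ (perp (deriv Γ s)) (regVelocity α ε Ω X - regVelocity α ε Ω (Γ s))| ≤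
      normalBound α β M Λ lam * ‖X - Γ s‖ := by
  have hL := h.length_pos
  have hlam := h.lam_pos
  have hM := h.M_pos
  have hσ' : 0 < β - 2 * α := by linarith
  set n := perp (deriv Γ s) with hn
  have hnn : ‖n‖ = 1 := h.norm_perp_deriv s
  set F : ℝ → Plane := fun s' => (‖X - Γ s'‖ ^ 2 + ε ^ 2) ^ (-α) • deriv Γ s' -
    (‖Γ s - Γ s'‖ ^ 2 + ε ^ 2) ^ (-α) • deriv Γ s' with hF
  have hc1 := h.continuous_regBoundary hε (-α) X
  have hc2 := h.continuous_regBoundary hε (-α) (Γ s)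
  have hcF : Continuous F := hc1.sub hc2
  have hper : Function.Periodic F L := fun s' => by
    simp only [hF, h.periodic s', h.periodic_deriv s']
  have h1 : (2 * α) • (regVelocity α ε Ω X - regVelocity α ε Ω (Γ s)) =
      ∫ s' in (0)..L, F s' := by
    rw [smul_sub, h.regVelocity_eq h.patch hε, h.regVelocity_eq h.patch hε,
      ← intervalIntegral.integral_sub (hc1.intervalIntegrable _ _) (hc2.intervalIntegrable _ _)]
  have h2 : 2 * α * inner ℝ n (regVelocity α ε Ω X - regVelocity α ε Ω (Γ s)) =
      ∫ u in (-(L / 2))..(L / 2), inner ℝ n (F (s + u)) := by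
    rw [← inner_smul_right, h1, Periodic.intervalIntegral_eq_centered hper s]
    have hi : IntervalIntegrable (fun u => F (s + u)) volume (-(L / 2)) (L / 2) :=
      (hcF.comp (by fun_prop)).intervalIntegrable _ _
    have := (innerSL ℝ n).intervalIntegral_comp_comm hi
    simp only [innerSL_apply_apply] at this
    exact this.symm
  have hb : ∀ u, |u| ≤ L / 2 → u ≠ 0 → ‖inner ℝ n (F (s + u))‖ ≤
      (2 * α * ‖X - Γ s‖ * (M * (lam / 2) ^ (-1 - 2 * α))) * |u| ^ (β - 2 * α - 1) := by
    intro u hu hu0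
    have hu0' : 0 < |u| := abs_pos.2 hu0
    have harc := h.arc s (s + u) (by rw [add_sub_cancel_left]; linarith)
    rw [add_sub_cancel_left, norm_sub_rev] at harc
    -- Because `Γ s` is nearest to `X`, the distances to `Γ (s + u)` from `X` and from the foot are
    -- both at least `lam / 2 * |u|`.
    have hX : ‖Γ s - Γ (s + u)‖ ≤ 2 * ‖X - Γ (s + u)‖ := by
      have := norm_sub_le (X - Γ (s + u)) (X - Γ s)
      rw [sub_sub_sub_cancel_left] at this
      linarith [hs (s + u)]
    have hker := abs_reg_rpow_sub_le (ρ := lam / 2 * |u|) (ρ₁ := ‖Γ s - Γ (s + u)‖)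
      (ρ₂ := ‖X - Γ (s + u)‖) hα hε (by positivity) (by nlinarith) (by nlinarith)
    have hdiff : |‖X - Γ (s + u)‖ - ‖Γ s - Γ (s + u)‖| ≤ ‖X - Γ s‖ := by
      refine (abs_norm_sub_norm_le _ _).trans ?_
      rw [sub_sub_sub_cancel_right]
    -- The normal at `s` is orthogonal to the tangent there, so its product with nearby tangents is
    -- only `O(|u|^β)`. This compensates the kernel difference of order `|u|^(-1-2α)`; the
    -- tangential component has no such gain.
    have hnd : |inner ℝ n (deriv Γ (s + u))| ≤ M * |u| ^ β := by
      have e : inner ℝ n (deriv Γ (s + u)) = inner ℝ n (deriv Γ (s + u) - deriv Γ s) := by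
        rw [inner_sub_right, hn, real_inner_comm (deriv Γ s), inner_perp_self, sub_zero]
      rw [e]
      refine (abs_real_inner_le_norm _ _).trans ?_
      rw [hnn, one_mul]
      have := h.holder s (s + u)
      rwa [add_sub_cancel_left] at this
    simp only [hF]
    rw [← sub_smul, inner_smul_right, Real.norm_eq_abs, abs_mul]
    calc _ ≤ (2 * α * (lam / 2 * |u|) ^ (-1 - 2 * α) * ‖X - Γ s‖) * (M * |u| ^ β) := by
          gcongr
          exact hker.trans (by gcongr)
      _ = (2 * α * ‖X - Γ s‖ * (M * (lam / 2) ^ (-1 - 2 * α))) * (|u| ^ (-1 - 2 * α) * |u| ^ β) := by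
          rw [Real.mul_rpow (by positivity) hu0'.le]; ring
      _ = _ := by rw [← Real.rpow_add hu0']; congr 2; ring
  have h3 := norm_integral_le_of_singular hσ' (by linarith) hb
  rw [← h2, Real.norm_eq_abs, abs_mul, abs_of_pos (by positivity : 0 < 2 * α)] at h3
  have h4 : (L / 2) ^ (β - 2 * α) ≤ Λ ^ (β - 2 * α) := by
    gcongr
    linarith [h.length_le]
  refine le_of_mul_le_mul_left (h3.trans ?_) (by positivity : 0 < 2 * α)
  calc _ ≤ 2 * α * ‖X - Γ s‖ * (M * (lam / 2) ^ (-1 - 2 * α)) *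
        (2 * (Λ ^ (β - 2 * α) / (β - 2 * α))) := by gcongr
    _ = _ := by rw [normalBound]; ring

omit hε
variable (hα₁ : α < 1 / 2)
include hα₁

omit hσ in
lemma tendsto_regVelocity (X : Plane) :
    Tendsto (fun ε => regVelocity α ε Ω X) (𝓝[>] 0) (𝓝 (biotSavart α (Ω.indicator 1) X)) :=
  AlphaPatch.tendsto_regVelocity hα hα₁ h.patch.isOpen.measurableSet h.patch.isBounded X

/-- Normal Lipschitz estimate for the velocity. -/
lemma exists_norm_velocity_sub_le {s : ℝ} {X : Plane} (hs : ∀ s', ‖X - Γ s‖ ≤ ‖X - Γ s'‖) :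
    ∃ a : ℝ, ‖biotSavart α (Ω.indicator 1) X - biotSavart α (Ω.indicator 1) (Γ s) -
      a • deriv Γ s‖ ≤ normalBound α β M Λ lam * ‖X - Γ s‖ := by
  set w := biotSavart α (Ω.indicator 1) X - biotSavart α (Ω.indicator 1) (Γ s)
  refine ⟨inner ℝ (deriv Γ s) w, ?_⟩
  have h1 : Tendsto (fun ε => |inner ℝ (perp (deriv Γ s))
      (regVelocity α ε Ω X - regVelocity α ε Ω (Γ s))|) (𝓝[>] 0)
      (𝓝 |inner ℝ (perp (deriv Γ s)) w|) :=
    (tendsto_const_nhds.inner ((h.tendsto_regVelocity hα hα₁ X).sub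
      (h.tendsto_regVelocity hα hα₁ (Γ s)))).abs
  have h2 := le_of_tendsto h1 (eventually_mem_nhdsWithin.mono fun ε hε =>
    h.abs_inner_regVelocity_sub_le hα hσ hε hs)
  have h3 := frame_expansion (h.norm_deriv s) w
  rw [sub_eq_iff_eq_add'.2 h3, norm_smul, h.norm_perp_deriv, mul_one]
  exact h2

/-- The tangential derivative of the velocity. -/
lemma exists_tangential_deriv : ∃ W : ℝ → Plane, Function.Periodic W L ∧
    (∀ s, ‖W s‖ ≤ derivBound α β M Λ lam) ∧
    (∀ s s', ‖W s' - W s‖ ≤ derivHolder α β M ℓ Λ lam * |s' - s| ^ (β - 2 * α)) ∧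
    ∀ s s', ‖biotSavart α (Ω.indicator 1) (Γ s') - biotSavart α (Ω.indicator 1) (Γ s) -
        (s' - s) • W s‖ ≤ derivHolder α β M ℓ Λ lam * |s' - s| ^ (β - 2 * α) * |s' - s| := by
  -- Convergence of the regularized derivatives as `ε → 0` need not be proved: they are bounded, so
  -- they converge along an ultrafilter, and all the estimates pass to that limit.
  let U : Ultrafilter ℝ := Ultrafilter.of (𝓝[>] (0 : ℝ))
  have hU : (U : Filter ℝ) ≤ 𝓝[>] 0 := Ultrafilter.of_le _
  have hpos : ∀ᶠ ε in (U : Filter ℝ), 0 < ε := hU self_mem_nhdsWithin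
  have hW : ∀ s, ∃ w, Tendsto (fun ε => -∫ s' in (0)..L, regPhi α ε Γ s s') U (𝓝 w) := by
    intro s
    obtain ⟨w, -, hw⟩ := (isCompact_closedBall (0 : Plane)
      (derivBound α β M Λ lam)).ultrafilter_le_nhds
      (U.map fun ε => -∫ s' in (0)..L, regPhi α ε Γ s s') (by
        rw [le_principal_iff, Ultrafilter.coe_map, mem_map]
        filter_upwards [hpos] with ε hε
        simpa using h.norm_integral_regPhi_le hα hσ hε s)
    exact ⟨w, hw⟩
  choose W hW using hW
  refine ⟨W, fun s => ?_, fun s => ?_, fun s s' => ?_, fun s s' => ?_⟩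
  · refine tendsto_nhds_unique (hW (s + L)) ?_
    refine (hW s).congr fun ε => ?_
    simp only [regPhi, h.periodic s, h.periodic_deriv s]
  · refine le_of_tendsto (hW s).norm (hpos.mono fun ε hε => ?_)
    rw [norm_neg]
    exact h.norm_integral_regPhi_le hα hσ hε s
  · refine le_of_tendsto ((hW s').sub (hW s)).norm (hpos.mono fun ε hε => ?_)
    rw [neg_sub_neg]
    exact h.norm_integral_regPhi_sub_le hα hσ hε s s'
  · refine le_of_tendsto ((((h.tendsto_regVelocity hα hα₁ (Γ s')).mono_left hU).sub
      ((h.tendsto_regVelocity hα hα₁ (Γ s)).mono_left hU)).sub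
      ((hW s).const_smul (s' - s))).norm (hpos.mono fun ε hε => ?_)
    exact h.norm_regVelocity_sub_le hα hσ hε s s'

end RegularCurve


/-! ### The velocity as a field along the boundary -/

/-- Regularity of a field along a curve: Lipschitz and tangentially `C^{1,σ}` along the curve, and
Lipschitz up to a tangential term off the curve. -/
structure CurveField (σ K : ℝ) (C : Set Plane) (v : Plane → Plane) : Prop where
  one_le : 1 ≤ K
  isCompact : IsCompact C
  nonempty : C.Nonempty
  lip : ∀ P ∈ C, ∀ Q ∈ C, ‖v Q - v P‖ ≤ K * ‖Q - P‖
  jet : ∃ A : Plane → Plane →L[ℝ] Plane, (∀ P ∈ C, ‖A P‖ ≤ K) ∧ ∀ P ∈ C, ∀ Q ∈ C,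
    ‖A Q - A P‖ ≤ K * ‖Q - P‖ ^ σ ∧ ‖v Q - v P - A P (Q - P)‖ ≤ K * ‖Q - P‖ ^ σ * ‖Q - P‖
  normal : ∀ X, ∃ P ∈ C, ‖X - P‖ = Metric.infDist X C ∧ ∃ u : Plane,
    ‖v X - v P - u‖ ≤ K * Metric.infDist X C ∧
      ∀ ε > 0, ∀ᶠ h in 𝓝 (0 : ℝ), ∃ P' ∈ C, ‖P' - P - h • u‖ ≤ ε * |h|

namespace RegularCurve

variable {α β M ℓ Λ lam L ε : ℝ} {Γ : ℝ → Plane} {Ω : Set Plane}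
  (h : RegularCurve β M ℓ Λ lam L Γ Ω)
include h

/-- The point `Γ (s + t * a)` serves. A tangential error in the velocity can thus be absorbed, to
first order, by moving within the curve. -/
lemma exists_tangent_motion (s a : ℝ) {ε : ℝ} (hε : 0 < ε) :
    ∀ᶠ t in 𝓝 (0 : ℝ), ∃ P' ∈ frontier Ω, ‖P' - Γ s - t • a • deriv Γ s‖ ≤ ε * |t| := by
  have hd : HasDerivAt (fun t : ℝ => Γ (s + t * a)) (a • deriv Γ s) 0 := by
    have h1 : HasDerivAt (fun t : ℝ => s + t * a) a 0 := by
      simpa using ((hasDerivAt_id (0 : ℝ)).mul_const a).const_add s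
    have h2 : HasDerivAt Γ (deriv Γ s) (s + 0 * a) := by
      rw [zero_mul, add_zero]; exact h.hasDerivAt s
    exact h2.scomp 0 h1
  have := (hasDerivAt_iff_isLittleO.1 hd).def hε
  filter_upwards [this] with t ht
  refine ⟨Γ (s + t * a), h.mem_frontier _, ?_⟩
  simpa using ht

end RegularCurve

/-- The constant is built from the parameters of `RegularCurve` alone, hence is uniform in time. The
jet at a boundary point is the rank-one map sending the unit tangent to the tangential derivative
`W` and the normal to zero. It is `σ`-Hölder because `W` is, and because the tangent is even
`β`-Hölder on arcs of length at most `Λ`. -/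
lemma exists_curveField {α β M ℓ Λ lam : ℝ} (hα : 0 < α) (hα₁ : α < 1 / 2) (hσ : 2 * α < β) :
    ∃ K, ∀ (L : ℝ) (Γ : ℝ → Plane) (Ω : Set Plane), RegularCurve β M ℓ Λ lam L Γ Ω →
      CurveField (β - 2 * α) K (frontier Ω) (biotSavart α (Ω.indicator 1)) := by
  set B := derivBound α β M Λ lam with hBdef
  set H := derivHolder α β M ℓ Λ lam with hHdef
  set N := normalBound α β M Λ lam with hNdef
  set σ := β - 2 * α with hσdef
  have hσ0 : 0 < σ := by linarith
  set G := H + M * B * Λ ^ (2 * α) with hG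
  set K₁ := 1 + B + G * lam⁻¹ ^ σ * (1 + lam⁻¹) + (H * Λ ^ σ + B) * lam⁻¹ with hK₁
  set K := max K₁ N with hK
  refine ⟨K, fun L Γ Ω h => ?_⟩
  have hB : 0 ≤ B := h.derivBound_nonneg hσ
  have hH : 0 ≤ H := h.derivHolder_nonneg hα hσ
  have hM := h.M_pos
  have hlam := h.lam_pos
  have hL := h.length_pos
  have hΛ : 0 < Λ := hL.trans_le h.length_le
  have hGn : 0 ≤ G := by positivity
  set v := biotSavart α (Ω.indicator 1) with hv
  obtain ⟨W, hWper, hWB, hWH, hWv⟩ := h.exists_tangential_deriv hα hσ hα₁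
  have hKK : ∀ {x}, x ≤ K₁ → x ≤ K := fun hx => hx.trans (le_max_left _ _)
  -- passing from parameters to points
  have hpt : ∀ {d r : ℝ}, 0 ≤ d → lam * d ≤ r → d ≤ lam⁻¹ * r := fun hd hr => by
    rw [inv_mul_eq_div, le_div_iff₀ hlam]; linarith
  have hpow : ∀ {d : ℝ}, 0 ≤ d → d ≤ Λ → M * d ^ β * B ≤ M * B * Λ ^ (2 * α) * d ^ σ := by
    intro d hd hdΛ
    have e : d ^ β = d ^ (2 * α) * d ^ σ := by
      rw [← Real.rpow_add_of_nonneg hd (by linarith) hσ0.le]; congr 1; ring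
    rw [e]
    calc M * (d ^ (2 * α) * d ^ σ) * B ≤ M * (Λ ^ (2 * α) * d ^ σ) * B := by gcongr
      _ = _ := by ring
  choose! S hS using fun P (hP : P ∈ frontier Ω) => h.exists_eq hP
  have hnear : ∀ P ∈ frontier Ω, ∀ Q ∈ frontier Ω, ∃ s', Γ s' = Q ∧ deriv Γ s' = deriv Γ (S Q) ∧
      W s' = W (S Q) ∧ |s' - S P| ≤ Λ ∧ |s' - S P| ≤ lam⁻¹ * ‖Q - P‖ := by
    intro P hP Q hQ
    obtain ⟨n, hn, hn'⟩ := exists_int_sub_mem_Ico hL (S P - L / 2) (S Q)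
    have hr : Γ (S Q - n * L) = Γ (S Q) := h.periodic.sub_int_mul_eq n
    have habs : |S Q - n * L - S P| ≤ L / 2 := abs_le.2 ⟨by linarith, by linarith⟩
    refine ⟨S Q - n * L, hr.trans (hS Q hQ), h.periodic_deriv.sub_int_mul_eq n,
      hWper.sub_int_mul_eq n, habs.trans (by linarith [h.length_le]), hpt (abs_nonneg _) ?_⟩
    have := h.arc (S P) (S Q - n * L) (by linarith)
    rwa [hr, hS P hP, hS Q hQ] at this
  refine ⟨hKK ?_, h.isCompact_frontier, h.nonempty_frontier, fun P hP Q hQ => ?_,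
    ⟨fun P => (innerSL ℝ (deriv Γ (S P))).smulRight (W (S P)), fun P hP => ?_,
      fun P hP Q hQ => ⟨?_, ?_⟩⟩, fun X => ?_⟩
  · have : 0 ≤ B + G * lam⁻¹ ^ σ * (1 + lam⁻¹) + (H * Λ ^ σ + B) * lam⁻¹ := by positivity
    linarith
  · obtain ⟨s', hs', -, -, hd1, hd2⟩ := hnear P hP Q hQ
    have h1 := hWv (S P) s'
    rw [hs', hS P hP] at h1
    set d := |s' - S P| with hd
    have hd0 : 0 ≤ d := abs_nonneg _
    have h2 : ‖v Q - v P‖ ≤ H * Λ ^ σ * d + d * B := by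
      have e : v Q - v P = (v Q - v P - (s' - S P) • W (S P)) + (s' - S P) • W (S P) := by abel
      rw [e]
      refine (norm_add_le _ _).trans (add_le_add (h1.trans ?_) ?_)
      · gcongr
      · rw [norm_smul, Real.norm_eq_abs]
        gcongr
        exact hWB _
    calc _ ≤ _ := h2
      _ = (H * Λ ^ σ + B) * d := by ring
      _ ≤ (H * Λ ^ σ + B) * (lam⁻¹ * ‖Q - P‖) := by gcongr
      _ = (H * Λ ^ σ + B) * lam⁻¹ * ‖Q - P‖ := by ring
      _ ≤ _ := by
        gcongr
        apply hKK
        have : 0 ≤ B + G * lam⁻¹ ^ σ * (1 + lam⁻¹) := by positivity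
        linarith
  · rw [ContinuousLinearMap.norm_smulRight_apply, innerSL_apply_norm, h.norm_deriv, one_mul]
    refine (hWB _).trans (hKK ?_)
    have : 0 ≤ G * lam⁻¹ ^ σ * (1 + lam⁻¹) + (H * Λ ^ σ + B) * lam⁻¹ := by positivity
    linarith
  · obtain ⟨s', hs', hs'd, hs'W, hd1, hd2⟩ := hnear P hP Q hQ
    beta_reduce
    rw [← hs'd, ← hs'W]
    have h1 := h.holder (S P) s'
    have h2 := hWH (S P) s'
    set d := |s' - S P| with hd
    have hd0 : 0 ≤ d := abs_nonneg _
    have h3 : ‖(innerSL ℝ (deriv Γ s')).smulRight (W s') -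
        (innerSL ℝ (deriv Γ (S P))).smulRight (W (S P))‖ ≤ M * d ^ β * B + H * d ^ σ := by
      refine ContinuousLinearMap.opNorm_le_bound _ (by positivity) fun x => ?_
      have e : ((innerSL ℝ (deriv Γ s')).smulRight (W s') -
          (innerSL ℝ (deriv Γ (S P))).smulRight (W (S P))) x =
          inner ℝ (deriv Γ s' - deriv Γ (S P)) x • W s' +
            inner ℝ (deriv Γ (S P)) x • (W s' - W (S P)) := by
        simp only [sub_apply, ContinuousLinearMap.smulRight_apply,
          innerSL_apply_apply, inner_sub_left]
        module
      rw [e, add_mul]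
      refine (norm_add_le _ _).trans (add_le_add ?_ ?_)
      · rw [norm_smul]
        calc _ ≤ (‖deriv Γ s' - deriv Γ (S P)‖ * ‖x‖) * B :=
              mul_le_mul (norm_inner_le_norm _ _) (hWB _) (norm_nonneg _) (by positivity)
          _ ≤ (M * d ^ β * ‖x‖) * B := by gcongr
          _ = _ := by ring
      · rw [norm_smul]
        calc _ ≤ (‖deriv Γ (S P)‖ * ‖x‖) * (H * d ^ σ) :=
              mul_le_mul (norm_inner_le_norm _ _) h2 (norm_nonneg _) (by positivity)
          _ = _ := by rw [h.norm_deriv]; ring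
    calc _ ≤ _ := h3
      _ ≤ M * B * Λ ^ (2 * α) * d ^ σ + H * d ^ σ := by gcongr ?_ + _; exact hpow hd0 hd1
      _ = G * d ^ σ := by ring
      _ ≤ G * (lam⁻¹ * ‖Q - P‖) ^ σ := by gcongr
      _ = G * lam⁻¹ ^ σ * 1 * ‖Q - P‖ ^ σ := by
          rw [Real.mul_rpow (by positivity) (norm_nonneg _)]; ring
      _ ≤ K * ‖Q - P‖ ^ σ := by
          gcongr
          apply hKK
          have : 0 ≤ B + G * lam⁻¹ ^ σ * lam⁻¹ + (H * Λ ^ σ + B) * lam⁻¹ := by positivity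
          linarith
  · obtain ⟨s', hs', -, -, hd1, hd2⟩ := hnear P hP Q hQ
    have h1 := hWv (S P) s'
    have h2 := h.taylor (S P) s'
    rw [hs', hS P hP] at h1 h2
    set d := |s' - S P| with hd
    have hd0 : 0 ≤ d := abs_nonneg _
    have h3 : |inner ℝ (deriv Γ (S P)) (Q - P) - (s' - S P)| ≤ M * d ^ β * d := by
      have e : inner ℝ (deriv Γ (S P)) (Q - P) - (s' - S P) =
          inner ℝ (deriv Γ (S P)) (Q - P - (s' - S P) • deriv Γ (S P)) := by
        rw [inner_sub_right _ (Q - P), inner_smul_right, real_inner_self_eq_norm_sq, h.norm_deriv]; ring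
      rw [e]
      refine (abs_real_inner_le_norm _ _).trans ?_
      rwa [h.norm_deriv, one_mul]
    have h4 : ‖v Q - v P - (innerSL ℝ (deriv Γ (S P))).smulRight (W (S P)) (Q - P)‖ ≤
        H * d ^ σ * d + M * d ^ β * d * B := by
      have e : v Q - v P - (innerSL ℝ (deriv Γ (S P))).smulRight (W (S P)) (Q - P) =
          (v Q - v P - (s' - S P) • W (S P)) -
            (inner ℝ (deriv Γ (S P)) (Q - P) - (s' - S P)) • W (S P) := by
        simp only [ContinuousLinearMap.smulRight_apply, innerSL_apply_apply]
        module
      rw [e]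
      refine (norm_sub_le _ _).trans (add_le_add h1 ?_)
      rw [norm_smul, Real.norm_eq_abs]
      exact mul_le_mul h3 (hWB _) (norm_nonneg _) (by positivity)
    calc _ ≤ _ := h4
      _ = (H * d ^ σ + M * d ^ β * B) * d := by ring
      _ ≤ (H * d ^ σ + M * B * Λ ^ (2 * α) * d ^ σ) * d := by
          gcongr (_ + ?_) * _; exact hpow hd0 hd1
      _ = G * d ^ σ * d := by ring
      _ ≤ G * (lam⁻¹ * ‖Q - P‖) ^ σ * (lam⁻¹ * ‖Q - P‖) := by gcongr
      _ = G * lam⁻¹ ^ σ * lam⁻¹ * ‖Q - P‖ ^ σ * ‖Q - P‖ := by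
          rw [Real.mul_rpow (by positivity) (norm_nonneg _)]; ring
      _ ≤ K * ‖Q - P‖ ^ σ * ‖Q - P‖ := by
          gcongr
          apply hKK
          have : 0 ≤ B + G * lam⁻¹ ^ σ + (H * Λ ^ σ + B) * lam⁻¹ := by positivity
          linarith
  · obtain ⟨s, hs, -, -⟩ := h.exists_foot X
    have hinf : ‖X - Γ s‖ = Metric.infDist X (frontier Ω) := by
      refine le_antisymm ((Metric.le_infDist h.nonempty_frontier).2 fun {y} hy => ?_) ?_
      · obtain ⟨s', rfl⟩ := h.exists_eq hy
        rw [dist_eq_norm]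
        exact hs s'
      · rw [← dist_eq_norm]
        exact Metric.infDist_le_dist_of_mem (h.mem_frontier s)
    obtain ⟨a, ha⟩ := h.exists_norm_velocity_sub_le hα hσ hα₁ hs
    refine ⟨Γ s, h.mem_frontier s, hinf, a • deriv Γ s, ha.trans ?_, fun ε hε =>
      h.exists_tangent_motion s a hε⟩
    rw [hinf]
    have := Metric.infDist_nonneg (x := X) (s := frontier Ω)
    gcongr
    exact le_max_right _ _

namespace MovingCurve

variable {β M ℓ T : ℝ} {Ω : ℝ → Set Plane} {L : ℝ → ℝ} {Γ : ℝ → ℝ → Plane}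

/-- A chord of length at least `δ` is compared with `Λ`. For a shorter chord `c`, `ArcChord`
supplies a multiple `k` of the period: if `k = 0` then `|s' - s| ≤ 2c`; otherwise `L ≤ 3/4 L + 2c`,
so `|s' - s| ≤ 3/4 L ≤ 6c`. This explains `1/6`. -/
lemma exists_regularCurve (h : MovingCurve β M ℓ T Ω L Γ) (hT : 0 ≤ T) :
    ∃ Λ lam, ∀ t ∈ Icc 0 T, RegularCurve β M ℓ Λ lam (L t) (Γ t) (Ω t) := by
  obtain ⟨Λ, hΛ⟩ := h.exists_length_le hT
  obtain ⟨δ, hδ, -, hac⟩ := h.exists_uniform_arcChord hT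
  have h0 : (0 : ℝ) ∈ Icc 0 T := ⟨le_rfl, hT⟩
  have hΛ0 : 0 < Λ := (h.curve 0 h0).length_pos.trans_le (hΛ 0 h0)
  refine ⟨Λ, min (1 / 6) (δ / Λ), fun t ht => ⟨h.curve t ht, h.patch t ht, by positivity,
    fun s s' hs => ?_, hΛ t ht⟩⟩
  have hL := (h.curve t ht).length_pos
  rcases lt_or_ge ‖Γ t s' - Γ t s‖ δ with hlt | hge
  · obtain ⟨k, hk⟩ := hac t ht s s' hlt
    have : |s' - s| ≤ 6 * ‖Γ t s' - Γ t s‖ := by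
      rcases eq_or_ne k 0 with rfl | hk0
      · rw [Int.cast_zero, zero_mul, sub_zero] at hk
        linarith [norm_nonneg (Γ t s' - Γ t s)]
      · have h1 : (1 : ℝ) ≤ |(k : ℝ)| := by exact_mod_cast Int.one_le_abs hk0
        have h2 : |(k : ℝ) * L t| ≤ |s' - s| + |s' - s - k * L t| := by
          have := abs_sub (s' - s) (s' - s - k * L t)
          rwa [sub_sub_cancel] at this
        rw [abs_mul, abs_of_pos hL] at h2
        nlinarith
    calc _ ≤ 1 / 6 * |s' - s| := by gcongr; exact min_le_left _ _
      _ ≤ _ := by linarith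
  · calc _ ≤ δ / Λ * |s' - s| := by gcongr; exact min_le_right _ _
      _ ≤ δ / Λ * Λ := by
        gcongr
        linarith [hΛ t ht]
      _ = δ := by field_simp
      _ ≤ _ := hge

end MovingCurve


/-! ### Continuity in time of the velocity and of masses -/

/-- The curve is the image of a line in the plane under the differentiable map `x ↦ Γ (x 0)`, which
preserves null sets. -/
lemma HolderCurve.volume_frontier {β M ℓ L : ℝ} {Γ : ℝ → Plane} {Ω : Set Plane}
    (h : HolderCurve β M ℓ L Γ Ω) : volume (frontier Ω) = 0 := by
  have himg : frontier Ω = (fun x : Plane => Γ (x 0)) ''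
      (LinearMap.ker (EuclideanSpace.proj 1 : Plane →L[ℝ] ℝ).toLinearMap :
        Submodule ℝ Plane) := by
    rw [← h.range_eq]
    ext P
    constructor
    · rintro ⟨s, rfl⟩
      exact ⟨!₂[s, 0], by simp, by simp⟩
    · rintro ⟨x, -, rfl⟩
      exact ⟨x 0, rfl⟩
  rw [himg]
  refine addHaar_image_eq_zero_of_differentiableOn_of_addHaar_eq_zero volume ?_ ?_
  · have h1 : Differentiable ℝ Γ := h.contDiff.differentiable (by simp)
    have h2 : Differentiable ℝ fun x : Plane => x 0 :=
      (EuclideanSpace.proj 0 : Plane →L[ℝ] ℝ).differentiable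
    exact (h1.comp h2).differentiableOn
  · refine Measure.addHaar_submodule _ _ fun htop => ?_
    have : (!₂[0, 1] : Plane) ∈ (LinearMap.ker
        (EuclideanSpace.proj 1 : Plane →L[ℝ] ℝ).toLinearMap :
          Submodule ℝ Plane) := by rw [htop]; trivial
    simp at this

namespace MovingCurve

variable {α β M ℓ T : ℝ} {Ω : ℝ → Set Plane} {L : ℝ → ℝ} {Γ : ℝ → ℝ → Plane}
  (H : MovingCurve β M ℓ T Ω L Γ)
include H

lemma tendsto_indicator {t₀ : ℝ} (ht₀ : t₀ ∈ Icc 0 T) {X : Plane} (hX : X ∉ frontier (Ω t₀)) :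
    ∀ᶠ q : Plane × ℝ in 𝓝 X ×ˢ 𝓝[Icc 0 T] t₀,
      (Ω q.2).indicator (1 : Plane → ℝ) q.1 = (Ω t₀).indicator (1 : Plane → ℝ) X := by
  filter_upwards [H.eventually_mem_iff ht₀ hX] with q hq
  by_cases h : X ∈ Ω t₀
  · rw [indicator_of_mem h, indicator_of_mem (hq.2.2 h)]; rfl
  · rw [indicator_of_notMem h, indicator_of_notMem (mt hq.2.1 h)]

/-- The velocity field is continuous in space-time. -/
lemma continuousOn_velocity (hα₀ : 0 < α) (hα₁ : α < 1 / 2) :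
    ContinuousOn (fun q : Plane × ℝ => velocity α Ω q.1 q.2) (univ ×ˢ Icc 0 T) := by
  rintro ⟨X₀, t₀⟩ ⟨-, ht₀⟩
  obtain ⟨R, hR, hRΩ⟩ := H.exists_bound
  rw [ContinuousWithinAt, nhdsWithin_prod_eq, nhdsWithin_univ]
  simp only [velocity, biotSavart_indicator_eq]
  have hK := (locallyIntegrable_bsKernel hα₀ hα₁).integrableOn_isCompact
    (isCompact_closedBall (0 : Plane) (‖X₀‖ + 1 + R))
  have ht : ∀ᶠ q : Plane × ℝ in 𝓝 X₀ ×ˢ 𝓝[Icc 0 T] t₀, q.2 ∈ Icc 0 T :=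
    tendsto_snd.eventually eventually_mem_nhdsWithin
  have hX : ∀ᶠ q : Plane × ℝ in 𝓝 X₀ ×ˢ 𝓝[Icc 0 T] t₀, ‖q.1‖ < ‖X₀‖ + 1 :=
    tendsto_fst.eventually (continuous_norm.tendsto X₀ |>.eventually_lt_const (by linarith))
  refine tendsto_integral_filter_of_dominated_convergence
    ((Metric.closedBall (0 : Plane) (‖X₀‖ + 1 + R)).indicator fun z => ‖bsKernel α z‖) ?_ ?_ ?_ ?_
  · filter_upwards [ht] with q hq
    have h1 : Measurable fun z : Plane => (Ω q.2).indicator (1 : Plane → ℝ) (q.1 - z) :=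
      (measurable_one.indicator (H.patch _ hq).isOpen.measurableSet).comp
        (measurable_const.sub measurable_id)
    exact (h1.smul (measurable_bsKernel α)).aestronglyMeasurable
  · filter_upwards [ht, hX] with q hq hqX
    refine Eventually.of_forall fun z => ?_
    by_cases hz : q.1 - z ∈ Ω q.2
    · have hzb : z ∈ Metric.closedBall (0 : Plane) (‖X₀‖ + 1 + R) := by
        rw [mem_closedBall_zero_iff]
        have h1 := hRΩ _ hq _ (subset_closure hz)
        have h2 := norm_sub_le q.1 (q.1 - z)
        rw [sub_sub_cancel] at h2
        linarith
      rw [indicator_of_mem hzb, indicator_of_mem hz, Pi.one_apply, one_smul]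
    · rw [indicator_of_notMem hz, zero_smul, norm_zero]
      exact indicator_nonneg (fun _ _ => norm_nonneg _) _
  · exact (integrable_indicator_iff measurableSet_closedBall).2 hK.norm
  · have hnull : ∀ᵐ z : Plane, X₀ - z ∉ frontier (Ω t₀) := by
      have h0 : ∀ᵐ y : Plane, y ∉ frontier (Ω t₀) :=
        measure_eq_zero_iff_ae_notMem.1 (H.curve t₀ ht₀).volume_frontier
      exact (Measure.measurePreserving_sub_left volume X₀).quasiMeasurePreserving.ae h0
    filter_upwards [hnull] with z hz
    apply Tendsto.smul_const
    have hmap : Tendsto (fun q : Plane × ℝ => (q.1 - z, q.2)) (𝓝 X₀ ×ˢ 𝓝[Icc 0 T] t₀)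
        (𝓝 (X₀ - z) ×ˢ 𝓝[Icc 0 T] t₀) :=
      (((continuous_id.sub continuous_const).tendsto X₀).comp tendsto_fst).prodMk tendsto_snd
    exact tendsto_const_nhds.congr' ((hmap.eventually (H.tendsto_indicator ht₀ hz)).mono
      fun q hq => hq.symm)

/-- Integrals of continuous functions over the moving domain are continuous in time. -/
lemma continuousOn_integral {g : Plane × ℝ → ℝ} (hg : ContinuousOn g (univ ×ˢ Icc 0 T)) :
    ContinuousOn (fun t => ∫ x, (Ω t).indicator (1 : Plane → ℝ) x * g (x, t)) (Icc 0 T) := by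
  intro t₀ ht₀
  obtain ⟨R, hR, hRΩ⟩ := H.exists_bound
  obtain ⟨B, hB⟩ := ((isCompact_closedBall (0 : Plane) R).prod
    (isCompact_Icc (a := (0 : ℝ)) (b := T))).exists_bound_of_continuousOn
      (hg.mono (prod_mono (subset_univ _) subset_rfl))
  refine tendsto_integral_filter_of_dominated_convergence
    ((Metric.closedBall (0 : Plane) R).indicator fun _ => B) ?_ ?_ ?_ ?_
  · filter_upwards [eventually_mem_nhdsWithin] with t ht
    have h1 : Continuous fun x : Plane => g (x, t) :=
      hg.comp_continuous (by fun_prop) fun x => ⟨mem_univ _, ht⟩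
    exact ((measurable_one.indicator (H.patch _ ht).isOpen.measurableSet).mul
      h1.measurable).aestronglyMeasurable
  · filter_upwards [eventually_mem_nhdsWithin] with t ht
    refine Eventually.of_forall fun x => ?_
    by_cases hx : x ∈ Ω t
    · have hxb : x ∈ Metric.closedBall (0 : Plane) R := by
        rw [mem_closedBall_zero_iff]; exact hRΩ t ht x (subset_closure hx)
      rw [indicator_of_mem hxb, indicator_of_mem hx, Pi.one_apply, one_mul]
      exact hB (x, t) ⟨hxb, ht⟩
    · rw [indicator_of_notMem hx, zero_mul, norm_zero]
      refine indicator_nonneg (fun x hx => ?_) _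
      exact (norm_nonneg _).trans (hB (x, t) ⟨hx, ht⟩)
  · exact (integrable_indicator_iff measurableSet_closedBall).2
      (integrableOn_const measure_closedBall_lt_top.ne)
  · have h0 : ∀ᵐ y : Plane, y ∉ frontier (Ω t₀) :=
      measure_eq_zero_iff_ae_notMem.1 (H.curve t₀ ht₀).volume_frontier
    filter_upwards [h0] with x hx
    have hmap : Tendsto (fun t : ℝ => (x, t)) (𝓝[Icc 0 T] t₀) (𝓝 x ×ˢ 𝓝[Icc 0 T] t₀) :=
      tendsto_const_nhds.prodMk tendsto_id
    refine Tendsto.mul (tendsto_const_nhds.congr' ((hmap.eventually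
      (H.tendsto_indicator ht₀ hx)).mono fun q hq => hq.symm)) ?_
    have h1 := hg (x, t₀) ⟨mem_univ _, ht₀⟩
    rw [ContinuousWithinAt, nhdsWithin_prod_eq, nhdsWithin_univ] at h1
    exact h1.comp hmap

lemma integrable_indicator_mul {g : Plane → ℝ} (hg : Continuous g) {t : ℝ} (ht : t ∈ Icc 0 T) :
    Integrable fun x => (Ω t).indicator (1 : Plane → ℝ) x * g x := by
  have h1 : IntegrableOn g (Ω t) := (hg.continuousOn.integrableOn_compact
    (H.patch t ht).isBounded.isCompact_closure).mono_set subset_closure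
  refine ((integrable_indicator_iff (H.patch t ht).isOpen.measurableSet).2 h1).congr
    (Eventually.of_forall fun x => ?_)
  by_cases hx : x ∈ Ω t <;> simp [hx]

end MovingCurve


/-! ### The weak equation in a uniformly moving frame -/

lemma deriv_mul_comp_sub {φ : ℝ → ℝ} {ψ : Plane → ℝ} (hφ : ContDiff ℝ ∞ φ) (hψ : ContDiff ℝ ∞ ψ)
    (c V x : Plane) (t : ℝ) : deriv (fun s => φ s * ψ (x - (c + s • V))) t =
      deriv φ t * ψ (x - (c + t • V)) - φ t * fderiv ℝ ψ (x - (c + t • V)) V := by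
  have h1 : HasDerivAt (fun s : ℝ => x - (c + s • V)) (-V) t := by
    simpa using (((hasDerivAt_id t).smul_const V).const_add c).const_sub x
  have h2 : HasFDerivAt ψ (fderiv ℝ ψ (x - (c + t • V))) (x - (c + t • V)) :=
    (hψ.differentiable (by simp) _).hasFDerivAt
  have h3 := ((hφ.differentiable (by simp) t).hasDerivAt.mul (h2.comp_hasDerivAt t h1)).deriv
  simp only [map_neg, mul_neg] at h3
  exact h3

lemma fderiv_mul_comp_sub {ψ : Plane → ℝ} (hψ : ContDiff ℝ ∞ ψ) (r : ℝ) (c x w : Plane) :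
    fderiv ℝ (fun y => r * ψ (y - c)) x w = r * fderiv ℝ ψ (x - c) w := by
  have h2 : HasFDerivAt ψ (fderiv ℝ ψ (x - c)) (x - c) :=
    (hψ.differentiable (by simp) _).hasFDerivAt
  have h3 : HasFDerivAt (fun y => r * ψ (y - c)) (r • (fderiv ℝ ψ (x - c))) x := by
    have := (h2.comp x ((hasFDerivAt_id x).sub_const c)).const_mul r
    simpa using this
  rw [h3.fderiv]; rfl

namespace MovingCurve

variable {α β M ℓ T : ℝ} {Ω : ℝ → Set Plane} {L : ℝ → ℝ} {Γ : ℝ → ℝ → Plane}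
  (H : MovingCurve β M ℓ T Ω L Γ) (hα₀ : 0 < α) (hα₁ : α < 1 / 2) (hw : IsAlphaPatch α T Ω)
  {ψ : Plane → ℝ} (hψ : ContDiff ℝ ∞ ψ) (hψc : HasCompactSupport ψ) (c V : Plane)
include H hψ

lemma continuousOn_mass :
    ContinuousOn (fun t => ∫ x, (Ω t).indicator (1 : Plane → ℝ) x * ψ (x - (c + t • V)))
      (Icc 0 T) := by
  have := hψ.continuous
  exact H.continuousOn_integral (g := fun q => ψ (q.1 - (c + q.2 • V)))
    (Continuous.continuousOn (by fun_prop))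

include hα₀ hα₁

lemma continuousOn_flux : ContinuousOn (fun q : Plane × ℝ =>
      fderiv ℝ ψ (q.1 - (c + q.2 • V)) (velocity α Ω q.1 q.2 - V)) (univ ×ˢ Icc 0 T) := by
  have h1 : Continuous (fderiv ℝ ψ) := hψ.continuous_fderiv (by simp)
  refine ContinuousOn.clm_apply (Continuous.continuousOn ?_)
    ((H.continuousOn_velocity hα₀ hα₁).sub continuousOn_const)
  exact h1.comp (by fun_prop)

include hw hψc

/-- Testing with `φ(t) ψ(x - (c + tV))` shows that, in the moving frame, the weak time derivative of
the mass is the flux of the relative velocity `v - V`. The bound `b < T` keeps the test function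
supported in times before `T`. -/
lemma abs_mass_sub_le {a b : ℝ} (ha : 0 ≤ a) (hab : a < b) (hb : b < T) :
    |(∫ x, (Ω b).indicator (1 : Plane → ℝ) x * ψ (x - (c + b • V))) -
      ∫ x, (Ω a).indicator (1 : Plane → ℝ) x * ψ (x - (c + a • V))| ≤
      ∫ t in Icc a b, ‖∫ x, (Ω t).indicator (1 : Plane → ℝ) x *
        fderiv ℝ ψ (x - (c + t • V)) (velocity α Ω x t - V)‖ := by
  have hT : 0 < T := by linarith
  set m : ℝ → ℝ := fun t => ∫ x, (Ω t).indicator (1 : Plane → ℝ) x * ψ (x - (c + t • V)) with hm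
  set N : ℝ → ℝ := fun t => ∫ x, (Ω t).indicator (1 : Plane → ℝ) x *
    fderiv ℝ ψ (x - (c + t • V)) (velocity α Ω x t - V) with hN
  have hmc : ContinuousOn m (Icc 0 T) := H.continuousOn_mass hψ c V
  have hNc : ContinuousOn N (Icc 0 T) :=
    H.continuousOn_integral (H.continuousOn_flux hα₀ hα₁ hψ c V)
  have hsub : Icc a b ⊆ Icc 0 T := Icc_subset_Icc ha hb.le
  -- The mass is controlled on `[0, T]` only; it is extended by constants to a function continuous
  -- on the whole line.
  set f : ℝ → ℝ := IccExtend hT.le ((Icc 0 T).domRestrict m) with hf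
  have hfc : Continuous f := (continuousOn_iff_continuous_domRestrict.1 hmc).Icc_extend'
  have hfm : ∀ t ∈ Icc 0 T, f t = m t := fun t ht => by rw [hf, IccExtend_of_mem _ _ ht]; rfl
  have hkey := norm_sub_le_of_weakDeriv_on (g := N) hfc hab
    (hNc.mono hsub).integrableOn_Icc fun φ hφ hφ0 => ?_
  · rwa [hfm b (hsub ⟨hab.le, le_rfl⟩), hfm a (hsub ⟨le_rfl, hab.le⟩), Real.norm_eq_abs] at hkey
  have hdφ0 : ∀ t, t ∉ Icc a b → deriv φ t = 0 := by
    intro t ht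
    have : φ =ᶠ[𝓝 t] fun _ => 0 := by
      filter_upwards [isClosed_Icc.isOpen_compl.mem_nhds ht] with s hs using hφ0 s hs
    rw [this.deriv_eq]; simp
  -- Even for `a = 0` the cutoff vanishes at time `0`, by continuity from negative times, so the
  -- initial term of the weak formulation disappears.
  have hφz : φ 0 = 0 := by
    rcases ha.eq_or_lt with rfl | ha'
    · have h1 : Tendsto φ (𝓝[<] 0) (𝓝 (φ 0)) := hφ.continuous.continuousAt.tendsto.mono_left
        nhdsWithin_le_nhds
      refine tendsto_nhds_unique h1 (tendsto_const_nhds.congr' ?_)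
      filter_upwards [self_mem_nhdsWithin] with t ht
      exact (hφ0 t fun h => absurd h.1 (not_le.2 ht)).symm
    · exact hφ0 0 fun h => absurd h.1 (not_le.2 ha')
  -- the test function
  set Φ : Plane × ℝ → ℝ := fun q => φ q.2 * ψ (q.1 - (c + q.2 • V)) with hΦ
  have hΦs : ContDiff ℝ ∞ Φ := by
    have h1 : ContDiff ℝ ∞ fun q : Plane × ℝ => q.1 - (c + q.2 • V) := by fun_prop
    exact (hφ.comp contDiff_snd).mul (hψ.comp h1)
  obtain ⟨r, hr⟩ := hψc.isCompact.isBounded.exists_norm_le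
  have hzero : ∀ q : Plane × ℝ, q ∉ Metric.closedBall (0 : Plane) (r + (‖c‖ + T * ‖V‖)) ×ˢ Icc a b →
      Φ q = 0 := by
    intro q hq
    by_cases hq2 : q.2 ∈ Icc a b
    · have : ψ (q.1 - (c + q.2 • V)) = 0 := by
        by_contra hne
        apply hq
        refine ⟨?_, hq2⟩
        rw [mem_closedBall_zero_iff]
        have h1 := hr _ (subset_tsupport _ hne)
        have h2 : ‖c + q.2 • V‖ ≤ ‖c‖ + T * ‖V‖ := by
          refine (norm_add_le _ _).trans ?_
          rw [norm_smul, Real.norm_of_nonneg (hsub hq2).1]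
          gcongr
          exact (hsub hq2).2
        have h3 := norm_add_le (q.1 - (c + q.2 • V)) (c + q.2 • V)
        rw [sub_add_cancel] at h3
        linarith
      simp only [hΦ, this, mul_zero]
    · simp only [hΦ, hφ0 _ hq2, zero_mul]
  have hΦc : HasCompactSupport Φ :=
    HasCompactSupport.intro ((isCompact_closedBall _ _).prod isCompact_Icc) hzero
  have hΦt : tsupport Φ ⊆ {z | z.2 < T} := by
    have : tsupport Φ ⊆ {z | z.2 ≤ b} := by
      refine closure_minimal (fun q hq => ?_) (isClosed_le continuous_snd continuous_const)
      by_contra hlt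
      exact hq (hzero q fun h => hlt h.2.2)
    exact this.trans fun z hz => lt_of_le_of_lt hz hb
  have hweak := hw.weakSolution Φ hΦs hΦc hΦt
  simp only [hΦ, hφz, zero_mul, integral_zero] at hweak
  have hinner : ∀ t ∈ uIcc 0 T, (∫ x, (Ω t).indicator (1 : Plane → ℝ) x *
      (deriv (fun s => φ s * ψ (x - (c + s • V))) t +
        fderiv ℝ (fun y => φ t * ψ (y - (c + t • V))) x (velocity α Ω x t))) =
      deriv φ t * m t + φ t * N t := by
    intro t ht
    rw [uIcc_of_le hT.le] at ht
    have hi1 := H.integrable_indicator_mul (g := fun x => ψ (x - (c + t • V)))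
      (hψ.continuous.comp (by fun_prop)) ht
    have hi2 := H.integrable_indicator_mul
      (g := fun x => fderiv ℝ ψ (x - (c + t • V)) (velocity α Ω x t - V))
      ((H.continuousOn_flux hα₀ hα₁ hψ c V).comp_continuous (f := fun x => (x, t)) (by fun_prop)
        fun x => ⟨mem_univ _, ht⟩) ht
    simp only [hm, hN]
    rw [← integral_const_mul, ← integral_const_mul, ← integral_add (hi1.const_mul _)
      (hi2.const_mul _)]
    congr 1; ext x
    rw [deriv_mul_comp_sub hφ hψ, fderiv_mul_comp_sub hψ, map_sub]
    ring
  rw [intervalIntegral.integral_congr hinner] at hweak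
  have hdφ : Continuous (deriv φ) := hφ.continuous_deriv (by simp)
  rw [intervalIntegral.integral_add
    (ContinuousOn.intervalIntegrable (by rw [uIcc_of_le hT.le]; exact hdφ.continuousOn.mul hmc))
    (ContinuousOn.intervalIntegrable
      (by rw [uIcc_of_le hT.le]; exact hφ.continuous.continuousOn.mul hNc))] at hweak
  have hIoc : ∀ {F : ℝ → ℝ}, (∀ t, t ∉ Icc a b → F t = 0) → ∫ t in (0)..T, F t = ∫ t in Icc a b, F t := by
    intro F hF
    rw [intervalIntegral.integral_of_le hT.le, ← integral_Icc_eq_integral_Ioc]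
    exact setIntegral_eq_of_subset_of_forall_sdiff_eq_zero measurableSet_Icc hsub
      fun t ht => hF t ht.2
  rw [hIoc (fun t ht => by rw [hdφ0 t ht, zero_mul]), hIoc (fun t ht => by rw [hφ0 t ht, zero_mul])]
    at hweak
  simp only [smul_eq_mul]
  have hf1 : ∫ t in Icc a b, deriv φ t * f t = ∫ t, deriv φ t * f t :=
    setIntegral_eq_integral_of_forall_compl_eq_zero fun t ht => by rw [hdφ0 t ht, zero_mul]
  have hf2 : ∫ t in Icc a b, φ t * N t = ∫ t, φ t * N t :=
    setIntegral_eq_integral_of_forall_compl_eq_zero fun t ht => by rw [hφ0 t ht, zero_mul]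
  have hfm' : ∫ t in Icc a b, deriv φ t * f t = ∫ t in Icc a b, deriv φ t * m t :=
    setIntegral_congr_fun measurableSet_Icc fun t ht => by
      simp only [hfm t (hsub ht)]
  rw [← hf1, ← hf2, hfm']
  linarith

/-- The rate of change of the smoothed mass of the domain near a uniformly moving point. -/
lemma abs_mass_sub_le_mul {κ a b : ℝ} (ha : 0 ≤ a) (hab : a ≤ b) (hb : b ≤ T)
    (hκ : ∀ t ∈ Icc a b, ‖∫ x, (Ω t).indicator (1 : Plane → ℝ) x *
        fderiv ℝ ψ (x - (c + t • V)) (velocity α Ω x t - V)‖ ≤ κ) :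
    |(∫ x, (Ω b).indicator (1 : Plane → ℝ) x * ψ (x - (c + b • V))) -
      ∫ x, (Ω a).indicator (1 : Plane → ℝ) x * ψ (x - (c + a • V))| ≤ κ * (b - a) := by
  rcases hab.eq_or_lt with rfl | hab
  · simp
  -- The endpoint `b` may equal `T`, so it is reached from the left by continuity of the mass.
  have hlt : ∀ s ∈ Ioo a b, |(∫ x, (Ω s).indicator (1 : Plane → ℝ) x * ψ (x - (c + s • V))) -
      ∫ x, (Ω a).indicator (1 : Plane → ℝ) x * ψ (x - (c + a • V))| ≤ κ * (s - a) := by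
    intro s hs
    refine (H.abs_mass_sub_le hα₀ hα₁ hw hψ hψc c V ha hs.1 (hs.2.trans_le hb)).trans ?_
    have hNc := H.continuousOn_integral (H.continuousOn_flux hα₀ hα₁ hψ c V)
    have := setIntegral_mono_on (μ := volume) (s := Icc a s) (g := fun _ => κ)
      ((hNc.mono (Icc_subset_Icc ha (hs.2.le.trans hb))).norm.integrableOn_Icc)
      (integrableOn_const (by simp)) measurableSet_Icc fun t ht => hκ t ⟨ht.1, ht.2.trans hs.2.le⟩
    refine this.trans_eq ?_
    rw [setIntegral_const, smul_eq_mul, Measure.real, Real.volume_Icc,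
      ENNReal.toReal_ofReal (by linarith [hs.1])]
    ring
  have hc := (H.continuousOn_mass hψ c V b ⟨by linarith, hb⟩).mono_left
    (nhdsWithin_mono b (show Ioo a b ⊆ Icc 0 T from fun s hs => ⟨by linarith [hs.1], by linarith [hs.2]⟩))
  have hne : (𝓝[Ioo a b] b).NeBot := by
    rw [nhdsWithin_Ioo_eq_nhdsLT hab]; infer_instance
  have hlin : Tendsto (fun s => κ * (s - a)) (𝓝[Ioo a b] b) (𝓝 (κ * (b - a))) :=
    ((continuous_const.mul (continuous_id.sub continuous_const)).tendsto b).mono_left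
      nhdsWithin_le_nhds
  exact le_of_tendsto_of_tendsto (hc.sub_const _).abs hlin
    (eventually_mem_nhdsWithin.mono fun s hs => hlt s hs)

end MovingCurve


/-! ### First-order motion of the boundary -/

/-- A smooth bump function at scale `r`. -/
structure IsBump (D r : ℝ) (ψ : Plane → ℝ) : Prop where
  contDiff : ContDiff ℝ ∞ ψ
  hasCompactSupport : HasCompactSupport ψ
  nonneg : ∀ x, 0 ≤ ψ x
  eq_one : ∀ x, ‖x‖ ≤ r / 2 → ψ x = 1
  eq_zero : ∀ x, r < ‖x‖ → ψ x = 0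
  norm_fderiv_le : ∀ x, ‖fderiv ℝ ψ x‖ ≤ D / r

lemma exists_isBump : ∃ D > 0, ∀ r > 0, ∃ ψ, IsBump D r ψ := by
  let B : ContDiffBump (0 : Plane) := ⟨1 / 2, 1, by norm_num, by norm_num⟩
  have hB : ContDiff ℝ ∞ B := B.contDiff
  obtain ⟨D, hD⟩ := (hB.continuous_fderiv (by simp)).bounded_above_of_compact_support
    (B.hasCompactSupport.fderiv (𝕜 := ℝ))
  refine ⟨max D 1, by positivity, fun r hr => ⟨fun x => B (r⁻¹ • x), ?_, ?_, fun x => B.nonneg,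
    fun x hx => ?_, fun x hx => ?_, fun x => ?_⟩⟩
  · exact hB.comp (contDiff_const_smul _)
  · exact B.hasCompactSupport.comp_homeomorph (Homeomorph.smulOfNeZero r⁻¹ (by positivity))
  · apply B.one_of_mem_closedBall
    rw [mem_closedBall_zero_iff, norm_smul, Real.norm_of_nonneg (by positivity), inv_mul_le_iff₀ hr]
    change ‖x‖ ≤ r * (1 / 2)
    linarith
  · apply B.zero_of_le_dist
    rw [dist_zero_right, norm_smul, Real.norm_of_nonneg (by positivity), le_inv_mul_iff₀ hr]
    change r * 1 ≤ ‖x‖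
    linarith
  · have h1 : HasFDerivAt (fun x => B (r⁻¹ • x)) (r⁻¹ • fderiv ℝ B (r⁻¹ • x)) x := by
      have h2 : HasFDerivAt B (fderiv ℝ B (r⁻¹ • x)) (r⁻¹ • x) :=
        (hB.differentiable (by simp) _).hasFDerivAt
      have := h2.comp x ((hasFDerivAt_id x).const_smul r⁻¹)
      rw [ContinuousLinearMap.comp_smul] at this
      exact this
    rw [h1.fderiv, norm_smul, Real.norm_of_nonneg (by positivity), inv_mul_eq_div]
    gcongr
    exact (hD _).trans (le_max_left _ _)

namespace IsBump

variable {D r ρ : ℝ} {ψ : Plane → ℝ} (h : IsBump D r ψ) {Ω : Set Plane} {c p : Plane}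
include h

lemma integrable (c : Plane) : Integrable fun x => ψ (x - c) :=
  (h.contDiff.continuous.integrable_of_hasCompactSupport h.hasCompactSupport).comp_sub_right c

lemma integrable_indicator (hΩ : MeasurableSet Ω) (c : Plane) :
    Integrable fun x => Ω.indicator (1 : Plane → ℝ) x * ψ (x - c) := by
  refine ((integrable_indicator_iff hΩ).2 (h.integrable c).integrableOn).congr
    (Eventually.of_forall fun x => ?_)
  by_cases hx : x ∈ Ω <;> simp [hx]

lemma fderiv_eq_zero {x : Plane} (hx : r < ‖x‖) : fderiv ℝ ψ x = 0 := by
  have : ψ =ᶠ[𝓝 x] fun _ => 0 := by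
    filter_upwards [(isOpen_lt continuous_const continuous_norm).mem_nhds hx] with y hy
    exact h.eq_zero y hy
  rw [this.fderiv_eq]; simp

lemma measureReal_le (hΩ : MeasurableSet Ω) (hS : Metric.closedBall p ρ ⊆ Ω)
    (hSc : Metric.closedBall p ρ ⊆ Metric.closedBall c (r / 2)) :
    volume.real (Metric.closedBall p ρ) ≤ ∫ x, Ω.indicator (1 : Plane → ℝ) x * ψ (x - c) := by
  rw [← integral_indicator_one measurableSet_closedBall]
  refine integral_mono ((integrable_indicator_iff measurableSet_closedBall).2
    (integrableOn_const measure_closedBall_lt_top.ne)) (h.integrable_indicator hΩ c) fun x => ?_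
  by_cases hx : x ∈ Metric.closedBall p ρ
  · have h1 := hSc hx
    rw [mem_closedBall_iff_norm] at h1
    simp only [indicator_of_mem hx, indicator_of_mem (hS hx), h.eq_one _ h1]
    simp
  · simp only [indicator_of_notMem hx]
    exact mul_nonneg (indicator_nonneg (fun _ _ => zero_le_one) _) (h.nonneg _)

lemma le_sub_measureReal (hΩ : MeasurableSet Ω) (hS : Disjoint (Metric.closedBall p ρ) Ω)
    (hSc : Metric.closedBall p ρ ⊆ Metric.closedBall c (r / 2)) :
    ∫ x, Ω.indicator (1 : Plane → ℝ) x * ψ (x - c) ≤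
      (∫ x, ψ (x - c)) - volume.real (Metric.closedBall p ρ) := by
  have h1 := h.measureReal_le hΩ.compl hS.subset_compl_right hSc
  have h2 : (∫ x, ψ (x - c)) = (∫ x, Ωᶜ.indicator (1 : Plane → ℝ) x * ψ (x - c)) +
      ∫ x, Ω.indicator (1 : Plane → ℝ) x * ψ (x - c) := by
    rw [← integral_add (h.integrable_indicator hΩ.compl c) (h.integrable_indicator hΩ c)]
    congr 1; ext x
    by_cases hx : x ∈ Ω <;> simp [hx]
  linarith

lemma integral_eq_of_subset (hS : Metric.closedBall c r ⊆ Ω) :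
    ∫ x, Ω.indicator (1 : Plane → ℝ) x * ψ (x - c) = ∫ x, ψ (x - c) := by
  congr 1; ext x
  by_cases hx : x ∈ Metric.closedBall c r
  · simp [hS hx]
  · rw [mem_closedBall_iff_norm, not_le] at hx
    rw [h.eq_zero _ hx, mul_zero]

lemma integral_eq_zero_of_disjoint (hS : Disjoint (Metric.closedBall c r) Ω) :
    ∫ x, Ω.indicator (1 : Plane → ℝ) x * ψ (x - c) = 0 := by
  rw [← integral_zero Plane ℝ]
  congr 1; ext x
  by_cases hx : x ∈ Metric.closedBall c r
  · simp [disjoint_left.1 hS hx]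
  · rw [mem_closedBall_iff_norm, not_le] at hx
    rw [h.eq_zero _ hx, mul_zero]

lemma norm_integral_fderiv_le (hD : 0 < D) (hr : 0 < r) {u : Plane → Plane} {η : ℝ}
    (hu : ∀ x ∈ Metric.closedBall c r, ‖u x‖ ≤ η) :
    ‖∫ x, Ω.indicator (1 : Plane → ℝ) x * fderiv ℝ ψ (x - c) (u x)‖ ≤
      D / r * η * volume.real (Metric.closedBall c r) := by
  have hη : 0 ≤ η := (norm_nonneg _).trans (hu c (Metric.mem_closedBall_self hr.le))
  have h1 : ∫ x, (Metric.closedBall c r).indicator (fun _ => D / r * η) x =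
      D / r * η * volume.real (Metric.closedBall c r) := by
    rw [integral_indicator measurableSet_closedBall, setIntegral_const, smul_eq_mul, mul_comm]
  rw [← h1]
  refine norm_integral_le_of_norm_le ((integrable_indicator_iff measurableSet_closedBall).2
    (integrableOn_const measure_closedBall_lt_top.ne)) (Eventually.of_forall fun x => ?_)
  by_cases hx : x ∈ Metric.closedBall c r
  · rw [indicator_of_mem hx, norm_mul]
    have e1 : ‖Ω.indicator (1 : Plane → ℝ) x‖ ≤ 1 := by
      by_cases hxΩ : x ∈ Ω <;> simp [hxΩ]
    calc _ ≤ 1 * (‖fderiv ℝ ψ (x - c)‖ * ‖u x‖) :=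
          mul_le_mul e1 (ContinuousLinearMap.le_opNorm _ _) (norm_nonneg _) zero_le_one
      _ ≤ 1 * (D / r * η) := by
          gcongr
          · exact h.norm_fderiv_le _
          · exact hu x hx
      _ = _ := one_mul _
  · rw [indicator_of_notMem hx]
    rw [mem_closedBall_iff_norm, not_le] at hx
    rw [h.fderiv_eq_zero hx]; simp

end IsBump

/-- On this ball the distance to `P` is at most `5r/16` and the height along `e` is at least
`3r/16`, more than half of it. -/
lemma closedBall_subset_cone {P e : Plane} {δ r : ℝ} (he : ‖e‖ = 1) (hr : 0 < r) (hrδ : r < δ) :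
    Metric.closedBall (P + (r / 4) • e) (r / 16) ⊆ cone P e δ := by
  intro X hX
  rw [mem_closedBall_iff_norm] at hX
  set y := X - (P + (r / 4) • e) with hy
  have e1 : X - P = (r / 4) • e + y := by rw [hy]; abel
  have e2 : ‖(r / 4) • e‖ = r / 4 := by rw [norm_smul, he, mul_one, Real.norm_of_nonneg (by linarith)]
  have e3 : ‖X - P‖ ≤ r / 4 + r / 16 := by
    rw [e1]; exact (norm_add_le _ _).trans (by rw [e2]; linarith)
  have e4 : r / 4 - r / 16 ≤ inner ℝ e (X - P) := by
    rw [e1, inner_add_right, inner_smul_right, real_inner_self_eq_norm_sq, he]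
    have := neg_le_of_abs_le (abs_real_inner_le_norm e y)
    rw [he] at this
    linarith
  exact ⟨by linarith, by linarith⟩

namespace MovingCurve

variable {α β M ℓ T : ℝ} {Ω : ℝ → Set Plane} {L : ℝ → ℝ} {Γ : ℝ → ℝ → Plane}
  (H : MovingCurve β M ℓ T Ω L Γ) (hα₀ : 0 < α) (hα₁ : α < 1 / 2)
include H hα₀ hα₁

lemma exists_modulus {t₀ : ℝ} (ht₀ : t₀ ∈ Icc 0 T) {η : ℝ} (hη : 0 < η) :
    ∃ ρ > 0, ∀ P ∈ frontier (Ω t₀), ∀ t ∈ Icc 0 T, |t - t₀| < ρ → ∀ x, ‖x - P‖ < ρ →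
      ‖velocity α Ω x t - velocity α Ω P t₀‖ ≤ η := by
  obtain ⟨R, hR, hRΩ⟩ := H.exists_bound
  have hK : IsCompact (Metric.closedBall (0 : Plane) (R + 1) ×ˢ Icc 0 T) :=
    (isCompact_closedBall _ _).prod isCompact_Icc
  have hu := hK.uniformContinuousOn_of_continuous
    ((H.continuousOn_velocity hα₀ hα₁).mono (prod_mono (subset_univ _) subset_rfl))
  obtain ⟨ρ, hρ, hρu⟩ := Metric.uniformContinuousOn_iff.1 hu η hη
  refine ⟨min ρ 1, by positivity, fun P hP t ht htρ x hx => ?_⟩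
  have hPR : ‖P‖ ≤ R := hRΩ t₀ ht₀ P (frontier_subset_closure hP)
  have hxR : ‖x‖ ≤ R + 1 := by
    have := norm_add_le (x - P) P
    rw [sub_add_cancel] at this
    linarith [min_le_right ρ 1]
  have := hρu (x, t) ⟨by simpa using hxR, ht⟩ (P, t₀) ⟨by simp; linarith, ht₀⟩ (by
    rw [Prod.dist_eq, max_lt_iff, dist_eq_norm, Real.dist_eq]
    exact ⟨hx.trans_le (min_le_left _ _), htρ.trans_le (min_le_left _ _)⟩)
  rw [dist_eq_norm] at this
  exact this.le

/-- The boundary of an `α`-patch moves with the velocity field, to first order. -/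
lemma eventually_motion (hw : IsAlphaPatch α T Ω) {t₀ : ℝ} (ht₀ : t₀ ∈ Icc 0 T) {ε : ℝ} (hε : 0 < ε) :
    ∀ᶠ h in 𝓝 (0 : ℝ), t₀ + h ∈ Icc 0 T → ∀ P ∈ frontier (Ω t₀), ∃ Q ∈ frontier (Ω (t₀ + h)),
      ‖Q - P - h • velocity α Ω P t₀‖ ≤ ε * |h| := by
  obtain ⟨D, hD, hψ⟩ := exists_isBump
  obtain ⟨δ, hδ, hδℓ, hac⟩ := H.exists_uniform_arcChord (ht₀.1.trans ht₀.2)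
  -- With `η = ε / (512 D)` and `r = ε|h|`, the total flux during time `|h|` is at most `r²ν/512`,
  -- half the area `r²ν/256` of a disc of radius `r/16`, where `ν` is the area of the unit disc.
  obtain ⟨ρ, hρ, hmod⟩ := H.exists_modulus hα₀ hα₁ ht₀ (η := ε / (512 * D)) (by positivity)
  obtain ⟨R, hR, hRΩ⟩ := H.exists_bound
  obtain ⟨B, hB⟩ : ∃ B, ∀ P ∈ frontier (Ω t₀), ‖velocity α Ω P t₀‖ ≤ B := by
    refine (H.curve t₀ ht₀).isCompact_frontier.exists_bound_of_continuousOn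
      (((H.continuousOn_velocity hα₀ hα₁).comp_continuous (f := fun x => (x, t₀)) (by fun_prop)
        fun x => ⟨mem_univ _, ht₀⟩).continuousOn)
  have hB0 : 0 ≤ B := by
    obtain ⟨P, hP⟩ := (H.curve t₀ ht₀).nonempty_frontier
    exact (norm_nonneg _).trans (hB P hP)
  have hsm1 : ∀ᶠ h in 𝓝 (0 : ℝ), |h| * (B + ε + 1) < ρ := by
    have : Tendsto (fun h : ℝ => |h| * (B + ε + 1)) (𝓝 0) (𝓝 (|0| * (B + ε + 1))) :=
      (continuous_abs.mul continuous_const).tendsto 0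
    rw [abs_zero, zero_mul] at this
    exact this.eventually_lt_const hρ
  have hsm2 : ∀ᶠ h in 𝓝 (0 : ℝ), ε * |h| < δ := by
    have : Tendsto (fun h : ℝ => ε * |h|) (𝓝 0) (𝓝 (ε * |0|)) :=
      (continuous_const.mul continuous_abs).tendsto 0
    rw [abs_zero, mul_zero] at this
    exact this.eventually_lt_const hδ
  filter_upwards [hsm1, hsm2] with h hh1 hh2 hth P hP
  rcases eq_or_ne h 0 with rfl | hh0
  · exact ⟨P, by simpa using hP, by simp⟩
  have hhp : 0 < |h| := abs_pos.2 hh0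
  by_contra! hcon
  -- If the claim fails, the ball of radius `r` about `P + h • V` misses the boundary at time `t₀ +
  -- h`, so the mass under the bump is zero or full. At time `t₀` each normal cone at `P` contains a
  -- disc of radius `r/16` on which the bump equals `1`, so the mass was away from both extremes.
  set r := ε * |h| with hr
  have hr0 : 0 < r := by positivity
  obtain ⟨ψ, hψr⟩ := hψ r hr0
  set V := velocity α Ω P t₀ with hV
  set c := P - t₀ • V with hc
  have hct : ∀ t, c + t • V = P + (t - t₀) • V := fun t => by rw [hc, sub_smul]; abel
  have hVB : ‖V‖ ≤ B := hB P hP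
  set ν := volume.real (Metric.ball (0 : Plane) 1) with hν
  have hν0 : 0 < ν := 
    ENNReal.toReal_pos (Metric.measure_ball_pos _ _ one_pos).ne' measure_ball_lt_top.ne
  have hvol : ∀ (p : Plane) {q : ℝ}, 0 ≤ q → volume.real (Metric.closedBall p q) = q ^ 2 * ν := by
    intro p q hq
    have := Measure.addHaar_real_closedBall (volume : Measure Plane) p hq
    rwa [finrank_euclideanSpace_fin] at this
  -- the flux is small
  have hflux : ∀ t ∈ uIcc t₀ (t₀ + h), ‖∫ x, (Ω t).indicator (1 : Plane → ℝ) x *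
      fderiv ℝ ψ (x - (c + t • V)) (velocity α Ω x t - V)‖ ≤
      D / r * (ε / (512 * D)) * (r ^ 2 * ν) := by
    intro t ht
    have htT : t ∈ Icc 0 T := (uIcc_subset_Icc ht₀ hth) ht
    have hth' : |t - t₀| ≤ |h| := by
      have := abs_sub_left_of_mem_uIcc ht
      rwa [add_sub_cancel_left] at this
    rw [← hvol (c + t • V) hr0.le]
    refine hψr.norm_integral_fderiv_le hD hr0 fun x hx => ?_
    refine hmod P hP t htT ?_ x ?_
    · nlinarith
    · rw [mem_closedBall_iff_norm, hct] at hx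
      have e : x - P = (x - (P + (t - t₀) • V)) + (t - t₀) • V := by abel
      have e2 : ‖(t - t₀) • V‖ ≤ |h| * B := by
        rw [norm_smul, Real.norm_eq_abs]; gcongr
      rw [e]
      refine (norm_add_le _ _).trans_lt ?_
      nlinarith
  have hmass : |(∫ x, (Ω (t₀ + h)).indicator (1 : Plane → ℝ) x * ψ (x - (c + (t₀ + h) • V))) -
      ∫ x, (Ω t₀).indicator (1 : Plane → ℝ) x * ψ (x - (c + t₀ • V))| ≤
      D / r * (ε / (512 * D)) * (r ^ 2 * ν) * |h| := by
    rcases le_total 0 h with h0 | h0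
    · rw [uIcc_of_le (by linarith)] at hflux
      have := H.abs_mass_sub_le_mul hα₀ hα₁ hw hψr.contDiff hψr.hasCompactSupport c V ht₀.1
        (by linarith) hth.2 hflux
      rw [add_sub_cancel_left] at this
      rwa [abs_of_nonneg h0]
    · rw [uIcc_of_ge (by linarith)] at hflux
      have := H.abs_mass_sub_le_mul hα₀ hα₁ hw hψr.contDiff hψr.hasCompactSupport c V hth.1
        (by linarith) ht₀.2 hflux
      rw [sub_add_cancel_left] at this
      rwa [abs_of_nonpos h0, abs_sub_comm]
  have hval : D / r * (ε / (512 * D)) * (r ^ 2 * ν) * |h| = r ^ 2 * ν / 512 := by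
    rw [hr]; field_simp
  rw [hval] at hmass
  -- the density of the domain at a boundary point
  have h₀ := H.curve t₀ ht₀
  have hac₀ := hac t₀ ht₀
  obtain ⟨s, rfl⟩ := h₀.exists_eq hP
  set n := perp (deriv (Γ t₀) s) with hn
  have hnn : ‖n‖ = 1 := h₀.norm_perp_deriv s
  have hc0 : c + t₀ • V = Γ t₀ s := by rw [hct, sub_self, zero_smul, add_zero]
  have hch : c + (t₀ + h) • V = Γ t₀ s + h • V := by rw [hct, add_sub_cancel_left]
  rw [hc0, hch] at hmass
  have hsub : ∀ e : Plane, ‖e‖ = 1 → Metric.closedBall (Γ t₀ s + (r / 4) • e) (r / 16) ⊆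
      Metric.closedBall (Γ t₀ s) (r / 2) := fun e he => by
    refine Metric.closedBall_subset_closedBall' ?_
    rw [dist_self_add_left, norm_smul, he, mul_one, Real.norm_of_nonneg (by positivity)]
    linarith
  have hnn' : ‖-n‖ = 1 := by rw [norm_neg, hnn]
  have hlow := hψr.measureReal_le (H.patch t₀ ht₀).isOpen.measurableSet
    ((closedBall_subset_cone hnn hr0 hh2).trans (h₀.upper_cone_subset hδ hδℓ hac₀ s)) (hsub n hnn)
  have hupp := hψr.le_sub_measureReal (H.patch t₀ ht₀).isOpen.measurableSet
    (disjoint_left.2 fun X hX => h₀.lower_cone_disjoint hδ hδℓ hac₀ (H.patch t₀ ht₀)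
      (closedBall_subset_cone hnn' hr0 hh2 hX)) (hsub (-n) hnn')
  rw [hvol _ (by positivity)] at hlow hupp
  have htrans : ∫ x, ψ (x - (Γ t₀ s + h • V)) = ∫ x, ψ (x - Γ t₀ s) := by
    rw [integral_sub_right_eq_self (μ := volume) ψ, integral_sub_right_eq_self (μ := volume) ψ]
  have hfar : ∀ x ∈ Metric.closedBall (Γ t₀ s + h • V) r, x ∉ frontier (Ω (t₀ + h)) := by
    intro x hx hxf
    have := hcon x hxf
    rw [mem_closedBall_iff_norm, ← sub_sub] at hx
    linarith
  have hcc : ∀ {x y : Plane}, x ∈ Metric.closedBall (Γ t₀ s + h • V) r →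
      y ∈ Metric.closedBall (Γ t₀ s + h • V) r → (x ∈ Ω (t₀ + h) ↔ y ∈ Ω (t₀ + h)) := fun hx hy =>
    mem_iff_mem_of_isPreconnected (convex_closedBall _ _).isPreconnected hfar hx hy
  have hcm : Γ t₀ s + h • V ∈ Metric.closedBall (Γ t₀ s + h • V) r :=
    Metric.mem_closedBall_self hr0.le
  have hpos : 0 < r ^ 2 * ν := by positivity
  by_cases hin : Γ t₀ s + h • V ∈ Ω (t₀ + h)
  · rw [hψr.integral_eq_of_subset fun x hx => (hcc hcm hx).1 hin, htrans] at hmass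
    have := le_of_abs_le hmass
    nlinarith
  · rw [hψr.integral_eq_zero_of_disjoint (disjoint_left.2 fun x hx hxΩ => hin ((hcc hcm hx).2 hxΩ))]
      at hmass
    have := neg_le_of_abs_le hmass
    nlinarith

end MovingCurve


/-! ### Invariance of the moving curve -/

/-- A family of curves transported by a velocity field. -/
structure FlowFamily (T σ K : ℝ) (C : ℝ → Set Plane) (v : Plane → ℝ → Plane) : Prop where
  σ_pos : 0 < σ
  field : ∀ t ∈ Icc 0 T, CurveField σ K (C t) fun x => v x t
  bound : ∃ R, ∀ t ∈ Icc 0 T, ∀ P ∈ C t, ‖P‖ ≤ R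
  continuousOn : ContinuousOn (fun q : Plane × ℝ => v q.1 q.2) (univ ×ˢ Icc 0 T)
  near : ∀ t ∈ Icc 0 T, ∀ η > 0, ∀ᶠ s in 𝓝[Icc 0 T] t,
    (∀ P ∈ C t, ∃ Q ∈ C s, ‖Q - P‖ ≤ η) ∧ ∀ Q ∈ C s, ∃ P ∈ C t, ‖Q - P‖ ≤ η
  motion : ∀ t ∈ Icc 0 T, ∀ ε > 0, ∀ᶠ h in 𝓝 (0 : ℝ), t + h ∈ Icc 0 T →
    ∀ P ∈ C t, ∃ Q ∈ C (t + h), ‖Q - P - h • v P t‖ ≤ ε * |h|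

lemma CurveField.neg {σ K : ℝ} {C : Set Plane} {v : Plane → Plane} (h : CurveField σ K C v) :
    CurveField σ K C fun x => -v x where
  one_le := h.one_le
  isCompact := h.isCompact
  nonempty := h.nonempty
  lip P hP Q hQ := by
    rw [neg_sub_neg, norm_sub_rev]
    exact h.lip P hP Q hQ
  jet := by
    obtain ⟨A, hA, hA'⟩ := h.jet
    refine ⟨fun x => -A x, fun P hP => by rw [norm_neg]; exact hA P hP, fun P hP Q hQ => ⟨?_, ?_⟩⟩
    · rw [neg_sub_neg, norm_sub_rev]
      exact (hA' P hP Q hQ).1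
    · rw [← norm_neg]
      refine le_of_eq_of_le (congrArg _ ?_) (hA' P hP Q hQ).2
      rw [neg_apply]
      abel
  normal X := by
    obtain ⟨P, hP, hPX, u, hu, hu'⟩ := h.normal X
    refine ⟨P, hP, hPX, -u, ?_, fun ε hε => ?_⟩
    · rw [← norm_neg]
      refine le_of_eq_of_le (congrArg _ ?_) hu
      abel
    · have h0 : Tendsto (fun h : ℝ => -h) (𝓝 0) (𝓝 0) := by
        simpa using (continuous_neg.tendsto (0 : ℝ))
      filter_upwards [h0.eventually (hu' ε hε)] with r hr
      simpa using hr

namespace FlowFamily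

variable {T σ K : ℝ} {C : ℝ → Set Plane} {v : Plane → ℝ → Plane} (F : FlowFamily T σ K C v)
include F

/-- The first-order motion holds for both signs of `h` and the field conditions are invariant under
change of sign. Every forward estimate therefore has a backward counterpart. -/
lemma reverse {t₁ : ℝ} (ht₁ : t₁ ∈ Icc 0 T) :
    FlowFamily t₁ σ K (fun s => C (t₁ - s)) (fun x s => -v x (t₁ - s)) := by
  have hmem : ∀ {s}, s ∈ Icc 0 t₁ → t₁ - s ∈ Icc 0 T := fun hs =>
    ⟨by linarith [hs.2], by linarith [hs.1, ht₁.2]⟩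
  refine ⟨F.σ_pos, fun s hs => (F.field _ (hmem hs)).neg, ?_, ?_, fun s hs η hη => ?_,
    fun s hs ε hε => ?_⟩
  · obtain ⟨R, hR⟩ := F.bound
    exact ⟨R, fun s hs => hR _ (hmem hs)⟩
  · refine (F.continuousOn.comp (f := fun q : Plane × ℝ => (q.1, t₁ - q.2))
      (Continuous.continuousOn (by fun_prop)) fun q hq => ⟨mem_univ _, hmem hq.2⟩).neg
  · have : Tendsto (fun r => t₁ - r) (𝓝[Icc 0 t₁] s) (𝓝[Icc 0 T] (t₁ - s)) :=
      tendsto_nhdsWithin_iff.2 ⟨((continuous_const.sub continuous_id).tendsto s).mono_left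
        nhdsWithin_le_nhds, eventually_mem_nhdsWithin.mono fun r hr => hmem hr⟩
    exact this.eventually (F.near _ (hmem hs) η hη)
  · have h0 : Tendsto (fun h : ℝ => -h) (𝓝 0) (𝓝 0) := by
      simpa using (continuous_neg.tendsto (0 : ℝ))
    filter_upwards [h0.eventually (F.motion _ (hmem hs) ε hε)] with h hh hsh P hP
    have e : t₁ - s + -h = t₁ - (s + h) := by ring
    rw [e] at hh
    obtain ⟨Q, hQ, hQP⟩ := hh (hmem hsh) P hP
    exact ⟨Q, hQ, by simpa using hQP⟩

lemma exists_norm_le : ∃ B > 0, ∀ t ∈ Icc 0 T, ∀ P ∈ C t, ‖v P t‖ ≤ B := by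
  obtain ⟨R, hR⟩ := F.bound
  obtain ⟨B, hB⟩ := ((isCompact_closedBall (0 : Plane) R).prod
    (isCompact_Icc (a := (0 : ℝ)) (b := T))).exists_bound_of_continuousOn
      (F.continuousOn.mono (prod_mono (subset_univ _) subset_rfl))
  refine ⟨max B 1, by positivity, fun t ht P hP => ?_⟩
  exact (hB (P, t) ⟨by simpa using hR t ht P hP, ht⟩).trans (le_max_left _ _)

lemma abs_infDist_sub_le {s t η : ℝ} (hs : s ∈ Icc 0 T) (ht : t ∈ Icc 0 T)
    (h : (∀ P ∈ C t, ∃ Q ∈ C s, ‖Q - P‖ ≤ η) ∧ ∀ Q ∈ C s, ∃ P ∈ C t, ‖Q - P‖ ≤ η) (X Y : Plane) :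
    |Metric.infDist Y (C s) - Metric.infDist X (C t)| ≤ η + ‖Y - X‖ := by
  have h1 : Metric.infDist Y (C s) ≤ Metric.infDist X (C t) + (η + ‖Y - X‖) := by
    obtain ⟨P, hP, hPX⟩ := (F.field t ht).isCompact.exists_infDist_eq_dist (F.field t ht).nonempty X
    obtain ⟨Q, hQ, hQP⟩ := h.1 P hP
    refine (Metric.infDist_le_dist_of_mem hQ).trans ?_
    rw [hPX, dist_eq_norm, dist_eq_norm]
    have e : Y - Q = (Y - X) + (X - P) - (Q - P) := by abel
    rw [e]
    linarith [norm_sub_le ((Y - X) + (X - P)) (Q - P), norm_add_le (Y - X) (X - P)]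
  have h2 : Metric.infDist X (C t) ≤ Metric.infDist Y (C s) + (η + ‖Y - X‖) := by
    obtain ⟨Q, hQ, hQX⟩ := (F.field s hs).isCompact.exists_infDist_eq_dist (F.field s hs).nonempty Y
    obtain ⟨P, hP, hQP⟩ := h.2 Q hQ
    refine (Metric.infDist_le_dist_of_mem hP).trans ?_
    rw [hQX, dist_eq_norm, dist_eq_norm]
    have e : X - P = (Y - Q) + (Q - P) - (Y - X) := by abel
    rw [e]
    linarith [norm_sub_le ((Y - Q) + (Q - P)) (Y - X), norm_add_le (Y - Q) (Q - P)]
  rw [abs_le]; constructor <;> linarith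

lemma continuousOn_infDist {X : ℝ → Plane} (hX : ContinuousOn X (Icc 0 T)) :
    ContinuousOn (fun t => Metric.infDist (X t) (C t)) (Icc 0 T) := by
  intro t ht
  rw [ContinuousWithinAt, Metric.tendsto_nhds]
  intro ε hε
  have hXt := Metric.tendsto_nhds.1 (hX t ht) (ε / 2) (by positivity)
  filter_upwards [hXt, F.near t ht (ε / 2) (by positivity), eventually_mem_nhdsWithin]
    with s hs1 hs2 hs
  rw [dist_eq_norm] at hs1
  rw [Real.dist_eq]
  linarith [F.abs_infDist_sub_le hs ht hs2 (X t) (X s)]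

/-- Invariance of the moving curve: a trajectory that starts on the curve and follows the velocity
at the nearest point of the curve, up to a tangential term and an error controlled by the distance
to the curve, stays on the curve. -/
lemma mem_of_hasDerivWithinAt {X X' : ℝ → Plane} {κ : ℝ}
    (hX : ∀ t ∈ Icc 0 T, HasDerivWithinAt X (X' t) (Icc 0 T) t) (h0 : X 0 ∈ C 0)
    (hn : ∀ t ∈ Icc 0 T, ∃ P ∈ C t, ‖X t - P‖ = Metric.infDist (X t) (C t) ∧ ∃ u : Plane,
      ‖X' t - v P t - u‖ ≤ κ * Metric.infDist (X t) (C t) ∧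
        ∀ ε > 0, ∀ᶠ h in 𝓝 (0 : ℝ), ∃ P' ∈ C t, ‖P' - P - h • u‖ ≤ ε * |h|) :
    ∀ t ∈ Icc 0 T, X t ∈ C t := by
  set f : ℝ → ℝ := fun t => Metric.infDist (X t) (C t) with hf
  -- The distance to the curve satisfies `f' ≤ κ f` in the sense of lower right derivatives and
  -- starts at zero.
  have hgr := le_gronwallBound_of_liminf_deriv_right_le (f := f) (f' := fun t => κ * f t)
    (δ := 0) (K := κ) (ε := 0) (a := 0) (b := T)
    (F.continuousOn_infDist fun t ht => (hX t ht).continuousWithinAt) (fun t ht r hr => ?_)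
    (by rw [hf]; exact (Metric.infDist_zero_of_mem h0).le) (fun t _ => by rw [add_zero])
  · intro t ht
    have h1 := hgr t ht
    rw [gronwallBound_ε0_δ0] at h1
    exact ((F.field t ht).isCompact.isClosed.mem_iff_infDist_zero (F.field t ht).nonempty).2
      (le_antisymm h1 Metric.infDist_nonneg)
  · have htT : t ∈ Icc 0 T := ⟨ht.1, ht.2.le⟩
    obtain ⟨P, hP, hPX, u, hu, hu'⟩ := hn t htT
    have hK := (F.field t htT).one_le
    -- Four errors of size `e * h` occur: in the derivative of `X`, the tangential shift, the motion
    -- of the curve, and the change of `v` between `P` and `P'`. The fifth share keeps the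
    -- inequality strict.
    set e := (r - κ * f t) / 5 with he
    have he0 : 0 < e := by
      have : 0 < r - κ * f t := sub_pos.2 hr
      positivity
    have hsub : Tendsto (fun z : ℝ => z - t) (𝓝[>] t) (𝓝 0) := by
      have : Tendsto (fun z : ℝ => z - t) (𝓝 t) (𝓝 (t - t)) :=
        (continuous_id.sub continuous_const).tendsto t
      rw [sub_self] at this
      exact this.mono_left nhdsWithin_le_nhds
    have hIcc : ∀ᶠ z in 𝓝[>] t, z ∈ Icc 0 T := by
      filter_upwards [Ioo_mem_nhdsGT ht.2] with z hz using ⟨ht.1.trans hz.1.le, hz.2.le⟩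
    have hsm : ∀ᶠ h in 𝓝 (0 : ℝ), K * ((‖u‖ + e) * |h|) < e := by
      have : Tendsto (fun h : ℝ => K * ((‖u‖ + e) * |h|)) (𝓝 0) (𝓝 (K * ((‖u‖ + e) * |0|))) :=
        Continuous.tendsto (by fun_prop) 0
      rw [abs_zero, mul_zero, mul_zero] at this
      exact this.eventually_lt_const he0
    have hder : ∀ᶠ z in 𝓝[Icc 0 T] t, ‖X z - X t - (z - t) • X' t‖ ≤ e * ‖z - t‖ :=
      (hasDerivWithinAt_iff_isLittleO.1 (hX t htT)).def he0
    have hder' : ∀ᶠ z in 𝓝[>] t, ‖X z - X t - (z - t) • X' t‖ ≤ e * ‖z - t‖ :=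
      (tendsto_nhdsWithin_iff.2 ⟨tendsto_id.mono_left nhdsWithin_le_nhds, hIcc⟩).eventually hder
    refine Eventually.frequently ?_
    filter_upwards [self_mem_nhdsWithin, hIcc, hder', hsub.eventually hsm,
      hsub.eventually (hu' e he0), hsub.eventually (F.motion t htT e he0)]
      with z hz hzT hz1 hz2 hz3 hz4
    have hh : 0 < z - t := sub_pos.2 hz
    rw [add_sub_cancel] at hz4
    -- The comparison point is reached in two moves: from `P` to `P'` within the curve at time `t`,
    -- absorbing `u`, then from `P'` to `Q` with the moving curve.
    obtain ⟨P', hP', hP'u⟩ := hz3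
    obtain ⟨Q, hQ, hQP⟩ := hz4 hzT P' hP'
    rw [Real.norm_eq_abs] at hz1
    rw [abs_of_pos hh] at hz1 hz2 hP'u hQP
    set h := z - t with hhd
    have hPP : ‖P' - P‖ ≤ (‖u‖ + e) * h := by
      have e1 : P' - P = (P' - P - h • u) + h • u := by abel
      rw [e1]
      refine (norm_add_le _ _).trans ?_
      rw [norm_smul, Real.norm_of_nonneg hh.le]
      linarith
    have hvP : ‖v P' t - v P t‖ ≤ e := by
      refine ((F.field t htT).lip P hP P' hP').trans (le_trans ?_ hz2.le)
      gcongr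
    have hdist : f z ≤ f t + h * (κ * f t + 4 * e) := by
      refine (Metric.infDist_le_dist_of_mem hQ).trans ?_
      rw [dist_eq_norm]
      have e1 : X z - Q = (X z - X t - h • X' t) + (X t - P) + h • (X' t - v P t - u) -
          (P' - P - h • u) - (Q - P' - h • v P' t) - h • (v P' t - v P t) := by module
      rw [e1]
      have n1 := norm_sub_le ((X z - X t - h • X' t) + (X t - P) + h • (X' t - v P t - u) -
          (P' - P - h • u) - (Q - P' - h • v P' t)) (h • (v P' t - v P t))
      have n2 := norm_sub_le ((X z - X t - h • X' t) + (X t - P) + h • (X' t - v P t - u) -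
          (P' - P - h • u)) (Q - P' - h • v P' t)
      have n3 := norm_sub_le ((X z - X t - h • X' t) + (X t - P) + h • (X' t - v P t - u))
          (P' - P - h • u)
      have n4 := norm_add₃_le (a := X z - X t - h • X' t) (b := X t - P)
        (c := h • (X' t - v P t - u))
      have n5 : ‖h • (X' t - v P t - u)‖ ≤ h * (κ * f t) := by
        rw [norm_smul, Real.norm_of_nonneg hh.le]; gcongr
      have n6 : ‖h • (v P' t - v P t)‖ ≤ h * e := by
        rw [norm_smul, Real.norm_of_nonneg hh.le]; gcongr
      have n7 : ‖X t - P‖ = f t := hPX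
      linarith
    rw [inv_mul_lt_iff₀ hh]
    have hr' : r = κ * f t + 5 * e := by rw [he]; ring
    rw [hr']
    nlinarith

/-- Solutions of the flow equation that start on the curve stay on the curve. -/
lemma mem_of_flow {X : ℝ → Plane} (hX : ∀ t ∈ Icc 0 T, HasDerivWithinAt X (v (X t) t) (Icc 0 T) t)
    (h0 : X 0 ∈ C 0) : ∀ t ∈ Icc 0 T, X t ∈ C t := by
  intro t ht
  exact F.mem_of_hasDerivWithinAt (κ := K) hX h0
    (fun t ht => (F.field t ht).normal (X t)) t ht

end FlowFamily


/-! ### Existence of trajectories by Lipschitz extension -/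

lemma norm_le_abs_add_abs (X : Plane) : ‖X‖ ≤ |X 0| + |X 1| := by
  have h := norm_sq_plane X
  refine abs_le_of_sq_le_sq' ?_ (by positivity) |>.2
  rw [h, add_sq, sq_abs, sq_abs]
  nlinarith [mul_nonneg (abs_nonneg (X 0)) (abs_nonneg (X 1))]

/-- The McShane extension of a `κ`-Lipschitz function on `C`. -/
noncomputable def lipExt (κ : ℝ) (C : Set Plane) (g : Plane → ℝ) (X : Plane) : ℝ :=
  ⨅ P : C, (g P + κ * ‖X - P‖)

/-- One comparison of infima serves twice: with the same curve it gives the Lipschitz bound in `X`,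
with curves at two times it gives continuity in time. -/
lemma lipExt_le {κ B e₁ e₂ : ℝ} (hκ : 0 ≤ κ) {C C' : Set Plane} (hC' : C'.Nonempty)
    {g g' : Plane → ℝ} (hg : ∀ P ∈ C, -B ≤ g P)
    (h : ∀ Q ∈ C', ∃ P ∈ C, g P ≤ g' Q + e₁ ∧ ‖Q - P‖ ≤ e₂) (X X' : Plane) :
    lipExt κ C g X ≤ lipExt κ C' g' X' + (e₁ + κ * (e₂ + ‖X - X'‖)) := by
  have := hC'.to_subtype
  rw [← sub_le_iff_le_add]
  refine le_ciInf fun Q => ?_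
  obtain ⟨P, hP, h1, h2⟩ := h Q Q.2
  have hbdd : BddBelow (range fun P : C => g P + κ * ‖X - P‖) := by
    refine ⟨-B, ?_⟩
    rintro _ ⟨P, rfl⟩
    have := hg P P.2
    have : 0 ≤ κ * ‖X - P‖ := by positivity
    simp only
    linarith
  have h3 : lipExt κ C g X ≤ g P + κ * ‖X - P‖ := ciInf_le hbdd ⟨P, hP⟩
  have h4 : ‖X - P‖ ≤ ‖X' - Q‖ + (e₂ + ‖X - X'‖) := by
    have e : X - P = (X - X') + (X' - Q) + (Q - P) := by abel
    rw [e]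
    linarith [norm_add₃_le (a := X - X') (b := X' - (Q : Plane)) (c := Q - P)]
  have h5 : κ * ‖X - P‖ ≤ κ * (‖X' - Q‖ + (e₂ + ‖X - X'‖)) := by gcongr
  linarith

lemma lipExt_eq {κ : ℝ} {C : Set Plane} {g : Plane → ℝ}
    (hg : ∀ P ∈ C, ∀ Q ∈ C, g Q ≤ g P + κ * ‖Q - P‖) {X : Plane} (hX : X ∈ C) :
    lipExt κ C g X = g X := by
  have : Nonempty C := ⟨⟨X, hX⟩⟩
  refine le_antisymm ?_ (le_ciInf fun P => hg P P.2 X hX)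
  have := ciInf_le (f := fun P : C => g P + κ * ‖X - P‖) ⟨g X, by
    rintro _ ⟨P, rfl⟩
    exact hg P P.2 X hX⟩ ⟨X, hX⟩
  simpa [lipExt] using this

/-- Truncation of a real number to the interval `[-B, B]`. -/
noncomputable def clip (B a : ℝ) : ℝ := max (-B) (min B a)

lemma abs_clip_le {B : ℝ} (hB : 0 ≤ B) (a : ℝ) : |clip B a| ≤ B :=
  abs_le.2 ⟨le_max_left _ _, max_le (by linarith) (min_le_left _ _)⟩

lemma abs_clip_sub_le (B a b : ℝ) : |clip B a - clip B b| ≤ |a - b| := by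
  unfold clip
  refine (abs_max_sub_max_le_max _ _ _ _).trans ?_
  rw [sub_self, abs_zero]
  refine max_le (abs_nonneg _) ((abs_min_sub_min_le_max _ _ _ _).trans ?_)
  rw [sub_self, abs_zero]
  exact max_le (abs_nonneg _) le_rfl

lemma clip_eq {B a : ℝ} (h : |a| ≤ B) : clip B a = a := by
  rw [abs_le] at h
  rw [clip, min_eq_right h.2, max_eq_right h.1]

namespace FlowFamily

variable {T σ K : ℝ} {C : ℝ → Set Plane} {v : Plane → ℝ → Plane} (F : FlowFamily T σ K C v)
include F

/-- The velocity is known to be Lipschitz only along the curve, so Picard-Lindelöf is applied to the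
clipped coordinatewise McShane extension `w`. Since `w` is Lipschitz in the plane, its trajectory
meets the invariance criterion with `u = 0`; it stays on the curve, where `w` equals `v`. -/
lemma exists_flow (hT : 0 ≤ T) {x₀ : Plane} (hx₀ : x₀ ∈ C 0) :
    ∃ X : ℝ → Plane, X 0 = x₀ ∧
      ∀ t ∈ Icc 0 T, HasDerivWithinAt X (v (X t) t) (Icc 0 T) t ∧ X t ∈ C t := by
  obtain ⟨B, hB, hvB⟩ := F.exists_norm_le
  have h0 : (0 : ℝ) ∈ Icc 0 T := ⟨le_rfl, hT⟩
  have hK : 0 < K := zero_lt_one.trans_le (F.field 0 h0).one_le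
  have hcoord : ∀ (x : Plane) (i : Fin 2), |x i| ≤ ‖x‖ := fun x i => PiLp.norm_apply_le x i
  set G : ℝ → Fin 2 → Plane → ℝ := fun t i => lipExt K (C t) fun P => v P t i with hG
  set w : ℝ → Plane → Plane := fun t X => !₂[clip B (G t 0 X), clip B (G t 1 X)] with hw
  have hlow : ∀ t ∈ Icc 0 T, ∀ i, ∀ P ∈ C t, -B ≤ v P t i := fun t ht i P hP =>
    neg_le_of_abs_le ((hcoord _ i).trans (hvB t ht P hP))
  -- the field extends `v`
  have hGv : ∀ t ∈ Icc 0 T, ∀ i, ∀ P ∈ C t, G t i P = v P t i := by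
    intro t ht i P hP
    refine lipExt_eq (fun P hP Q hQ => ?_) hP
    have h1 := (hcoord (v Q t - v P t) i).trans ((F.field t ht).lip P hP Q hQ)
    rw [PiLp.sub_apply] at h1
    linarith [le_of_abs_le h1]
  have hwv : ∀ t ∈ Icc 0 T, ∀ P ∈ C t, w t P = v P t := by
    intro t ht P hP
    have hc : ∀ i, clip B (G t i P) = v P t i := fun i => by
      rw [hGv t ht i P hP, clip_eq ((hcoord _ i).trans (hvB t ht P hP))]
    apply plane_ext
    · simp only [hw, hc]; simp
    · simp only [hw, hc]; simp
  have hwdiff : ∀ t s X Y c, (∀ i, |G t i X - G s i Y| ≤ c) → ‖w t X - w s Y‖ ≤ 2 * c := by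
    intro t s X Y c hc
    refine (norm_le_abs_add_abs _).trans ?_
    have e0 := (abs_clip_sub_le B (G t 0 X) (G s 0 Y)).trans (hc 0)
    have e1 := (abs_clip_sub_le B (G t 1 X) (G s 1 Y)).trans (hc 1)
    have : |(w t X - w s Y) 0| + |(w t X - w s Y) 1| =
        |clip B (G t 0 X) - clip B (G s 0 Y)| + |clip B (G t 1 X) - clip B (G s 1 Y)| := by
      simp [hw]
    linarith
  have hGlip : ∀ t ∈ Icc 0 T, ∀ i X Y, |G t i X - G t i Y| ≤ K * ‖X - Y‖ := by
    intro t ht i X Y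
    have h1 := fun X Y => lipExt_le (e₁ := 0) (e₂ := 0) (g' := fun P => v P t i) hK.le
      (F.field t ht).nonempty
      (hlow t ht i) (fun Q hQ => ⟨Q, hQ, by simp, by simp⟩) X Y
    have h2 := h1 X Y
    have h3 := h1 Y X
    rw [norm_sub_rev Y X] at h3
    simp only [zero_add] at h2 h3
    rw [abs_le]; constructor <;> linarith
  have hlipw : ∀ t ∈ Icc 0 T, ∀ X Y, ‖w t X - w t Y‖ ≤ 2 * K * ‖X - Y‖ := by
    intro t ht X Y
    rw [mul_assoc]
    exact hwdiff t t X Y _ fun i => hGlip t ht i X Y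
  have hbound : ∀ t X, ‖w t X‖ ≤ 2 * B := by
    intro t X
    refine (norm_le_abs_add_abs _).trans ?_
    have e0 := abs_clip_le hB.le (G t 0 X)
    have e1 := abs_clip_le hB.le (G t 1 X)
    have : |w t X 0| + |w t X 1| = |clip B (G t 0 X)| + |clip B (G t 1 X)| := by simp [hw]
    linarith
  have hcont : ∀ X, ContinuousOn (fun t => w t X) (Icc 0 T) := by
    intro X t ht
    rw [ContinuousWithinAt, Metric.tendsto_nhds]
    intro ε hε
    obtain ⟨R, hR⟩ := F.bound
    have hu := ((isCompact_closedBall (0 : Plane) R).prod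
      (isCompact_Icc (a := (0 : ℝ)) (b := T))).uniformContinuousOn_of_continuous
        (F.continuousOn.mono (prod_mono (subset_univ _) subset_rfl))
    obtain ⟨δ, hδ, hδu⟩ := Metric.uniformContinuousOn_iff.1 hu (ε / 8) (by positivity)
    have hη : 0 < min (δ / 2) (ε / (8 * K)) := by positivity
    have hnear := F.near t ht _ hη
    have hst : ∀ᶠ s in 𝓝[Icc 0 T] t, dist s t < δ :=
      mem_nhdsWithin_of_mem_nhds (Metric.ball_mem_nhds t hδ)
    filter_upwards [hnear, hst, eventually_mem_nhdsWithin] with s hs hsδ hsT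
    have hvv : ∀ P ∈ C t, ∀ Q ∈ C s, ‖Q - P‖ ≤ min (δ / 2) (ε / (8 * K)) → ∀ i,
        |v Q s i - v P t i| ≤ ε / 8 := by
      intro P hP Q hQ hQP i
      have h1 := hδu (Q, s) ⟨by simpa using hR s hsT Q hQ, hsT⟩ (P, t)
        ⟨by simpa using hR t ht P hP, ht⟩ (by
          rw [Prod.dist_eq, max_lt_iff, dist_eq_norm]
          exact ⟨by linarith [min_le_left (δ / 2) (ε / (8 * K))], hsδ⟩)
      rw [dist_eq_norm] at h1
      exact (hcoord _ i).trans h1.le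
    have hKη : K * min (δ / 2) (ε / (8 * K)) ≤ ε / 8 := by
      calc K * min (δ / 2) (ε / (8 * K)) ≤ K * (ε / (8 * K)) := by gcongr; exact min_le_right _ _
        _ = ε / 8 := by field_simp
    have hGt : ∀ i, |G s i X - G t i X| ≤ ε / 4 := by
      intro i
      have h1 := lipExt_le (κ := K) (e₁ := ε / 8) (g' := fun P => v P t i) hK.le
        (F.field t ht).nonempty (hlow s hsT i) (fun P hP => by
          obtain ⟨Q, hQ, hQP⟩ := hs.1 P hP
          refine ⟨Q, hQ, ?_, by rwa [norm_sub_rev]⟩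
          linarith [le_of_abs_le (hvv P hP Q hQ hQP i)]) X X
      have h2 := lipExt_le (κ := K) (e₁ := ε / 8) (g' := fun P => v P s i) hK.le
        (F.field s hsT).nonempty (hlow t ht i) (fun Q hQ => by
          obtain ⟨P, hP, hQP⟩ := hs.2 Q hQ
          refine ⟨P, hP, ?_, hQP⟩
          linarith [neg_le_of_abs_le (hvv P hP Q hQ hQP i)]) X X
      rw [sub_self, norm_zero, add_zero] at h1 h2
      rw [abs_le]; constructor <;> linarith
    rw [dist_eq_norm]
    have := hwdiff s t X X _ hGt
    linarith
  -- Clipping bounds the field by `2 * B` everywhere, so the ball of radius `2 * B * T` contains the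
  -- solution for the whole interval.
  have hPL : IsPicardLindelof w (tmin := 0) (tmax := T) ⟨0, h0⟩ x₀ (2 * B * T).toNNReal 0
      (2 * B).toNNReal (2 * K).toNNReal := by
    refine ⟨fun t ht => ?_, fun X _ => hcont X, fun t _ X _ => ?_, ?_⟩
    · refine (LipschitzWith.of_dist_le_mul fun X Y => ?_).lipschitzOnWith
      rw [dist_eq_norm, dist_eq_norm, Real.coe_toNNReal _ (by positivity)]
      exact hlipw t ht X Y
    · rw [Real.coe_toNNReal _ (by positivity)]
      exact hbound t X
    · rw [Real.coe_toNNReal _ (by positivity), Real.coe_toNNReal _ (by positivity)]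
      simp [hT]
  obtain ⟨X, hX0, hX⟩ := hPL.exists_eq_forall_mem_Icc_hasDerivWithinAt₀
  have hmem := F.mem_of_hasDerivWithinAt (κ := 2 * K) hX (by rw [hX0]; exact hx₀) fun t ht => by
    obtain ⟨P, hP, hPX⟩ := (F.field t ht).isCompact.exists_infDist_eq_dist (F.field t ht).nonempty (X t)
    rw [dist_eq_norm] at hPX
    refine ⟨P, hP, hPX.symm, 0, ?_, fun ε hε => Eventually.of_forall fun h => ⟨P, hP, ?_⟩⟩
    · rw [sub_zero, ← hwv t ht P hP, hPX]
      exact hlipw t ht _ _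
    · simp; positivity
  refine ⟨X, hX0, fun t ht => ⟨?_, hmem t ht⟩⟩
  rw [← hwv t ht _ (hmem t ht)]
  exact hX t ht

end FlowFamily


/-! ### Two-sided stability of trajectories -/

lemma norm_le_of_gronwall {f f' : ℝ → Plane} {T K ε : ℝ} (hK : 1 ≤ K) (hε : 0 ≤ ε)
    (hf : ∀ t ∈ Icc 0 T, HasDerivWithinAt f (f' t) (Icc 0 T) t)
    (hb : ∀ t ∈ Icc 0 T, ‖f' t‖ ≤ K * ‖f t‖ + ε) {t : ℝ} (ht : t ∈ Icc 0 T) :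
    ‖f t‖ ≤ (‖f 0‖ + ε) * Real.exp (K * T) := by
  have h1 := norm_le_gronwallBound_of_norm_deriv_right_le (f := f) (f' := f') (δ := ‖f 0‖) (K := K)
    (ε := ε) (a := 0) (b := T) (fun s hs => (hf s hs).continuousWithinAt)
    (fun s hs => (hf s ⟨hs.1, hs.2.le⟩).mono_of_mem_nhdsWithin
      (mem_of_superset (Icc_mem_nhdsGE hs.2) (Icc_subset_Icc_left hs.1))) le_rfl
    (fun s hs => hb s ⟨hs.1, hs.2.le⟩) t ht
  rw [gronwallBound_of_K_ne_0 (by linarith), sub_zero] at h1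
  have h2 : Real.exp (K * t) ≤ Real.exp (K * T) := by
    gcongr
    exact ht.2
  have h3 : ε / K ≤ ε := div_le_self hε hK
  have h4 : 0 ≤ Real.exp (K * t) - 1 := by
    have := Real.one_le_exp (x := K * t) (mul_nonneg (by linarith) ht.1)
    linarith
  calc ‖f t‖ ≤ ‖f 0‖ * Real.exp (K * t) + ε / K * (Real.exp (K * t) - 1) := h1
    _ ≤ ‖f 0‖ * Real.exp (K * T) + ε * Real.exp (K * T) := by
        gcongr
        linarith
    _ = _ := by ring

/-- A trajectory of the field `v` on the moving curve `C`. -/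
def IsTrajectory (T : ℝ) (C : ℝ → Set Plane) (v : Plane → ℝ → Plane) (X : ℝ → Plane) : Prop :=
  ∀ t ∈ Icc 0 T, HasDerivWithinAt X (v (X t) t) (Icc 0 T) t ∧ X t ∈ C t

lemma IsTrajectory.reverse {T : ℝ} {C : ℝ → Set Plane} {v : Plane → ℝ → Plane} {X : ℝ → Plane}
    (h : IsTrajectory T C v X) {t₁ : ℝ} (ht₁ : t₁ ∈ Icc 0 T) :
    IsTrajectory t₁ (fun s => C (t₁ - s)) (fun x s => -v x (t₁ - s)) fun s => X (t₁ - s) := by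
  intro s hs
  have hmem : ∀ {s}, s ∈ Icc 0 t₁ → t₁ - s ∈ Icc 0 T := fun hs =>
    ⟨by linarith [hs.2], by linarith [hs.1, ht₁.2]⟩
  obtain ⟨h1, h2⟩ := h _ (hmem hs)
  refine ⟨?_, h2⟩
  have h3 : HasDerivWithinAt (fun s : ℝ => t₁ - s) (-1) (Icc 0 t₁) s :=
    ((hasDerivAt_id s).const_sub t₁).hasDerivWithinAt
  have := h1.scomp s h3 fun r hr => hmem hr
  rw [neg_smul, one_smul] at this
  exact this

namespace FlowFamily

variable {T σ K : ℝ} {C : ℝ → Set Plane} {v : Plane → ℝ → Plane} (F : FlowFamily T σ K C v)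
include F

lemma norm_sub_le {X Y : ℝ → Plane} (hX : IsTrajectory T C v X) (hY : IsTrajectory T C v Y) {t : ℝ}
    (ht : t ∈ Icc 0 T) : ‖X t - Y t‖ ≤ ‖X 0 - Y 0‖ * Real.exp (K * T) := by
  have := norm_le_of_gronwall (f := fun t => X t - Y t) (F.field t ht).one_le le_rfl
    (fun s hs => (hX s hs).1.sub (hY s hs).1) (fun s hs => by
      rw [add_zero]; exact (F.field s hs).lip _ (hY s hs).2 _ (hX s hs).2) ht
  rwa [add_zero] at this

lemma eq_of_eq_zero {X Y : ℝ → Plane} (hX : IsTrajectory T C v X) (hY : IsTrajectory T C v Y)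
    (h0 : X 0 = Y 0) {t : ℝ} (ht : t ∈ Icc 0 T) : X t = Y t := by
  have := F.norm_sub_le hX hY ht
  rw [h0, sub_self, norm_zero, zero_mul] at this
  exact sub_eq_zero.1 (norm_le_zero_iff.1 this)

/-- The forward estimate for the reversed family. It makes the flow injective and keeps its spatial
derivative from vanishing. -/
lemma norm_zero_sub_le {X Y : ℝ → Plane} (hX : IsTrajectory T C v X) (hY : IsTrajectory T C v Y)
    {t : ℝ} (ht : t ∈ Icc 0 T) : ‖X 0 - Y 0‖ ≤ Real.exp (K * T) * ‖X t - Y t‖ := by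
  have h1 := (F.reverse ht).norm_sub_le (hX.reverse ht) (hY.reverse ht) (t := t) ⟨ht.1, le_rfl⟩
  simp only [sub_self, sub_zero] at h1
  refine h1.trans ?_
  rw [mul_comm]
  have := (F.field t ht).one_le
  gcongr
  exact ht.2

/-- Every point of the moving curve is reached by a trajectory. -/
lemma exists_start {t₁ : ℝ} (ht₁ : t₁ ∈ Icc 0 T) {P : Plane} (hP : P ∈ C t₁) :
    ∃ x₀ ∈ C 0, ∀ X, IsTrajectory T C v X → X 0 = x₀ → X t₁ = P := by
  have G := F.reverse ht₁
  have hmem : t₁ ∈ Icc 0 t₁ := ⟨ht₁.1, le_rfl⟩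
  -- Flow backwards from `P`; any forward trajectory from the point so reached returns to `P`, by
  -- uniqueness.
  obtain ⟨Y, hY0, hY⟩ := G.exists_flow ht₁.1 (x₀ := P) (by simpa using hP)
  have hYm := (hY t₁ hmem).2
  rw [sub_self] at hYm
  refine ⟨Y t₁, hYm, fun X hX hX0 => ?_⟩
  have := G.norm_zero_sub_le (hX.reverse ht₁) hY hmem
  rw [sub_self, sub_zero, hX0, sub_self, norm_zero, mul_zero, hY0] at this
  exact sub_eq_zero.1 (norm_le_zero_iff.1 this)

end FlowFamily


/-! ### Spatial regularity of the flow map -/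

/-- The flow of a `C^{1,σ}` initial curve along a moving family of curves. -/
structure FlowMap (T σ K M₀ : ℝ) (C : ℝ → Set Plane) (v : Plane → ℝ → Plane) (γ₀ : ℝ → Plane)
    (X : ℝ → ℝ → Plane) : Prop where
  family : FlowFamily T σ K C v
  nonneg : 0 ≤ T
  trajectory : ∀ x, IsTrajectory T C v (X x)
  initial : ∀ x, X x 0 = γ₀ x
  contDiff : ContDiff ℝ 1 γ₀
  pos : 0 < M₀
  norm_deriv_le : ∀ x, ‖deriv γ₀ x‖ ≤ M₀
  holder : ∀ x y, ‖deriv γ₀ x - deriv γ₀ y‖ ≤ M₀ * |x - y| ^ σ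

/-- The difference quotient of the flow map. -/
noncomputable def flowQuot (X : ℝ → ℝ → Plane) (h x t : ℝ) : Plane := h⁻¹ • (X (x + h) t - X x t)

namespace FlowMap

variable {T σ K M₀ : ℝ} {C : ℝ → Set Plane} {v : Plane → ℝ → Plane} {γ₀ : ℝ → Plane}
  {X : ℝ → ℝ → Plane} (Φ : FlowMap T σ K M₀ C v γ₀ X)
include Φ

lemma zero_mem : (0 : ℝ) ∈ Icc 0 T := ⟨le_rfl, Φ.nonneg⟩

lemma one_le : 1 ≤ K := (Φ.family.field 0 Φ.zero_mem).one_le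

lemma norm_sub_le (x y : ℝ) {t : ℝ} (ht : t ∈ Icc 0 T) :
    ‖X x t - X y t‖ ≤ M₀ * Real.exp (K * T) * |x - y| := by
  have h1 := Φ.family.norm_sub_le (Φ.trajectory x) (Φ.trajectory y) ht
  rw [Φ.initial, Φ.initial] at h1
  have h2 : ‖γ₀ x - γ₀ y‖ ≤ M₀ * |x - y| :=
    convex_univ.norm_image_sub_le_of_norm_deriv_le (𝕜 := ℝ)
      (fun z _ => Φ.contDiff.differentiable (by simp) z) (fun z _ => Φ.norm_deriv_le z)
      (mem_univ y) (mem_univ x)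
  calc _ ≤ _ := h1
    _ ≤ M₀ * |x - y| * Real.exp (K * T) := by gcongr
    _ = _ := by ring

lemma norm_flowQuot_le (x : ℝ) {h t : ℝ} (hh : h ≠ 0) (ht : t ∈ Icc 0 T) :
    ‖flowQuot X h x t‖ ≤ M₀ * Real.exp (K * T) := by
  have := Φ.norm_sub_le (x + h) x ht
  rw [add_sub_cancel_left] at this
  rw [flowQuot, norm_smul, norm_inv, Real.norm_eq_abs, inv_mul_le_iff₀ (abs_pos.2 hh)]
  linarith

lemma hasDerivWithinAt_flowQuot (h x : ℝ) {t : ℝ} (ht : t ∈ Icc 0 T) :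
    HasDerivWithinAt (fun t => flowQuot X h x t) (h⁻¹ • (v (X (x + h) t) t - v (X x t) t))
      (Icc 0 T) t :=
  ((Φ.trajectory (x + h) t ht).1.sub (Φ.trajectory x t ht).1).const_smul h⁻¹

lemma norm_deriv_flowQuot_le (x : ℝ) {h t : ℝ} (hh : h ≠ 0) (ht : t ∈ Icc 0 T) :
    ‖h⁻¹ • (v (X (x + h) t) t - v (X x t) t)‖ ≤ K * (M₀ * Real.exp (K * T)) := by
  have h1 := (Φ.family.field t ht).lip _ (Φ.trajectory x t ht).2 _ (Φ.trajectory (x + h) t ht).2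
  have h2 := Φ.norm_flowQuot_le x hh ht
  have hK := Φ.one_le
  rw [flowQuot, norm_smul] at h2
  rw [norm_smul]
  calc _ ≤ ‖h⁻¹‖ * (K * ‖X (x + h) t - X x t‖) := by gcongr
    _ = K * (‖h⁻¹‖ * ‖X (x + h) t - X x t‖) := by ring
    _ ≤ _ := by gcongr

lemma norm_initial_sub_le (x : ℝ) {h : ℝ} (hh : h ≠ 0) :
    ‖flowQuot X h x 0 - deriv γ₀ x‖ ≤ M₀ * |h| ^ σ := by
  have h1 := (convex_uIcc x (x + h)).norm_image_sub_le_of_norm_hasDerivWithin_le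
    (f := fun z => γ₀ z - z • deriv γ₀ x) (f' := fun z => deriv γ₀ z - deriv γ₀ x)
    (C := M₀ * |h| ^ σ) (x := x) (y := x + h) (fun z _ => ?_) (fun z hz => ?_)
    left_mem_uIcc right_mem_uIcc
  · rw [add_sub_cancel_left, Real.norm_eq_abs] at h1
    have e : flowQuot X h x 0 - deriv γ₀ x =
        h⁻¹ • (γ₀ (x + h) - (x + h) • deriv γ₀ x - (γ₀ x - x • deriv γ₀ x)) := by
      have : deriv γ₀ x = h⁻¹ • h • deriv γ₀ x := by rw [smul_smul, inv_mul_cancel₀ hh, one_smul]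
      rw [flowQuot, Φ.initial, Φ.initial]
      nth_rewrite 1 [this]
      rw [← smul_sub]
      congr 1
      module
    rw [e, norm_smul, norm_inv, Real.norm_eq_abs, inv_mul_le_iff₀ (abs_pos.2 hh)]
    linarith
  · have := ((Φ.contDiff.differentiable (by simp) z).hasDerivAt).sub
      ((hasDerivAt_id z).smul_const (deriv γ₀ x))
    rw [one_smul] at this
    exact this.hasDerivWithinAt
  · have h2 := abs_sub_left_of_mem_uIcc hz
    rw [add_sub_cancel_left] at h2
    refine (Φ.holder z x).trans ?_
    have := Φ.pos
    have := Φ.family.σ_pos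
    gcongr

lemma norm_initial_sub_initial_le (x y : ℝ) {h k : ℝ} (hh : h ≠ 0) (hk : k ≠ 0) :
    ‖flowQuot X h x 0 - flowQuot X k y 0‖ ≤ M₀ * (|x - y| ^ σ + |h| ^ σ + |k| ^ σ) := by
  have e : flowQuot X h x 0 - flowQuot X k y 0 = (flowQuot X h x 0 - deriv γ₀ x) +
      (deriv γ₀ x - deriv γ₀ y) + -(flowQuot X k y 0 - deriv γ₀ y) := by abel
  rw [e]
  refine norm_add₃_le.trans ?_
  rw [norm_neg]
  linarith [Φ.norm_initial_sub_le x hh, Φ.norm_initial_sub_le y hk, Φ.holder x y]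

/-- The jet linearises velocity differences: each quotient `q` satisfies `q' = A(X) q` up to
`O(|h|^σ)`, and `A` varies by `O(|x - y|^σ)` between the two base points. What remains is a linear
term in the difference of the quotients and a small forcing, as Grönwall requires. -/
lemma norm_deriv_sub_le (x y : ℝ) {h k t : ℝ} (hh : h ≠ 0) (hk : k ≠ 0) (ht : t ∈ Icc 0 T) :
    ‖h⁻¹ • (v (X (x + h) t) t - v (X x t) t) - k⁻¹ • (v (X (y + k) t) t - v (X y t) t)‖ ≤
      K * ‖flowQuot X h x t - flowQuot X k y t‖ +
        K * (M₀ * Real.exp (K * T)) ^ σ * (M₀ * Real.exp (K * T)) *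
          (|x - y| ^ σ + |h| ^ σ + |k| ^ σ) := by
  set E := M₀ * Real.exp (K * T) with hE
  have hM := Φ.pos
  have hE0 : 0 < E := by positivity
  have hK := Φ.one_le
  have hσ := Φ.family.σ_pos
  obtain ⟨A, hA, hA'⟩ := (Φ.family.field t ht).jet
  have hmem := fun x => (Φ.trajectory x t ht).2
  have herr : ∀ z r, r ≠ 0 → ‖r⁻¹ • (v (X (z + r) t) t - v (X z t) t) -
      A (X z t) (flowQuot X r z t)‖ ≤ K * E ^ σ * E * |r| ^ σ := by
    intro z r hr
    have h1 := (hA' _ (hmem z) _ (hmem (z + r))).2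
    have h2 := Φ.norm_sub_le (z + r) z ht
    rw [add_sub_cancel_left, ← hE] at h2
    rw [flowQuot, map_smul, ← smul_sub, norm_smul, norm_inv, Real.norm_eq_abs,
      inv_mul_le_iff₀ (abs_pos.2 hr)]
    calc _ ≤ _ := h1
      _ ≤ K * (E * |r|) ^ σ * (E * |r|) := by gcongr
      _ = _ := by rw [Real.mul_rpow hE0.le (abs_nonneg _)]; ring
  have hAA : ‖(A (X x t) - A (X y t)) (flowQuot X k y t)‖ ≤ K * E ^ σ * E * |x - y| ^ σ := by
    have h1 := (hA' _ (hmem y) _ (hmem x)).1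
    have h2 := Φ.norm_sub_le x y ht
    rw [← hE] at h2
    calc _ ≤ ‖A (X x t) - A (X y t)‖ * ‖flowQuot X k y t‖ := ContinuousLinearMap.le_opNorm _ _
      _ ≤ (K * (E * |x - y|) ^ σ) * E := by
          gcongr
          · exact h1.trans (by gcongr)
          · exact Φ.norm_flowQuot_le y hk ht
      _ = _ := by rw [Real.mul_rpow hE0.le (abs_nonneg _)]; ring
  have hlin : ‖A (X x t) (flowQuot X h x t - flowQuot X k y t)‖ ≤
      K * ‖flowQuot X h x t - flowQuot X k y t‖ := by
    refine (ContinuousLinearMap.le_opNorm _ _).trans ?_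
    gcongr
    exact hA _ (hmem x)
  set a := h⁻¹ • (v (X (x + h) t) t - v (X x t) t) - A (X x t) (flowQuot X h x t)
  set b := k⁻¹ • (v (X (y + k) t) t - v (X y t) t) - A (X y t) (flowQuot X k y t)
  have e : h⁻¹ • (v (X (x + h) t) t - v (X x t) t) - k⁻¹ • (v (X (y + k) t) t - v (X y t) t) =
      A (X x t) (flowQuot X h x t - flowQuot X k y t) +
        (A (X x t) - A (X y t)) (flowQuot X k y t) + (a - b) := by
    simp only [a, b, map_sub, sub_apply]
    abel
  rw [e]
  refine norm_add₃_le.trans ?_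
  have hab := _root_.norm_sub_le a b
  have ha := herr x h hh
  have hb := herr y k hk
  linarith

/-- Stability of the difference quotients. -/
lemma exists_norm_flowQuot_sub_le : ∃ G > 0, ∀ x y h k : ℝ, h ≠ 0 → k ≠ 0 →
    (∀ t ∈ Icc 0 T, ‖flowQuot X h x t - flowQuot X k y t‖ ≤ G * (|x - y| ^ σ + |h| ^ σ + |k| ^ σ)) ∧
    ∀ t ∈ Icc 0 T, ∀ s ∈ Icc 0 T, ‖(flowQuot X h x t - flowQuot X k y t) -
      (flowQuot X h x s - flowQuot X k y s)‖ ≤ G * (|x - y| ^ σ + |h| ^ σ + |k| ^ σ) * |t - s| := by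
  set E := M₀ * Real.exp (K * T) with hE
  have hM := Φ.pos
  have hE0 : 0 < E := by positivity
  have hK := Φ.one_le
  set D := K * E ^ σ * E with hD
  have hD0 : 0 < D := by positivity
  set G₁ := (M₀ + D) * Real.exp (K * T) with hG₁
  have hG₁0 : 0 < G₁ := by positivity
  refine ⟨K * G₁ + D, by positivity, fun x y h k hh hk => ?_⟩
  set S := |x - y| ^ σ + |h| ^ σ + |k| ^ σ with hS
  have hS0 : 0 ≤ S := by positivity
  have hw : ∀ t ∈ Icc 0 T, ‖flowQuot X h x t - flowQuot X k y t‖ ≤ G₁ * S := by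
    intro t ht
    have h1 := norm_le_of_gronwall (f := fun t => flowQuot X h x t - flowQuot X k y t)
      (ε := D * S) hK (by positivity)
      (fun s hs => (Φ.hasDerivWithinAt_flowQuot h x hs).sub (Φ.hasDerivWithinAt_flowQuot k y hs))
      (fun s hs => Φ.norm_deriv_sub_le x y hh hk hs) ht
    refine h1.trans ?_
    have h2 := Φ.norm_initial_sub_initial_le x y hh hk
    calc _ ≤ (M₀ * S + D * S) * Real.exp (K * T) := by gcongr
      _ = _ := by rw [hG₁]; ring
  refine ⟨fun t ht => (hw t ht).trans ?_, fun t ht s hs => ?_⟩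
  · gcongr
    nlinarith
  · have := (convex_Icc 0 T).norm_image_sub_le_of_norm_hasDerivWithin_le
      (f := fun t => flowQuot X h x t - flowQuot X k y t) (C := (K * G₁ + D) * S)
      (fun r hr => (Φ.hasDerivWithinAt_flowQuot h x hr).sub (Φ.hasDerivWithinAt_flowQuot k y hr))
      (fun r hr => (Φ.norm_deriv_sub_le x y hh hk hr).trans ?_) hs ht
    · rwa [Real.norm_eq_abs] at this
    · calc _ ≤ K * (G₁ * S) + D * S := by
            gcongr
            exact hw r hr
        _ = _ := by ring

lemma tendsto_abs_rpow : Tendsto (fun h : ℝ => |h| ^ σ) (𝓝[≠] 0) (𝓝 0) := by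
  have hσ := Φ.family.σ_pos
  have : Tendsto (fun h : ℝ => |h| ^ σ) (𝓝 0) (𝓝 (|0| ^ σ)) :=
    (continuous_abs.rpow_const fun _ => Or.inr hσ.le).tendsto 0
  rw [abs_zero, Real.zero_rpow hσ.ne'] at this
  exact this.mono_left nhdsWithin_le_nhds

/-- At equal base points the stability estimate says that the quotients are Cauchy as the increment
tends to zero. -/
lemma exists_hasDerivAt (x : ℝ) {t : ℝ} (ht : t ∈ Icc 0 T) :
    ∃ Z, HasDerivAt (fun x => X x t) Z x := by
  obtain ⟨G, hG, hGq⟩ := Φ.exists_norm_flowQuot_sub_le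
  have hσ := Φ.family.σ_pos
  have hc : Cauchy (map (fun h => flowQuot X h x t) (𝓝[≠] 0)) := by
    rw [cauchy_map_iff]
    refine ⟨inferInstance, ?_⟩
    rw [Metric.uniformity_eq_comap_nhds_zero, tendsto_comap_iff]
    have h0 : Tendsto (fun p : ℝ × ℝ => G * (|p.1| ^ σ + |p.2| ^ σ)) (𝓝[≠] 0 ×ˢ 𝓝[≠] 0) (𝓝 0) := by
      have := ((Φ.tendsto_abs_rpow.comp (tendsto_fst (g := 𝓝[≠] (0 : ℝ)))).add
        (Φ.tendsto_abs_rpow.comp (tendsto_snd (f := 𝓝[≠] (0 : ℝ))))).const_mul G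
      simpa using this
    refine squeeze_zero' (Eventually.of_forall fun p => dist_nonneg) ?_ h0
    have hne : ∀ᶠ h : ℝ in 𝓝[≠] 0, h ≠ 0 := self_mem_nhdsWithin
    filter_upwards [hne.prod_mk hne] with p hp
    have := (hGq x x p.1 p.2 hp.1 hp.2).1 t ht
    rw [sub_self, abs_zero, Real.zero_rpow hσ.ne', zero_add] at this
    simpa [dist_eq_norm] using this
  obtain ⟨Z, hZ⟩ := cauchy_map_iff_exists_tendsto.1 hc
  exact ⟨Z, hasDerivAt_iff_tendsto_slope_zero.2 hZ⟩

lemma hasDerivAt (x : ℝ) {t : ℝ} (ht : t ∈ Icc 0 T) :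
    HasDerivAt (fun x => X x t) (deriv (fun x => X x t) x) x := by
  obtain ⟨Z, hZ⟩ := Φ.exists_hasDerivAt x ht
  exact hZ.differentiableAt.hasDerivAt

lemma tendsto_flowQuot (x : ℝ) {t : ℝ} (ht : t ∈ Icc 0 T) :
    Tendsto (fun h => flowQuot X h x t) (𝓝[≠] 0) (𝓝 (deriv (fun x => X x t) x)) := by
  have h1 := hasDerivAt_iff_tendsto_slope_zero.1 (Φ.hasDerivAt x ht)
  exact h1.congr fun _ => rfl

omit Φ in
lemma eventually_ne : ∀ᶠ h : ℝ in 𝓝[≠] 0, h ≠ 0 := self_mem_nhdsWithin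

lemma norm_deriv_flow_le (x : ℝ) {t : ℝ} (ht : t ∈ Icc 0 T) :
    ‖deriv (fun x => X x t) x‖ ≤ M₀ * Real.exp (K * T) :=
  le_of_tendsto (Φ.tendsto_flowQuot x ht).norm
    (eventually_ne.mono fun _ hh => Φ.norm_flowQuot_le x hh ht)

lemma norm_deriv_flow_sub_le (x : ℝ) {t s : ℝ} (ht : t ∈ Icc 0 T) (hs : s ∈ Icc 0 T) :
    ‖deriv (fun x => X x t) x - deriv (fun x => X x s) x‖ ≤
      K * (M₀ * Real.exp (K * T)) * |t - s| := by
  refine le_of_tendsto ((Φ.tendsto_flowQuot x ht).sub (Φ.tendsto_flowQuot x hs)).norm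
    (eventually_ne.mono fun h hh => ?_)
  have := (convex_Icc 0 T).norm_image_sub_le_of_norm_hasDerivWithin_le
    (fun r hr => Φ.hasDerivWithinAt_flowQuot h x hr)
    (fun r hr => Φ.norm_deriv_flowQuot_le x hh hr) hs ht
  rwa [Real.norm_eq_abs] at this

/-- The derivative of the flow map is Hölder continuous in space, with Lipschitz continuous
dependence on time. -/
lemma exists_holder : ∃ G > 0, (∀ t ∈ Icc 0 T, ∀ x y,
      ‖deriv (fun x => X x t) x - deriv (fun x => X x t) y‖ ≤ G * |x - y| ^ σ) ∧
    ∀ t ∈ Icc 0 T, ∀ s ∈ Icc 0 T, ∀ x y,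
      ‖(deriv (fun x => X x t) x - deriv (fun x => X x t) y) -
        (deriv (fun x => X x s) x - deriv (fun x => X x s) y)‖ ≤ G * |x - y| ^ σ * |t - s| := by
  obtain ⟨G, hG, hGq⟩ := Φ.exists_norm_flowQuot_sub_le
  have hlim : ∀ x y, Tendsto (fun h : ℝ => G * (|x - y| ^ σ + |h| ^ σ + |h| ^ σ)) (𝓝[≠] 0)
      (𝓝 (G * |x - y| ^ σ)) := fun x y => by
    simpa using (((tendsto_const_nhds (x := |x - y| ^ σ)).add Φ.tendsto_abs_rpow).add
      Φ.tendsto_abs_rpow).const_mul G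
  refine ⟨G, hG, fun t ht x y => ?_, fun t ht s hs x y => ?_⟩
  · exact le_of_tendsto_of_tendsto ((Φ.tendsto_flowQuot x ht).sub (Φ.tendsto_flowQuot y ht)).norm
      (hlim x y) (eventually_ne.mono fun h hh => (hGq x y h h hh hh).1 t ht)
  · exact le_of_tendsto_of_tendsto (((Φ.tendsto_flowQuot x ht).sub (Φ.tendsto_flowQuot y ht)).sub
      ((Φ.tendsto_flowQuot x hs).sub (Φ.tendsto_flowQuot y hs))).norm
      ((hlim x y).mul_const _) (eventually_ne.mono fun h hh => (hGq x y h h hh hh).2 t ht s hs)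

/-- The backward Lipschitz estimate passes to difference quotients, so a nonvanishing initial
tangent never degenerates. -/
lemma norm_deriv_initial_le (x : ℝ) {t : ℝ} (ht : t ∈ Icc 0 T) :
    ‖deriv γ₀ x‖ ≤ Real.exp (K * T) * ‖deriv (fun x => X x t) x‖ := by
  have h0 : deriv γ₀ x = deriv (fun x => X x 0) x := by
    congr 1; funext y; exact (Φ.initial y).symm
  rw [h0]
  refine le_of_tendsto_of_tendsto (Φ.tendsto_flowQuot x Φ.zero_mem).norm
    ((Φ.tendsto_flowQuot x ht).norm.const_mul _) (Eventually.of_forall fun h => ?_)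
  have := Φ.family.norm_zero_sub_le (Φ.trajectory (x + h)) (Φ.trajectory x) ht
  simp only [flowQuot, norm_smul]
  calc _ ≤ ‖h⁻¹‖ * (Real.exp (K * T) * ‖X (x + h) t - X x t‖) := by gcongr
    _ = _ := by ring

lemma contDiff_flow {t : ℝ} (ht : t ∈ Icc 0 T) : ContDiff ℝ 1 fun x => X x t := by
  obtain ⟨G, hG, hGh, -⟩ := Φ.exists_holder
  have hσ := Φ.family.σ_pos
  rw [contDiff_one_iff_deriv]
  refine ⟨fun x => (Φ.hasDerivAt x ht).differentiableAt, continuous_iff_continuousAt.2 fun x => ?_⟩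
  rw [ContinuousAt, tendsto_iff_norm_sub_tendsto_zero]
  have h0 : Tendsto (fun y : ℝ => G * |y - x| ^ σ) (𝓝 x) (𝓝 (G * |x - x| ^ σ)) :=
    (continuous_const.mul (((continuous_id.sub continuous_const).abs).rpow_const
      fun _ => Or.inr hσ.le)).tendsto x
  rw [sub_self, abs_zero, Real.zero_rpow hσ.ne', mul_zero] at h0
  exact squeeze_zero (fun y => norm_nonneg _) (fun y => hGh t ht y x) h0

lemma periodic {L : ℝ} (hper : Function.Periodic γ₀ L) {t : ℝ} (ht : t ∈ Icc 0 T) :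
    Function.Periodic (fun x => X x t) L := fun x =>
  Φ.family.eq_of_eq_zero (Φ.trajectory (x + L)) (Φ.trajectory x)
    (by rw [Φ.initial, Φ.initial, hper x]) ht

lemma injOn {S : Set ℝ} (hinj : InjOn γ₀ S) {t : ℝ} (ht : t ∈ Icc 0 T) :
    InjOn (fun x => X x t) S := by
  intro x hx y hy hxy
  have := Φ.family.norm_zero_sub_le (Φ.trajectory x) (Φ.trajectory y) ht
  simp only at hxy
  rw [hxy, sub_self, norm_zero, mul_zero, Φ.initial, Φ.initial] at this
  exact hinj hx hy (sub_eq_zero.1 (norm_le_zero_iff.1 this))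

lemma range_flow (hr : range γ₀ = C 0) {t : ℝ} (ht : t ∈ Icc 0 T) :
    range (fun x => X x t) = C t := by
  refine Subset.antisymm ?_ fun P hP => ?_
  · rintro _ ⟨x, rfl⟩
    exact (Φ.trajectory x t ht).2
  · obtain ⟨x₀, hx₀, hx₀P⟩ := Φ.family.exists_start ht hP
    rw [← hr] at hx₀
    obtain ⟨x, rfl⟩ := hx₀
    exact ⟨x, hx₀P _ (Φ.trajectory x) (Φ.initial x)⟩

lemma exists_lipschitz_time : ∃ B > 0, ∀ x, ∀ t ∈ Icc 0 T, ∀ s ∈ Icc 0 T,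
    ‖X x t - X x s‖ ≤ B * |t - s| := by
  obtain ⟨B, hB, hvB⟩ := Φ.family.exists_norm_le
  refine ⟨B, hB, fun x t ht s hs => ?_⟩
  have := (convex_Icc 0 T).norm_image_sub_le_of_norm_hasDerivWithin_le
    (fun r hr => (Φ.trajectory x r hr).1) (fun r hr => hvB r hr _ (Φ.trajectory x r hr).2) hs ht
  rwa [Real.norm_eq_abs] at this

end FlowMap


/-! ### The `C^{1,σ}` norm -/

lemma c1HolderNorm_le {σ a b c : ℝ} (hσ : 0 < σ) {f : ℝ → Plane} (ha : ∀ x, ‖f x‖ ≤ a)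
    (hb : ∀ x, ‖deriv f x‖ ≤ b) (hc : ∀ x y, ‖deriv f x - deriv f y‖ ≤ c * |x - y| ^ σ) :
    c1HolderNorm σ f ≤ ENNReal.ofReal a + ENNReal.ofReal b + ENNReal.ofReal c := by
  unfold c1HolderNorm
  refine add_le_add (add_le_add (iSup_le fun x => ?_) (iSup_le fun x => ?_)) ?_
  · rw [← ofReal_norm]; exact ENNReal.ofReal_le_ofReal (ha x)
  · rw [← ofReal_norm]; exact ENNReal.ofReal_le_ofReal (hb x)
  · have hc0 : 0 ≤ c := by
      have := (norm_nonneg _).trans (hc 1 0)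
      simpa using this
    have h1 : HolderWith c.toNNReal σ.toNNReal (deriv f) := fun x y => by
      rw [edist_dist, edist_dist, dist_eq_norm, Real.dist_eq, Real.coe_toNNReal σ hσ.le,
        ENNReal.ofReal_rpow_of_nonneg (abs_nonneg _) hσ.le]
      change _ ≤ ENNReal.ofReal c * _
      rw [← ENNReal.ofReal_mul hc0]
      exact ENNReal.ofReal_le_ofReal (hc x y)
    exact h1.eHolderNorm_le

lemma exists_norm_le_of_periodic {f : ℝ → Plane} (hf : Continuous f) {L : ℝ} (hL : 0 < L)
    (hper : Function.Periodic f L) : ∃ B, ∀ x, ‖f x‖ ≤ B := by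
  obtain ⟨B, hB⟩ := (isCompact_Icc (a := (0 : ℝ)) (b := L)).exists_bound_of_continuousOn
    hf.continuousOn
  refine ⟨B, fun x => ?_⟩
  obtain ⟨n, hn, hn'⟩ := exists_int_sub_mem_Ico hL 0 x
  rw [← hper.sub_int_mul_eq n]
  exact hB _ ⟨hn, by linarith⟩

/-- Lowering the exponent of a bounded Hölder continuous function. -/
lemma holder_of_le {f : ℝ → Plane} {β σ A B : ℝ} (hσ : 0 < σ) (hσβ : σ ≤ β) (hA : 0 ≤ A)
    (hf : ∀ x, ‖f x‖ ≤ B) (hh : ∀ x y, ‖f y - f x‖ ≤ A * |y - x| ^ β) (x y : ℝ) :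
    ‖f x - f y‖ ≤ (A + 2 * B) * |x - y| ^ σ := by
  have hB : 0 ≤ B := (norm_nonneg _).trans (hf 0)
  rcases le_total |x - y| 1 with h1 | h1
  · have h2 : |x - y| ^ β ≤ |x - y| ^ σ :=
      Real.rpow_le_rpow_of_exponent_ge' (abs_nonneg _) h1 hσ.le hσβ
    calc _ ≤ A * |x - y| ^ β := hh y x
      _ ≤ (A + 2 * B) * |x - y| ^ σ := by gcongr; linarith
  · have h2 : 1 ≤ |x - y| ^ σ := Real.one_le_rpow h1 hσ.le
    calc _ ≤ ‖f x‖ + ‖f y‖ := norm_sub_le _ _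
      _ ≤ (A + 2 * B) * 1 := by linarith [hf x, hf y]
      _ ≤ _ := by gcongr

namespace FlowMap

variable {T σ K M₀ : ℝ} {C : ℝ → Set Plane} {v : Plane → ℝ → Plane} {γ₀ : ℝ → Plane}
  {X : ℝ → ℝ → Plane} (Φ : FlowMap T σ K M₀ C v γ₀ X)
include Φ

/-- Continuity in the Hölder seminorm does not follow from uniform continuity of the derivative. It
comes from the second estimate of `exists_holder`, where spatial increments of the derivative are
Lipschitz in time with constant proportional to `|x - y|^σ`. -/
lemma isContinuousC1Holder (hper : Function.Periodic γ₀ (2 * Real.pi)) :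
    IsContinuousC1Holder T σ X := by
  have hσ := Φ.family.σ_pos
  obtain ⟨G, hG, hG1, hG2⟩ := Φ.exists_holder
  obtain ⟨B, hB, hBt⟩ := Φ.exists_lipschitz_time
  refine ⟨fun t ht => Φ.periodic hper ht, fun t ht => Φ.contDiff_flow ht, fun t ht => ?_,
    fun t ht => ?_⟩
  · obtain ⟨R, hR⟩ := Φ.family.bound
    exact (c1HolderNorm_le hσ (fun x => hR t ht _ (Φ.trajectory x t ht).2)
      (fun x => Φ.norm_deriv_flow_le x ht) (hG1 t ht)).trans_lt (by simp)
  · have hd : ∀ s ∈ Icc 0 T, ∀ x, deriv (fun x => X x s - X x t) x =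
        deriv (fun x => X x s) x - deriv (fun x => X x t) x := fun s hs x =>
      ((Φ.hasDerivAt x hs).sub (Φ.hasDerivAt x ht)).deriv
    have hlin : ∀ c : ℝ, Tendsto (fun s => ENNReal.ofReal (c * |s - t|)) (𝓝[Icc 0 T] t) (𝓝 0) := by
      intro c
      have : Tendsto (fun s => ENNReal.ofReal (c * |s - t|)) (𝓝 t)
          (𝓝 (ENNReal.ofReal (c * |t - t|))) :=
        (ENNReal.continuous_ofReal.comp (by fun_prop : Continuous fun s => c * |s - t|)).tendsto t
      rw [sub_self, abs_zero, mul_zero, ENNReal.ofReal_zero] at this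
      exact this.mono_left nhdsWithin_le_nhds
    have hsum := ((hlin B).add (hlin (K * (M₀ * Real.exp (K * T))))).add (hlin G)
    rw [add_zero, add_zero] at hsum
    refine tendsto_of_tendsto_of_tendsto_of_le_of_le' tendsto_const_nhds hsum
      (Eventually.of_forall fun s => zero_le) (eventually_mem_nhdsWithin.mono fun s hs => ?_)
    refine c1HolderNorm_le hσ (fun x => hBt x s hs t ht) (fun x => ?_) fun x y => ?_
    · rw [hd s hs]
      exact Φ.norm_deriv_flow_sub_le x hs ht
    · rw [hd s hs, hd s hs, sub_sub_sub_comm]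
      refine (hG2 s hs t ht x y).trans_eq ?_
      ring

end FlowMap

/-! ### Orientation -/

/-- A nearly tangent `Z` has tangential component larger than `‖Z‖ / 2` in modulus, so `perp Z`
points into one of the two normal cones, according to the sign of that component. -/
lemma HolderCurve.side_of_almost_tangent {β M ℓ L δ : ℝ} {Γ : ℝ → Plane} {Ω : Set Plane}
    (h : HolderCurve β M ℓ L Γ Ω) (hδ : 0 < δ) (hδℓ : 2 * δ ≤ ℓ) (hac : ArcChord L δ Γ)
    (hΩ : IsPatchDomain Ω) {s : ℝ} {Z : Plane} (hZ0 : Z ≠ 0)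
    (hZ : |inner ℝ (perp (deriv Γ s)) Z| ≤ 1 / 4 * ‖Z‖) :
    (∀ r, 0 < r → r * ‖Z‖ < δ → Γ s + r • perp Z ∉ frontier Ω) ∧
      ((∀ r, 0 < r → r * ‖Z‖ < δ → Γ s + r • perp Z ∈ Ω) ∨
        ∀ r, 0 < r → r * ‖Z‖ < δ → Γ s + r • perp Z ∉ Ω) := by
  have hZp : 0 < ‖Z‖ := norm_pos_iff.2 hZ0
  set a := inner ℝ (deriv Γ s) Z with ha
  have hsq := norm_sq_frame (h.norm_deriv s) Z
  have ha2 : 1 / 2 * ‖Z‖ < |a| := by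
    have h1 : inner ℝ (perp (deriv Γ s)) Z ^ 2 ≤ (1 / 4 * ‖Z‖) ^ 2 := sq_le_sq' (by
      linarith [neg_le_of_abs_le hZ]) (le_of_abs_le hZ)
    refine lt_of_pow_lt_pow_left₀ 2 (abs_nonneg _) ?_
    rw [sq_abs]
    nlinarith
  have hinner : ∀ r : ℝ, inner ℝ (perp (deriv Γ s)) (r • perp Z) = r * a := fun r => by
    rw [inner_smul_right, inner_perp_perp]
  have hnorm : ∀ r : ℝ, 0 < r → ‖r • perp Z‖ = r * ‖Z‖ := fun r hr => by
    rw [norm_smul, norm_perp, Real.norm_of_nonneg hr.le]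
  rcases le_or_gt 0 a with h0 | h0
  · rw [abs_of_nonneg h0] at ha2
    have hcone : ∀ r, 0 < r → r * ‖Z‖ < δ → Γ s + r • perp Z ∈ cone (Γ s) (perp (deriv Γ s)) δ := by
      intro r hr hrδ
      refine ⟨by rwa [add_sub_cancel_left, hnorm r hr], ?_⟩
      rw [add_sub_cancel_left, hnorm r hr, hinner]
      nlinarith
    exact ⟨fun r hr hrδ => h.cone_not_mem_frontier hδℓ hac (Or.inl rfl) (hcone r hr hrδ),
      Or.inl fun r hr hrδ => h.upper_cone_subset hδ hδℓ hac s (hcone r hr hrδ)⟩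
  · rw [abs_of_neg h0] at ha2
    have hcone : ∀ r, 0 < r → r * ‖Z‖ < δ → Γ s + r • perp Z ∈ cone (Γ s) (-perp (deriv Γ s)) δ := by
      intro r hr hrδ
      refine ⟨by rwa [add_sub_cancel_left, hnorm r hr], ?_⟩
      rw [add_sub_cancel_left, hnorm r hr, inner_neg_left, hinner]
      nlinarith
    exact ⟨fun r hr hrδ => h.cone_not_mem_frontier hδℓ hac (Or.inr rfl) (hcone r hr hrδ),
      Or.inr fun r hr hrδ => h.lower_cone_disjoint hδ hδℓ hac hΩ (hcone r hr hrδ)⟩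

namespace MovingCurve

variable {α β M ℓ T : ℝ} {Ω : ℝ → Set Plane} {L : ℝ → ℝ} {Γ : ℝ → ℝ → Plane}
  (H : MovingCurve β M ℓ T Ω L Γ)
include H

lemma exists_flowFamily (hT : 0 ≤ T) (hα₀ : 0 < α) (hα₁ : α < 1 / 2) (hσ : 2 * α < β)
    (hw : IsAlphaPatch α T Ω) :
    ∃ K, FlowFamily T (β - 2 * α) K (fun t => frontier (Ω t)) (velocity α Ω) := by
  obtain ⟨Λ, lam, hreg⟩ := H.exists_regularCurve hT
  obtain ⟨K, hK⟩ := exists_curveField (β := β) (M := M) (ℓ := ℓ) (Λ := Λ) (lam := lam) hα₀ hα₁ hσ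
  obtain ⟨R, hR, hRΩ⟩ := H.exists_bound
  refine ⟨K, by linarith, fun t ht => hK _ _ _ (hreg t ht),
    ⟨R, fun t ht P hP => hRΩ t ht P (frontier_subset_closure hP)⟩,
    H.continuousOn_velocity hα₀ hα₁, fun t ht η hη => ?_,
    fun t ht ε hε => H.eventually_motion hα₀ hα₁ hw ht hε⟩
  filter_upwards [H.eventually_near ht hη] with s hs
  refine ⟨fun P hP => ?_, fun Q hQ => ?_⟩
  · obtain ⟨Q, hQ, hQP⟩ := hs.2 P hP
    exact ⟨Q, hQ, hQP.le⟩
  · obtain ⟨P, hP, hQP⟩ := hs.1 Q hQ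
    exact ⟨P, hP, hQP.le⟩

/-- The flow preserves the orientation of the boundary. -/
lemma eventually_add_smul_perp_mem {σ K M₀ : ℝ} {v : Plane → ℝ → Plane} {γ₀ : ℝ → Plane}
    {X : ℝ → ℝ → Plane} (Φ : FlowMap T σ K M₀ (fun t => frontier (Ω t)) v γ₀ X)
    {L₀ : ℝ} (h0 : IsParametrization L₀ γ₀ (Ω 0)) (x : ℝ) {t : ℝ} (ht : t ∈ Icc 0 T) :
    ∀ᶠ ε in 𝓝[>] (0 : ℝ), X x t + ε • perp (deriv (fun x => X x t) x) ∈ Ω t := by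
  obtain ⟨δ, hδ, hδℓ, hac⟩ := H.exists_uniform_arcChord Φ.nonneg
  set Z : ℝ → Plane := fun t => deriv (fun x => X x t) x with hZ
  set E := M₀ * Real.exp (K * T) with hE
  have hE0 : 0 < E := mul_pos Φ.pos (Real.exp_pos _)
  have hZE : ∀ t ∈ Icc 0 T, ‖Z t‖ ≤ E := fun t ht => Φ.norm_deriv_flow_le x ht
  have hZ0 : ∀ t ∈ Icc 0 T, Z t ≠ 0 := by
    intro t ht hz
    have := Φ.norm_deriv_initial_le x ht
    rw [show deriv (fun x => X x t) x = 0 from hz, norm_zero, mul_zero] at this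
    exact h0.deriv_ne_zero x (norm_le_zero_iff.1 this)
  have hside : ∀ t ∈ Icc 0 T,
      (∀ r, 0 < r → r * ‖Z t‖ < δ → X x t + r • perp (Z t) ∉ frontier (Ω t)) ∧
      ((∀ r, 0 < r → r * ‖Z t‖ < δ → X x t + r • perp (Z t) ∈ Ω t) ∨
        ∀ r, 0 < r → r * ‖Z t‖ < δ → X x t + r • perp (Z t) ∉ Ω t) := by
    intro t ht
    have hc := H.curve t ht
    obtain ⟨s, hs⟩ := hc.exists_eq (Φ.trajectory x t ht).2
    rw [← hs]
    refine hc.side_of_almost_tangent hδ hδℓ (hac t ht) (H.patch t ht) (hZ0 t ht) ?_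
    -- The derivative of the flow is a limit of chords of the curve at time `t`, which are nearly
    -- tangent by `HolderCurve.flat`.
    have hq := Φ.tendsto_flowQuot x ht
    have hn : ∀ᶠ h : ℝ in 𝓝[≠] 0, ‖X (x + h) t - X x t‖ < δ := by
      have h1 : Tendsto (fun h : ℝ => E * |h|) (𝓝 0) (𝓝 (E * |0|)) :=
        (continuous_const.mul continuous_abs).tendsto 0
      rw [abs_zero, mul_zero] at h1
      filter_upwards [(h1.mono_left nhdsWithin_le_nhds).eventually_lt_const hδ] with h hh
      have h2 := Φ.norm_sub_le (x + h) x ht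
      rw [add_sub_cancel_left] at h2
      linarith
    refine le_of_tendsto_of_tendsto ((tendsto_const_nhds.inner hq).abs) (hq.norm.const_mul (1 / 4))
      (hn.mono fun h hh => ?_)
    rw [← hs] at hh
    have := (hc.flat hδℓ (hac t ht) (Φ.trajectory (x + h) t ht).2 hh).1
    simp only [flowQuot, inner_smul_right, abs_mul, norm_smul, Real.norm_eq_abs]
    rw [hs] at this
    calc _ ≤ |h⁻¹| * (1 / 4 * ‖X (x + h) t - X x t‖) := by gcongr
      _ = _ := by ring
  -- A single `r` is admissible for all times because `‖Z t‖ ≤ E`. The point at height `r` moves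
  -- continuously and never meets the boundary, so it remains on the side where it starts.
  set r := δ / (2 * E) with hr
  have hr0 : 0 < r := by positivity
  have hrZ : ∀ t ∈ Icc 0 T, r * ‖Z t‖ < δ := by
    intro t ht
    calc r * ‖Z t‖ ≤ r * E := by gcongr; exact hZE t ht
      _ = δ / 2 := by rw [hr]; field_simp
      _ < δ := by linarith
  have hZc : ContinuousOn Z (Icc 0 T) := by
    refine LipschitzOnWith.continuousOn (K := (K * E).toNNReal)
      (LipschitzOnWith.of_dist_le_mul fun s hs s' hs' => ?_)
    rw [dist_eq_norm, Real.dist_eq,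
      Real.coe_toNNReal _ (mul_nonneg (by linarith [Φ.one_le]) hE0.le)]
    exact Φ.norm_deriv_flow_sub_le x hs hs'
  have hYc : ContinuousOn (fun t => X x t + r • perp (Z t)) (Icc 0 T) :=
    ContinuousOn.add (fun s hs => (Φ.trajectory x s hs).1.continuousWithinAt)
      ((continuous_perp.comp_continuousOn hZc).const_smul r)
  have hconst : ∀ s s' : Icc 0 T, (X x s + r • perp (Z s) ∈ Ω s ↔ X x s' + r • perp (Z s') ∈ Ω s') := by
    have : PreconnectedSpace (Icc 0 T) := Subtype.preconnectedSpace isPreconnected_Icc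
    refine forall_iff_of_eventually_iff (p := fun s : Icc 0 T => X x s + r • perp (Z s) ∈ Ω s)
      fun ⟨s, hs⟩ => ?_
    have h1 := H.eventually_mem_iff hs ((hside s hs).1 r hr0 (hrZ s hs))
    have h2 : Tendsto (fun s' => (X x s' + r • perp (Z s'), s')) (𝓝[Icc 0 T] s)
        (𝓝 (X x s + r • perp (Z s)) ×ˢ 𝓝[Icc 0 T] s) := Tendsto.prodMk (hYc s hs) tendsto_id
    have h3 := h2.eventually h1
    rw [nhdsWithin_eq_map_subtype_coe hs, eventually_map] at h3
    exact h3.mono fun s' hs' => hs'.2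
  have hstart : X x 0 + r • perp (Z 0) ∈ Ω 0 := by
    have hz0 : Z 0 = deriv γ₀ x := by
      simp only [hZ]; congr 1; funext y; exact Φ.initial y
    rcases (hside 0 Φ.zero_mem).2 with hin | hout
    · exact hin r hr0 (hrZ 0 Φ.zero_mem)
    · exfalso
      have hlt : ∀ᶠ ε : ℝ in 𝓝[>] 0, ε < r := Iio_mem_nhds hr0 |> nhdsWithin_le_nhds
      obtain ⟨ε, ⟨hε1, hε2⟩, hε0⟩ := (((h0.counterclockwise x).and hlt).and
        self_mem_nhdsWithin).exists
      refine hout ε hε0 (lt_of_le_of_lt ?_ (hrZ 0 Φ.zero_mem)) ?_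
      · gcongr
      · rw [hz0, Φ.initial]; exact hε1
  have hin := (hconst ⟨0, Φ.zero_mem⟩ ⟨t, ht⟩).1 hstart
  rcases (hside t ht).2 with hall | hout
  · have hlt : ∀ᶠ ε : ℝ in 𝓝[>] 0, ε < r := Iio_mem_nhds hr0 |> nhdsWithin_le_nhds
    filter_upwards [hlt, self_mem_nhdsWithin] with ε hε hε0
    refine hall ε hε0 (lt_of_le_of_lt ?_ (hrZ t ht))
    gcongr
  · exact absurd hin (hout r hr0 (hrZ t ht))

end MovingCurve


/-! ### From the Sobolev hypotheses to uniform Hölder constants, and conclusion -/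

lemma one_div_toReal_lt {α : ℝ} (hα₁ : α < 1 / 2) {p : ℝ≥0∞}
    (hp : ENNReal.ofReal (1 / (1 - 2 * α)) < p) : (1 / p).toReal < 1 - 2 * α := by
  have h1 : 0 < 1 - 2 * α := by linarith
  rcases eq_or_ne p ⊤ with rfl | hpt
  · simpa using h1
  · have h2 : 1 / (1 - 2 * α) < p.toReal := (ENNReal.ofReal_lt_iff_lt_toReal (by positivity) hpt).1 hp
    rw [one_div, ENNReal.toReal_inv]
    rw [one_div] at h2
    exact inv_lt_of_inv_lt₀ h1 h2

lemma one_le_of_lt {α : ℝ} (hα₀ : 0 < α) (hα₁ : α < 1 / 2) {p : ℝ≥0∞}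
    (hp : ENNReal.ofReal (1 / (1 - 2 * α)) < p) : 1 ≤ p := by
  refine le_trans ?_ hp.le
  rw [ENNReal.one_le_ofReal, le_div_iff₀ (by linarith)]
  linarith

lemma IsW2pAlphaPatch.exists_movingCurve {α T : ℝ} {p : ℝ≥0∞} {Ω : ℝ → Set Plane}
    (hΩ : IsW2pAlphaPatch α T p Ω) (hΩc : BoundaryContinuous T Ω) (hp : 1 ≤ p)
    (hβ : 0 < 1 - (1 / p).toReal) :
    ∃ M ℓ L Γ, MovingCurve (1 - (1 / p).toReal) M ℓ T Ω L Γ := by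
  set S := ⨆ t ∈ Icc 0 T, domainW2pNorm p (Ω t) with hS
  have hST : S < ⊤ := hΩ.sup_norm_lt_top
  -- The extra `1` makes the inequality strict, so that the infimum defining the norm yields an
  -- actual parametrization below `M₁` at each time.
  set M₁ := S.toReal + 1 with hM₁
  have hM₁0 : 0 < M₁ := by positivity
  have hSM : S < ENNReal.ofReal M₁ := (ENNReal.lt_ofReal_iff_toReal_lt hST.ne).2 (by linarith)
  have hex : ∀ t ∈ Icc 0 T, ∃ L Γ, IsArcLengthParametrization L Γ (Ω t) ∧
      w2pNorm p L Γ < ENNReal.ofReal M₁ := by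
    intro t ht
    have h1 : domainW2pNorm p (Ω t) < ENNReal.ofReal M₁ :=
      (le_iSup₂ (f := fun t (_ : t ∈ Icc 0 T) => domainW2pNorm p (Ω t)) t ht).trans_lt hSM
    simp only [domainW2pNorm, iInf_lt_iff] at h1
    obtain ⟨L, Γ, h2, h3⟩ := h1
    exact ⟨L, Γ, h2, h3⟩
  choose! L Γ hL hΓ using hex
  obtain ⟨l, hl, -, hlM⟩ := exists_small_scale hβ (2 * M₁) one_pos (show (0 : ℝ) < 1 / 8 by norm_num)
  refine ⟨2 * M₁, l, L, Γ, hΩ.isPatchDomain, fun t ht => ⟨hL t ht, hβ, ?_, by positivity, hl,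
    fun u hu => le_trans ?_ hlM, fun s s' => ?_⟩, hΩc⟩
  · linarith [ENNReal.toReal_nonneg (a := 1 / p)]
  · have : |u| ≤ 3 * l := by linarith
    gcongr
  · exact holder_of_w2pNorm_lt hp (hL t ht).length_pos (hL t ht).contDiff (hL t ht).periodic
      (hΓ t ht) s s'

lemma IsParametrization.exists_holder {L σ : ℝ} {p : ℝ≥0∞} {γ₀ : ℝ → Plane} {Ω : Set Plane}
    (h : IsParametrization L γ₀ Ω) (hL : 0 < L) (hp : 1 ≤ p) (hγ : w2pNorm p L γ₀ < ⊤) (hσ : 0 < σ)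
    (hσp : σ ≤ 1 - (1 / p).toReal) : ∃ M₀ > 0, (∀ x, ‖deriv γ₀ x‖ ≤ M₀) ∧
      ∀ x y, ‖deriv γ₀ x - deriv γ₀ y‖ ≤ M₀ * |x - y| ^ σ := by
  set M₁ := (w2pNorm p L γ₀).toReal + 1 with hM₁
  have hM₁0 : 0 < M₁ := by positivity
  have hlt : w2pNorm p L γ₀ < ENNReal.ofReal M₁ :=
    (ENNReal.lt_ofReal_iff_toReal_lt hγ.ne).2 (by linarith)
  have hh := holder_of_w2pNorm_lt hp hL h.contDiff h.periodic hlt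
  obtain ⟨B, hB⟩ := exists_norm_le_of_periodic (h.contDiff.continuous_deriv le_rfl) hL
    (periodic_deriv h.periodic)
  have hB0 : 0 ≤ B := (norm_nonneg _).trans (hB 0)
  exact ⟨2 * M₁ + 2 * B, by positivity, fun x => (hB x).trans (by linarith),
    holder_of_le hσ hσp (by positivity) hB hh⟩

end AlphaPatch

theorem theorem3p7 (α : ℝ) (hα₀ : 0 < α) (hα₁ : α < 1 / 2)
    (p : ℝ≥0∞) (hp : ENNReal.ofReal (1 / (1 - 2 * α)) < p)
    (T : ℝ) (hT : 0 < T) (Ω : ℝ → Set AlphaPatch.Plane)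
    (hΩ : AlphaPatch.IsW2pAlphaPatch α T p Ω)
    (hΩc : AlphaPatch.BoundaryContinuous T Ω)
    (γ₀ : ℝ → AlphaPatch.Plane)
    (hγ₀ : AlphaPatch.IsParametrization (2 * Real.pi) γ₀ (Ω 0))
    (hγ₀p : AlphaPatch.w2pNorm p (2 * Real.pi) γ₀ < ⊤)
    (σ : ℝ) (hσ : σ = 1 - (1 / p).toReal - 2 * α) :
    0 < σ ∧
    ∃ γ : ℝ → ℝ → AlphaPatch.Plane,
      AlphaPatch.IsContinuousC1Holder T σ γ ∧
      AlphaPatch.SolvesFlow α T Ω γ₀ γ ∧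
      (∀ t ∈ Icc 0 T,
        AlphaPatch.IsParametrization (2 * Real.pi) (fun x => γ x t) (Ω t)) ∧
      ∀ γ' : ℝ → ℝ → AlphaPatch.Plane,
        AlphaPatch.IsContinuousC1Holder T σ γ' →
        AlphaPatch.SolvesFlow α T Ω γ₀ γ' →
        ∀ x, ∀ t ∈ Icc 0 T, γ' x t = γ x t := by
  have hp' := AlphaPatch.one_div_toReal_lt hα₁ hp
  have hp1 := AlphaPatch.one_le_of_lt hα₀ hα₁ hp
  have hσ0 : 0 < σ := by linarith
  refine ⟨hσ0, ?_⟩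
  obtain ⟨M, ℓ, L, Γ, H⟩ := hΩ.exists_movingCurve hΩc hp1 (by linarith)
  obtain ⟨K, F⟩ := H.exists_flowFamily hT.le hα₀ hα₁ (by linarith) hΩ.toIsAlphaPatch
  rw [← hσ] at F
  obtain ⟨M₀, hM₀, hd, hh⟩ := hγ₀.exists_holder (by positivity) hp1 hγ₀p hσ0 (by linarith)
  have hmem : ∀ x, γ₀ x ∈ frontier (Ω 0) := fun x => hγ₀.range_eq ▸ mem_range_self x
  choose X hX0 hX using fun x => F.exists_flow hT.le (hmem x)
  have Φ : AlphaPatch.FlowMap T σ K M₀ (fun t => frontier (Ω t)) (AlphaPatch.velocity α Ω) γ₀ X :=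
    ⟨F, hT.le, hX, hX0, hγ₀.contDiff, hM₀, hd, hh⟩
  refine ⟨X, Φ.isContinuousC1Holder hγ₀.periodic, ⟨hX0, fun x t ht => (hX x t ht).1⟩,
    fun t ht => ⟨Φ.contDiff_flow ht, Φ.periodic hγ₀.periodic ht, fun x hx => ?_,
      Φ.injOn hγ₀.injOn ht, Φ.range_flow hγ₀.range_eq ht, fun x =>
        H.eventually_add_smul_perp_mem Φ hγ₀ x ht⟩, fun γ' _ hγ' x t ht => ?_⟩
  · have := Φ.norm_deriv_initial_le x ht
    rw [hx, norm_zero, mul_zero] at this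
    exact hγ₀.deriv_ne_zero x (norm_le_zero_iff.1 this)
  -- A competing solution is first confined to the boundary; only there is the Lipschitz bound that
  -- gives uniqueness available.
  · have hm := F.mem_of_flow (X := γ' x) (hγ'.flow x) (by rw [hγ'.initial]; exact hmem x)
    exact F.eq_of_eq_zero (fun s hs => ⟨hγ'.flow x s hs, hm s hs⟩) (hX x)
      (by rw [hγ'.initial, hX0]) ht
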